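/- Write $\mathbb R^3_\pm=\{x\in\mathbb R^3 : \pm x_3>0\}$. Let $\gamma_+,\gamma_->0$ be constants with $\gamma_+\neq\gamma_-$, and let $\gamma_0(x)=\gamma_\pm I_3$ for $\pm x_3>0$. Let $D$ be a non-empty bounded measurable set with $\overline D\subset\mathbb R^3_-$ and $\mathbb R^3_-\setminus D$ connected, and let $B$ be a non-empty bounded open set with $\overline B\subset\mathbb R^3_+$. Let $\gamma\in L^\infty(\mathbb R^3;\mathbb R^{3\times3})$ be symmetric with $\gamma(x)\xi\cdot\xi\ge c_0|\xi|^2$ for a.e. $x$ and all $\xi\in\mathbb R^3$, for some $c_0>0$, and let $\gamma=\gamma_0$ a.e. outside $D$. The monotonicity conditions are $(M)_{\gamma_0,+}$: there is $c>0$ with $\gamma(x)\geq(\gamma_-+c)I_3$ for a.e. $x\in D$; $(M)_{\gamma_0,-}$: there is $c>0$ with $\gamma(x)\leq(\gamma_--c)I_3$ for a.e. $x\in D$. Let $f\in L^2(\mathbb R^3)$ satisfy $\operatorname{supp}f\subset\overline B$ and, for some $c_1>0$, either $f\ge c_1$ a.e. on $B$ or $-f\geq c_1$ a.e. on $B$.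 Let $T>0$, and let $u$ be the weak solution of $\partial_t^2u-\operatorname{div}(\gamma\nabla u)=0$ in $(0,T)\times\mathbb R^3$, $u(0,\cdot)=0$, $\partial_tu(0,\cdot)=f$; that is, $u\in L^2(0,T;H^1(\mathbb R^3))$, $\partial_tu\in L^2(0,T;L^2(\mathbb R^3))$, $\partial_t^2u\in L^2(0,T;(H^1(\mathbb R^3))')$ and $\langle\partial_t^2u(t,\cdot),\phi\rangle+\int_{\mathbb R^3}\gamma\nabla u(t,x)\cdot\nabla\phi\,dx=0$ for a.e. $t\in(0,T)$ and all $\phi\in H^1(\mathbb R^3)$. For $\tau\geq1$ let $v(\cdot;\tau)\in H^1(\mathbb R^3)$ be the weak solution of $\operatorname{div}(\gamma_0\nabla v)-\tau^2v+f=0$ in $\mathbb R^3$, and put $$w(x;\tau)=\int_0^Te^{-\tau t}u(t,x)\,dt,\qquad I_\tau=\int_{\mathbb R^3}f(x)\,\bigl(w(x;\tau)-v(x;\tau)\bigr)\,dx .$$ For $x\in\mathbb R^3_-$ and $y\in\mathbb R^3_+$ let $$l(x,y)=\inf_{z'\in\mathbb R^2}\Bigl(\tfrac1{\sqrt{\gamma_-}}|(z',0)-x|+\tfrac1{\sqrt{\gamma_+}}|(z',0)-y|\Bigr),\qquad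 l(D,B)=\inf_{x\in D,\,y\in B}l(x,y).$$ A set $A\subset\mathbb R^3$ satisfies condition (C) if for every $x\in\partial A$ there are a unit vector $n$, $h>0$ and $\theta\in(0,\pi)$ such that $\{y : 0<|y-x|\le h,\ (y-x)\cdot n\ge|y-x|\cos\theta\}\subset A$. Suppose that either (a) $D$ has $C^1$ boundary and $B$ satisfies (C), or (b) $D$ and $B$ satisfy (C) and $B$ is convex. Then: (i) if $T<2l(D,B)$, then $\lim_{\tau\to\infty}e^{\tau T}I_\tau=0$; (ii) if $T>2l(D,B)$, then $\lim_{\tau\to\infty}e^{\tau T}I_\tau=-\infty$ under $(M)_{\gamma_0,+}$, and $\lim_{\tau\to\infty}e^{\tau T}I_\tau=+\infty$ under $(M)_{\gamma_0,-}$; (iii) if $T>2l(D,B)$ and either $(M)_{\gamma_0,+}$ or $(M)_{\gamma_0,-}$ holds, then $\lim_{\tau\to\infty}\frac1\tau\log|I_\tau|=-2l(D,B)$. -/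

import Mathlib

open MeasureTheory Set Filter Topology
open scoped ContDiff Matrix

noncomputable section

namespace TwoLayer

/-- Three-dimensional Euclidean space; the coordinates `x₁, x₂, x₃` are `x 0, x 1, x 2`. -/
abbrev E3 : Type := EuclideanSpace ℝ (Fin 3)

/-- The real space `L²(ℝ³)`. -/
abbrev L2 : Type := Lp ℝ 2 (volume : Measure E3)

/-- The space `L²(ℝ³; ℝ³)` of square integrable vector fields. -/
abbrev L2Vec : Type := Lp E3 2 (volume : Measure E3)

/-! ### The Sobolev space `H¹(ℝ³)` -/

/-- `G` is the weak (distributional) gradient of `u`. -/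
def IsWeakGradient (u : L2) (G : L2Vec) : Prop :=
  ∀ ψ : E3 → ℝ, ContDiff ℝ ∞ ψ → HasCompactSupport ψ → ∀ i : Fin 3,
    ∫ x, u x * fderiv ℝ ψ x (EuclideanSpace.single i 1) = - ∫ x, G x i * ψ x

lemma memLp_test_deriv {ψ : E3 → ℝ} (h : ContDiff ℝ ∞ ψ) (hc : HasCompactSupport ψ)
    (e : E3) : MemLp (fun x => fderiv ℝ ψ x e) 2 volume := by
  have hcont : Continuous (fun x => fderiv ℝ ψ x e) :=
    (h.continuous_fderiv (by simp)).clm_apply continuous_const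
  exact hcont.memLp_of_hasCompactSupport (hc.fderiv_apply (𝕜 := ℝ) e)

lemma memLp_test {ψ : E3 → ℝ} (h : ContDiff ℝ ∞ ψ) (hc : HasCompactSupport ψ) :
    MemLp ψ 2 (volume : Measure E3) :=
  h.continuous.memLp_of_hasCompactSupport hc

lemma memLp_coord (G : L2Vec) (i : Fin 3) :
    MemLp (fun x => G x i) 2 (volume : Measure E3) :=
  (EuclideanSpace.proj i : E3 →L[ℝ] ℝ).comp_memLp' (Lp.memLp G)

/-- `H¹(ℝ³)`: the pairs `(u, ∇u)` of an `L²` function and its weak gradient in `L²`, with the norm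
`(‖u‖² + ‖∇u‖²)^{1/2}`. -/
def H1 : Submodule ℝ (WithLp 2 (L2 × L2Vec)) where
  carrier := {p | IsWeakGradient p.fst p.snd}
  zero_mem' := by
    intro ψ h hc i
    have h1 : (fun x => (0 : L2) x * fderiv ℝ ψ x (EuclideanSpace.single i 1))
        =ᵐ[volume] fun _ => (0 : ℝ) := by
      filter_upwards [Lp.coeFn_zero ℝ 2 (volume : Measure E3)] with x hx
      rw [hx, Pi.zero_apply, zero_mul]
    have h2 : (fun x => (0 : L2Vec) x i * ψ x) =ᵐ[volume] fun _ => (0 : ℝ) := by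
      filter_upwards [Lp.coeFn_zero E3 2 (volume : Measure E3)] with x hx
      rw [hx, Pi.zero_apply, PiLp.zero_apply, zero_mul]
    change ∫ x, (0 : L2) x * _ = - ∫ x, (0 : L2Vec) x i * ψ x
    rw [integral_congr_ae h1, integral_congr_ae h2]
    simp
  add_mem' := by
    intro p q hp hq ψ h hc i
    have hd := memLp_test_deriv h hc (EuclideanSpace.single i 1)
    have ht := memLp_test h hc
    have h1 : (fun x => (p.fst + q.fst : L2) x * fderiv ℝ ψ x (EuclideanSpace.single i 1))
        =ᵐ[volume] fun x => p.fst x * fderiv ℝ ψ x (EuclideanSpace.single i 1)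
          + q.fst x * fderiv ℝ ψ x (EuclideanSpace.single i 1) := by
      filter_upwards [Lp.coeFn_add p.fst q.fst] with x hx
      rw [hx, Pi.add_apply, add_mul]
    have h2 : (fun x => (p.snd + q.snd : L2Vec) x i * ψ x)
        =ᵐ[volume] fun x => p.snd x i * ψ x + q.snd x i * ψ x := by
      filter_upwards [Lp.coeFn_add p.snd q.snd] with x hx
      rw [hx, Pi.add_apply, PiLp.add_apply, add_mul]
    change ∫ x, (p.fst + q.fst : L2) x * _ = - ∫ x, (p.snd + q.snd : L2Vec) x i * ψ x
    have e1 := integral_add ((Lp.memLp p.fst).integrable_mul hd)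
      ((Lp.memLp q.fst).integrable_mul hd)
    have e2 := integral_add ((memLp_coord p.snd i).integrable_mul ht)
      ((memLp_coord q.snd i).integrable_mul ht)
    simp only [Pi.mul_apply] at e1 e2
    rw [integral_congr_ae h1, integral_congr_ae h2, e1, e2, hp ψ h hc i, hq ψ h hc i]
    ring
  smul_mem' := by
    intro c p hp ψ h hc i
    have h1 : (fun x => (c • p.fst : L2) x * fderiv ℝ ψ x (EuclideanSpace.single i 1))
        =ᵐ[volume] fun x => c * (p.fst x * fderiv ℝ ψ x (EuclideanSpace.single i 1)) := by
      filter_upwards [Lp.coeFn_smul c p.fst] with x hx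
      rw [hx, Pi.smul_apply, smul_eq_mul, mul_assoc]
    have h2 : (fun x => (c • p.snd : L2Vec) x i * ψ x)
        =ᵐ[volume] fun x => c * (p.snd x i * ψ x) := by
      filter_upwards [Lp.coeFn_smul c p.snd] with x hx
      rw [hx, Pi.smul_apply, PiLp.smul_apply, smul_eq_mul, mul_assoc]
    change ∫ x, (c • p.fst : L2) x * _ = - ∫ x, (c • p.snd : L2Vec) x i * ψ x
    rw [integral_congr_ae h1, integral_congr_ae h2, integral_const_mul, integral_const_mul,
      hp ψ h hc i]
    ring

/-- The inclusion `H¹(ℝ³) → L²(ℝ³)`. -/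
def toL2 : H1 →L[ℝ] L2 := (WithLp.fstL 2 ℝ L2 L2Vec).comp H1.subtypeL

/-- The weak gradient `H¹(ℝ³) → L²(ℝ³; ℝ³)`. -/
def grad : H1 →L[ℝ] L2Vec := (WithLp.sndL 2 ℝ L2 L2Vec).comp H1.subtypeL

/-- The embedding `L²(ℝ³) → (H¹(ℝ³))'`, `g ↦ (φ ↦ ∫ g φ dx)`. -/
def toDual (g : L2) : StrongDual ℝ H1 := (innerSL ℝ g).comp toL2

/-- The bilinear form `∫ γ ∇u · ∇φ dx` of the operator `-L_γ = -div(γ ∇ ·)`. -/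
def form (γ : E3 → Matrix (Fin 3) (Fin 3) ℝ) (u φ : H1) : ℝ :=
  ∫ x, ∑ i, ∑ j, γ x i j * grad u x j * grad φ x i

/-! ### Coefficients -/

/-- The coefficient `γ₀` of the two-layered medium: `γ₊ I₃` above and `γ₋ I₃` below the plane
`x₃ = 0`. -/
def layered (γp γm : ℝ) (x : E3) : Matrix (Fin 3) (Fin 3) ℝ :=
  if 0 < x 2 then γp • (1 : Matrix (Fin 3) (Fin 3) ℝ) else γm • (1 : Matrix (Fin 3) (Fin 3) ℝ)

/-- A symmetric, essentially bounded, uniformly positive definite coefficient matrix. -/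
structure IsCoefficient (γ : E3 → Matrix (Fin 3) (Fin 3) ℝ) : Prop where
  memLp : ∀ i j, MemLp (fun x => γ x i j) ⊤ (volume : Measure E3)
  symm : ∀ᵐ x : E3, (γ x).IsSymm
  elliptic : ∃ c₀ : ℝ, 0 < c₀ ∧ ∀ᵐ x : E3, ∀ ξ : Fin 3 → ℝ, c₀ * (ξ ⬝ᵥ ξ) ≤ ξ ⬝ᵥ (γ x *ᵥ ξ)

/-- The monotonicity condition `inf_{x ∈ D} γ(x) > γ₋ I₃`. -/
def MonoPlus (γ : E3 → Matrix (Fin 3) (Fin 3) ℝ) (D : Set E3) (γm : ℝ) : Prop :=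
  ∃ c : ℝ, 0 < c ∧ ∀ᵐ x : E3, x ∈ D →
    ∀ ξ : Fin 3 → ℝ, (γm + c) * (ξ ⬝ᵥ ξ) ≤ ξ ⬝ᵥ (γ x *ᵥ ξ)

/-- The monotonicity condition `sup_{x ∈ D} γ(x) < γ₋ I₃`. -/
def MonoMinus (γ : E3 → Matrix (Fin 3) (Fin 3) ℝ) (D : Set E3) (γm : ℝ) : Prop :=
  ∃ c : ℝ, 0 < c ∧ ∀ᵐ x : E3, x ∈ D →
    ∀ ξ : Fin 3 → ℝ, ξ ⬝ᵥ (γ x *ᵥ ξ) ≤ (γm - c) * (ξ ⬝ᵥ ξ)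

/-! ### Geometry of the inclusion and of the observation set -/

/-- The cone with vertex `x`, direction `n`, radius `h` and opening angle `θ`. -/
def cone (x n : E3) (h θ : ℝ) : Set E3 :=
  {y | ‖y - x‖ ≤ h ∧ ‖y - x‖ * Real.cos θ ≤ inner ℝ (y - x) n}

/-- Condition (C): every boundary point is the vertex of a cone that lies, apart from its vertex,
in the set. -/
def ConeCondition (A : Set E3) : Prop :=
  ∀ x ∈ frontier A, ∃ (n : E3) (h θ : ℝ), ‖n‖ = 1 ∧ 0 < h ∧ 0 < θ ∧ θ < Real.pi ∧
    cone x n h θ \ {x} ⊆ A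

/-- `A` has `C¹` boundary: near every boundary point there is a `C¹` function `φ` without critical
points such that `A` is the region `φ < 0`, up to points of the boundary surface `φ = 0`
(which belong to `A` or not; if `A` is open they do not). -/
def HasC1Boundary (A : Set E3) : Prop :=
  ∀ x ∈ frontier A, ∃ (U : Set E3) (φ : E3 → ℝ), IsOpen U ∧ x ∈ U ∧ ContDiffOn ℝ 1 φ U ∧
    (∀ y ∈ U, fderiv ℝ φ y ≠ 0) ∧ (∀ y ∈ U, φ y < 0 → y ∈ A) ∧ (∀ y ∈ U, 0 < φ y → y ∉ A)

/-- Travel time `l_{x,y}(z')` along the broken path from `x` through `(z', 0)` to `y`. -/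
def pathLength (γp γm : ℝ) (x y : E3) (z : EuclideanSpace ℝ (Fin 2)) : ℝ :=
  1 / √γm * ‖(!₂[z 0, z 1, 0] : E3) - x‖ + 1 / √γp * ‖(!₂[z 0, z 1, 0] : E3) - y‖

/-- The optical distance `l(x, y)` of two points. -/
def opticalDist (γp γm : ℝ) (x y : E3) : ℝ :=
  ⨅ z : EuclideanSpace ℝ (Fin 2), pathLength γp γm x y z

/-- The optical distance `l(D, B)` of two sets. -/
def opticalSetDist (γp γm : ℝ) (D B : Set E3) : ℝ :=
  ⨅ p : D × B, opticalDist γp γm p.1 p.2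

/-- The emission condition on `B`: `supp f ⊆ closure B`, and `f ≥ c₁ > 0` on `B` or `-f ≥ c₁ > 0`
on `B`. -/
def EmissionCondition (B : Set E3) (f : L2) : Prop :=
  (∀ᵐ x : E3, x ∉ closure B → f x = 0) ∧
  ∃ c₁ : ℝ, 0 < c₁ ∧ ((∀ᵐ x : E3, x ∈ B → c₁ ≤ f x) ∨ (∀ᵐ x : E3, x ∈ B → c₁ ≤ - f x))

/-! ### Solutions and the indicator function -/

/-- `u` is, on `(0, T)`, the absolutely continuous function with initial value `a` and
derivative `u'` (in the sense of distributions with values in `X`). -/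
def IsPrimitive {X : Type*} [NormedAddCommGroup X] [NormedSpace ℝ X]
    (T : ℝ) (a : X) (u u' : ℝ → X) : Prop :=
  ∀ᵐ t ∂(volume.restrict (Ioo 0 T)), u t = a + ∫ s in (0 : ℝ)..t, u' s

/-- Weak solutions of `∂ₜ²u - L_γ u = 0` in `(0, T) × ℝ³`, `u(0) = 0`, `∂ₜu(0) = f`:
`u ∈ L²(0,T;H¹)`, `∂ₜu ∈ L²(0,T;L²)`, `∂ₜ²u ∈ L²(0,T;(H¹)')`, and
`⟨∂ₜ²u(t), φ⟩ + ∫ γ ∇u(t) · ∇φ dx = 0` for a.e. `t ∈ (0, T)` and all `φ ∈ H¹`. -/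
def IsWaveSolution (γ : E3 → Matrix (Fin 3) (Fin 3) ℝ) (T : ℝ) (f : L2) (u : ℝ → H1) : Prop :=
  MemLp u 2 (volume.restrict (Ioo 0 T)) ∧
  ∃ (u₁ : ℝ → L2) (u₂ : ℝ → StrongDual ℝ H1),
    MemLp u₁ 2 (volume.restrict (Ioo 0 T)) ∧
    MemLp u₂ 2 (volume.restrict (Ioo 0 T)) ∧
    IsPrimitive T 0 (fun t => toL2 (u t)) u₁ ∧
    IsPrimitive T (toDual f) (fun t => toDual (u₁ t)) u₂ ∧
    ∀ᵐ t ∂(volume.restrict (Ioo 0 T)), ∀ φ : H1, u₂ t φ + form γ (u t) φ = 0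

/-- Weak solutions `v ∈ H¹` of `(L_γ - τ²) v + f = 0` in `ℝ³`. -/
def IsResolventSolution (γ : E3 → Matrix (Fin 3) (Fin 3) ℝ) (τ : ℝ) (f : L2) (v : H1) : Prop :=
  ∀ φ : H1, form γ v φ + τ ^ 2 * ∫ x, toL2 v x * toL2 φ x = ∫ x, f x * toL2 φ x

/-- `w(·; τ) = ∫₀ᵀ e^{-τt} u(t, ·) dt`. -/
def laplaceT (T : ℝ) (u : ℝ → H1) (τ : ℝ) : L2 :=
  ∫ t in (0 : ℝ)..T, Real.exp (-(τ * t)) • toL2 (u t)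

/-- The indicator function `I_τ = ∫ f (w(·; τ) - v(·; τ)) dx`. -/
def indicatorFn (T : ℝ) (f : L2) (u v : ℝ → H1) (τ : ℝ) : ℝ :=
  ∫ x, f x * (laplaceT T u τ x - toL2 (v τ) x)

end TwoLayer

end

noncomputable section

namespace TwoLayer

/-! ### Quadratic forms and the energy form -/

/-! A Laplace transform in time turns the wave equation into the resolvent equation with boundary
terms at `t = T`. These carry the factor `e^{-τT}`, and after pairing with a resolvent solution they
are `O(e^{-τT}/τ)` (`exists_laplaceT_error`). Up to this error `I_τ` is `J_τ = ⟨f, V⟩ - ⟨f, v⟩`,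
where `V` and `v` solve the resolvent problem for `γ` and `γ₀`. A variational comparison bounds
`|J_τ|` by a multiple of the energy `E_τ = ∫_D |∇v|²`; under either monotonicity condition `J_τ`
also has a definite sign and size at least a multiple of `E_τ` (`exists_indicatorFn_approx`). The
three assertions then follow once `E_τ` is known to decay like `e^{-2 l(D,B) τ}`, up to an
arbitrarily small loss in the exponent.

The upper bound (`exists_energyOn_le`) is an Agmon estimate: testing with `ρ²v`, where `√γ₀ |∇ρ| ≤
κτρ` and `κ < 1`, compares the weighted energy in `D` with the weight on `B`. The weight is built
from phases `d` with `√γ₀ |∇d| ≤ 1` that come from refracted rays. For a given `x` and `y`, Snell's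
law gives slowness vectors with a common horizontal part on the two sides, so a piecewise linear
phase is continuous across the interface and changes between `x` and `y` by the travel time. Finite
nets of `D` and `B` and a smooth max-min combine these phases into one weight.

The lower bound (`exists_energyOn_ge`) uses positivity. For a source of one sign `v` is nonnegative,
and testing the equation with a smoothed radial exponential barrier shows that mass of `v` near one
point forces mass near another, at the exponential cost of the travel time
(`IsSuperFamily.exists_integral_ball_le`). Such steps are chained along a broken path. At the
interface the jump term in the integration by parts has the right sign when mass moves from the
slower to the faster medium. If the upper medium is the faster one, the argument runs upwards from
an artificial source in `D`, and reciprocity of the resolvent carries the result back. Since `f = 0`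
on `D`, averages of `v` over `D` are controlled by `E_τ`.

The boundary regularity enters through two consequences: `D` lies in the closure of its interior,
and `∂B` is a null set. -/

/-- The bilinear form `Mξ · ζ`. -/
def quad (M : Matrix (Fin 3) (Fin 3) ℝ) (ξ ζ : E3) : ℝ := ∑ i, ∑ j, M i j * ξ j * ζ i

lemma form_eq (γ : E3 → Matrix (Fin 3) (Fin 3) ℝ) (u φ : H1) :
    form γ u φ = ∫ x, quad (γ x) (grad u x) (grad φ x) := rfl

lemma dotProduct_mulVec_eq_quad (M : Matrix (Fin 3) (Fin 3) ℝ) (ξ : E3) :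
    (ξ : Fin 3 → ℝ) ⬝ᵥ (M *ᵥ (ξ : Fin 3 → ℝ)) = quad M ξ ξ := by
  simp only [quad, dotProduct, Matrix.mulVec, Finset.mul_sum]
  refine Finset.sum_congr rfl fun i _ => Finset.sum_congr rfl fun j _ => by ring

lemma dotProduct_self_eq_norm_sq (ξ : E3) : (ξ : Fin 3 → ℝ) ⬝ᵥ (ξ : Fin 3 → ℝ) = ‖ξ‖ ^ 2 := by
  rw [EuclideanSpace.real_norm_sq_eq]
  simp only [dotProduct]
  exact Finset.sum_congr rfl fun i _ => by ring

lemma quad_add_left (M : Matrix (Fin 3) (Fin 3) ℝ) (ξ ξ' ζ : E3) :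
    quad M (ξ + ξ') ζ = quad M ξ ζ + quad M ξ' ζ := by
  simp only [quad, PiLp.add_apply, ← Finset.sum_add_distrib]
  refine Finset.sum_congr rfl fun i _ => Finset.sum_congr rfl fun j _ => by ring

lemma quad_add_right (M : Matrix (Fin 3) (Fin 3) ℝ) (ξ ζ ζ' : E3) :
    quad M ξ (ζ + ζ') = quad M ξ ζ + quad M ξ ζ' := by
  simp only [quad, PiLp.add_apply, ← Finset.sum_add_distrib]
  refine Finset.sum_congr rfl fun i _ => Finset.sum_congr rfl fun j _ => by ring

lemma quad_smul_left (M : Matrix (Fin 3) (Fin 3) ℝ) (c : ℝ) (ξ ζ : E3) :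
    quad M (c • ξ) ζ = c * quad M ξ ζ := by
  simp only [quad, PiLp.smul_apply, smul_eq_mul, Finset.mul_sum]
  refine Finset.sum_congr rfl fun i _ => Finset.sum_congr rfl fun j _ => by ring

lemma quad_smul_right (M : Matrix (Fin 3) (Fin 3) ℝ) (c : ℝ) (ξ ζ : E3) :
    quad M ξ (c • ζ) = c * quad M ξ ζ := by
  simp only [quad, PiLp.smul_apply, smul_eq_mul, Finset.mul_sum]
  refine Finset.sum_congr rfl fun i _ => Finset.sum_congr rfl fun j _ => by ring

lemma quad_comm {M : Matrix (Fin 3) (Fin 3) ℝ} (hM : M.IsSymm) (ξ ζ : E3) :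
    quad M ξ ζ = quad M ζ ξ := by
  simp only [quad]
  rw [Finset.sum_comm]
  refine Finset.sum_congr rfl fun i _ => Finset.sum_congr rfl fun j _ => ?_
  rw [hM.apply i j]
  ring

lemma quad_smul_one (c : ℝ) (ξ ζ : E3) :
    quad (c • (1 : Matrix (Fin 3) (Fin 3) ℝ)) ξ ζ = c * inner ℝ ξ ζ := by
  simp [quad, Fin.sum_univ_three, Matrix.one_apply, PiLp.inner_apply]
  ring

lemma abs_quad_le {M : Matrix (Fin 3) (Fin 3) ℝ} {C : ℝ} (hC : ∀ i j, |M i j| ≤ C) (ξ ζ : E3) :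
    |quad M ξ ζ| ≤ 9 * C * ‖ξ‖ * ‖ζ‖ := by
  have h0 : 0 ≤ C := (abs_nonneg _).trans (hC 0 0)
  calc |quad M ξ ζ| ≤ ∑ i : Fin 3, ∑ j : Fin 3, |M i j * ξ j * ζ i| :=
        (Finset.abs_sum_le_sum_abs _ _).trans
          (Finset.sum_le_sum fun i _ => Finset.abs_sum_le_sum_abs _ _)
    _ ≤ ∑ i : Fin 3, ∑ j : Fin 3, C * ‖ξ‖ * ‖ζ‖ := by
        refine Finset.sum_le_sum fun i _ => Finset.sum_le_sum fun j _ => ?_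
        rw [abs_mul, abs_mul]
        have h1 : |ξ j| ≤ ‖ξ‖ := PiLp.norm_apply_le ξ j
        have h2 : |ζ i| ≤ ‖ζ‖ := PiLp.norm_apply_le ζ i
        have := hC i j
        gcongr
    _ = 9 * C * ‖ξ‖ * ‖ζ‖ := by simp; ring

lemma IsCoefficient.exists_bound {γ : E3 → Matrix (Fin 3) (Fin 3) ℝ} (hγ : IsCoefficient γ) :
    ∃ C : ℝ, 0 < C ∧ ∀ᵐ x : E3, ∀ ξ ζ : E3, |quad (γ x) ξ ζ| ≤ C * ‖ξ‖ * ‖ζ‖ := by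
  have h : ∀ i j, ∃ C : ℝ, ∀ᵐ x : E3, |γ x i j| ≤ C := fun i j => by
    have hfin : eLpNormEssSup (fun x => γ x i j) (volume : Measure E3) ≠ ⊤ := by
      rw [← eLpNorm_exponent_top]
      exact (hγ.memLp i j).2.ne
    refine ⟨(eLpNormEssSup (fun x => γ x i j) (volume : Measure E3)).toReal, ?_⟩
    filter_upwards [ae_le_eLpNormEssSup (f := fun x => γ x i j) (μ := (volume : Measure E3))]
      with x hx
    have := ENNReal.toReal_mono hfin hx
    simpa using this
  choose C hC using h
  have hCpos : 0 ≤ ∑ i, ∑ j, |C i j| :=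
    Finset.sum_nonneg fun i _ => Finset.sum_nonneg fun j _ => abs_nonneg _
  refine ⟨9 * (∑ i, ∑ j, |C i j|) + 1, by linarith, ?_⟩
  have hall : ∀ᵐ x : E3, ∀ i j, |γ x i j| ≤ C i j :=
    ae_all_iff.2 fun i => ae_all_iff.2 fun j => hC i j
  filter_upwards [hall] with x hx ξ ζ
  refine (abs_quad_le (C := ∑ i, ∑ j, |C i j|) (fun i j => ?_) ξ ζ).trans ?_
  · refine (hx i j).trans ((le_abs_self _).trans ?_)
    refine (Finset.single_le_sum (f := fun j => |C i j|) (fun j _ => abs_nonneg _)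
      (Finset.mem_univ j)).trans ?_
    exact Finset.single_le_sum (f := fun i => ∑ j, |C i j|)
      (fun i _ => Finset.sum_nonneg fun j _ => abs_nonneg _) (Finset.mem_univ i)
  · have : 0 ≤ ‖ξ‖ * ‖ζ‖ := by positivity
    nlinarith

lemma integrable_norm_mul_norm (G K : L2Vec) :
    Integrable (fun x => ‖G x‖ * ‖K x‖) (volume : Measure E3) :=
  (Lp.memLp G).norm.integrable_mul (Lp.memLp K).norm

lemma integrable_norm_sq (G : L2Vec) : Integrable (fun x => ‖G x‖ ^ 2) (volume : Measure E3) := by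
  simpa [sq] using integrable_norm_mul_norm G G

lemma integral_norm_sq (G : L2Vec) : ∫ x, ‖G x‖ ^ 2 = ‖G‖ ^ 2 := by
  rw [← real_inner_self_eq_norm_sq, L2.inner_def]
  simp

lemma integral_mul_eq_inner (u w : L2) : ∫ x, u x * w x = inner ℝ u w := by
  rw [L2.inner_def]
  exact integral_congr_ae (ae_of_all _ fun x => by simp [mul_comm])

lemma integral_norm_mul_norm_le {F : Type*} [NormedAddCommGroup F]
    (G K : Lp F 2 (volume : Measure E3)) : ∫ x, ‖G x‖ * ‖K x‖ ≤ ‖G‖ * ‖K‖ := by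
  have h1 : ∫ x, ‖G x‖ * ‖K x‖
      = inner ℝ ((Lp.memLp G).norm.toLp _ : L2) ((Lp.memLp K).norm.toLp _ : L2) := by
    rw [← integral_mul_eq_inner]
    refine integral_congr_ae ?_
    filter_upwards [(Lp.memLp G).norm.coeFn_toLp, (Lp.memLp K).norm.coeFn_toLp] with x h1 h2
    rw [h1, h2]
  have h2 : ∀ G : Lp F 2 (volume : Measure E3),
      ‖((Lp.memLp G).norm.toLp _ : L2)‖ = ‖G‖ := fun G => by
    rw [Lp.norm_toLp, eLpNorm_norm, ← Lp.norm_def]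
  rw [h1, ← h2 G, ← h2 K]
  exact real_inner_le_norm _ _

lemma integrable_quad {γ : E3 → Matrix (Fin 3) (Fin 3) ℝ} (hγ : IsCoefficient γ) (G K : L2Vec) :
    Integrable (fun x => quad (γ x) (G x) (K x)) (volume : Measure E3) := by
  obtain ⟨C, hC, hb⟩ := hγ.exists_bound
  refine Integrable.mono' ((integrable_norm_mul_norm G K).const_mul C) ?_ ?_
  · simp only [quad]
    refine Finset.aestronglyMeasurable_fun_sum _ fun i _ =>
      Finset.aestronglyMeasurable_fun_sum _ fun j _ => ?_
    exact ((hγ.memLp i j).1.mul (memLp_coord G j).1).mul (memLp_coord K i).1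
  · filter_upwards [hb] with x hx
    simpa [mul_assoc] using hx (G x) (K x)

lemma abs_integral_quad_le {γ : E3 → Matrix (Fin 3) (Fin 3) ℝ} {C : ℝ} (hC : 0 ≤ C)
    (hb : ∀ᵐ x : E3, ∀ ξ ζ : E3, |quad (γ x) ξ ζ| ≤ C * ‖ξ‖ * ‖ζ‖) (G K : L2Vec) :
    |∫ x, quad (γ x) (G x) (K x)| ≤ C * ‖G‖ * ‖K‖ := by
  rw [← Real.norm_eq_abs]
  refine (norm_integral_le_of_norm_le ((integrable_norm_mul_norm G K).const_mul C) ?_).trans ?_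
  · filter_upwards [hb] with x hx
    simpa [mul_assoc] using hx (G x) (K x)
  · rw [integral_const_mul, mul_assoc]
    exact mul_le_mul_of_nonneg_left (integral_norm_mul_norm_le G K) hC

lemma form_add_left {γ : E3 → Matrix (Fin 3) (Fin 3) ℝ} (hγ : IsCoefficient γ) (u u' φ : H1) :
    form γ (u + u') φ = form γ u φ + form γ u' φ := by
  simp only [form_eq, map_add]
  rw [← integral_add (integrable_quad hγ _ _) (integrable_quad hγ _ _)]
  refine integral_congr_ae ?_
  filter_upwards [Lp.coeFn_add (grad u) (grad u')] with x hx
  rw [hx, Pi.add_apply, quad_add_left]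

lemma form_add_right {γ : E3 → Matrix (Fin 3) (Fin 3) ℝ} (hγ : IsCoefficient γ) (u φ φ' : H1) :
    form γ u (φ + φ') = form γ u φ + form γ u φ' := by
  simp only [form_eq, map_add]
  rw [← integral_add (integrable_quad hγ _ _) (integrable_quad hγ _ _)]
  refine integral_congr_ae ?_
  filter_upwards [Lp.coeFn_add (grad φ) (grad φ')] with x hx
  rw [hx, Pi.add_apply, quad_add_right]

lemma form_smul_left (γ : E3 → Matrix (Fin 3) (Fin 3) ℝ) (c : ℝ) (u φ : H1) :
    form γ (c • u) φ = c * form γ u φ := by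
  simp only [form_eq, map_smul]
  rw [← integral_const_mul]
  refine integral_congr_ae ?_
  filter_upwards [Lp.coeFn_smul c (grad u)] with x hx
  rw [hx, Pi.smul_apply, quad_smul_left]

lemma form_smul_right (γ : E3 → Matrix (Fin 3) (Fin 3) ℝ) (c : ℝ) (u φ : H1) :
    form γ u (c • φ) = c * form γ u φ := by
  simp only [form_eq, map_smul]
  rw [← integral_const_mul]
  refine integral_congr_ae ?_
  filter_upwards [Lp.coeFn_smul c (grad φ)] with x hx
  rw [hx, Pi.smul_apply, quad_smul_right]

lemma form_comm {γ : E3 → Matrix (Fin 3) (Fin 3) ℝ} (hγ : IsCoefficient γ) (u φ : H1) :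
    form γ u φ = form γ φ u := by
  simp only [form_eq]
  refine integral_congr_ae ?_
  filter_upwards [hγ.symm] with x hx
  exact quad_comm hx _ _

lemma IsCoefficient.exists_form_ge {γ : E3 → Matrix (Fin 3) (Fin 3) ℝ} (hγ : IsCoefficient γ) :
    ∃ c : ℝ, 0 < c ∧ ∀ u : H1, c * ‖grad u‖ ^ 2 ≤ form γ u u := by
  obtain ⟨c, hc, h⟩ := hγ.elliptic
  refine ⟨c, hc, fun u => ?_⟩
  rw [← integral_norm_sq, ← integral_const_mul, form_eq]
  refine integral_mono_ae ((integrable_norm_sq _).const_mul c) (integrable_quad hγ _ _) ?_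
  filter_upwards [h] with x hx
  have := hx (grad u x)
  rwa [dotProduct_self_eq_norm_sq, dotProduct_mulVec_eq_quad] at this

/-- The scalar coefficient of the two-layered medium. -/
def layeredScalar (γp γm : ℝ) (x : E3) : ℝ := if 0 < x 2 then γp else γm

lemma layered_eq_smul (γp γm : ℝ) (x : E3) :
    layered γp γm x = layeredScalar γp γm x • (1 : Matrix (Fin 3) (Fin 3) ℝ) := by
  unfold layered layeredScalar
  split_ifs <;> rfl

lemma quad_layered (γp γm : ℝ) (x ξ ζ : E3) :
    quad (layered γp γm x) ξ ζ = layeredScalar γp γm x * inner ℝ ξ ζ := by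
  rw [layered_eq_smul, quad_smul_one]

lemma measurable_layeredScalar (γp γm : ℝ) : Measurable (layeredScalar γp γm) := by
  unfold layeredScalar
  refine Measurable.ite ?_ measurable_const measurable_const
  exact measurableSet_lt measurable_const (by fun_prop)

lemma layeredScalar_pos {γp γm : ℝ} (hp : 0 < γp) (hm : 0 < γm) (x : E3) :
    0 < layeredScalar γp γm x := by
  unfold layeredScalar
  split_ifs <;> assumption

lemma min_le_layeredScalar (γp γm : ℝ) (x : E3) : min γp γm ≤ layeredScalar γp γm x := by
  unfold layeredScalar
  split_ifs
  exacts [min_le_left _ _, min_le_right _ _]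

lemma layeredScalar_le_max (γp γm : ℝ) (x : E3) : layeredScalar γp γm x ≤ max γp γm := by
  unfold layeredScalar
  split_ifs
  exacts [le_max_left _ _, le_max_right _ _]

lemma isCoefficient_layered {γp γm : ℝ} (hp : 0 < γp) (hm : 0 < γm) :
    IsCoefficient (layered γp γm) where
  memLp i j := by
    simp only [layered_eq_smul, Matrix.smul_apply, smul_eq_mul]
    refine memLp_top_of_bound
      ((measurable_layeredScalar γp γm).mul_const _).aestronglyMeasurable (max γp γm)
      (ae_of_all _ fun x => ?_)
    have h1 := layeredScalar_le_max γp γm x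
    have h2 := layeredScalar_pos hp hm x
    rw [Real.norm_eq_abs, abs_mul, abs_of_pos h2]
    have : |(1 : Matrix (Fin 3) (Fin 3) ℝ) i j| ≤ 1 := by
      rw [Matrix.one_apply]; split_ifs <;> simp
    nlinarith
  symm := ae_of_all _ fun x => by
    rw [layered_eq_smul]
    exact Matrix.isSymm_one.smul _
  elliptic := by
    refine ⟨min γp γm, lt_min hp hm, ae_of_all _ fun x ξ => ?_⟩
    rw [layered_eq_smul, Matrix.smul_mulVec, Matrix.one_mulVec, dotProduct_smul, smul_eq_mul]
    refine mul_le_mul_of_nonneg_right (min_le_layeredScalar γp γm x) ?_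
    exact Finset.sum_nonneg fun i _ => mul_self_nonneg _

/-! ### Completeness of `H¹` and the resolvent problem -/

lemma H1.norm_sq_eq (u : H1) : ‖u‖ ^ 2 = ‖toL2 u‖ ^ 2 + ‖grad u‖ ^ 2 :=
  WithLp.prod_norm_sq_eq_of_L2 (u : WithLp 2 (L2 × L2Vec))

lemma norm_toL2_le (u : H1) : ‖toL2 u‖ ≤ ‖u‖ := by
  refine le_of_sq_le_sq ?_ (norm_nonneg _)
  rw [H1.norm_sq_eq u]
  linarith [sq_nonneg ‖grad u‖]

lemma norm_grad_le (u : H1) : ‖grad u‖ ≤ ‖u‖ := by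
  refine le_of_sq_le_sq ?_ (norm_nonneg _)
  rw [H1.norm_sq_eq u]
  linarith [sq_nonneg ‖toL2 u‖]

lemma memLp_single {ψ : E3 → ℝ} (h : MemLp ψ 2 (volume : Measure E3)) (i : Fin 3) :
    MemLp (fun x => EuclideanSpace.single i (ψ x) : E3 → E3) 2 (volume : Measure E3) := by
  have h1 : (fun x => EuclideanSpace.single i (ψ x) : E3 → E3)
      = fun x => ψ x • (EuclideanSpace.single i (1 : ℝ) : E3) := by
    ext x j
    by_cases hj : j = i <;> simp [hj]
  rw [h1]
  exact (ContinuousLinearMap.toSpanSingleton ℝ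
    (EuclideanSpace.single i (1 : ℝ) : E3)).comp_memLp' h

/-- Each condition defining a weak gradient pairs the two components with fixed `L²` elements, so
`H¹` is an intersection of closed subspaces. The resulting completeness is what Lax–Milgram needs.
-/
lemma isClosed_H1 : IsClosed (H1 : Set (WithLp 2 (L2 × L2Vec))) := by
  have key : (H1 : Set (WithLp 2 (L2 × L2Vec))) =
      ⋂ (ψ : E3 → ℝ) (h : ContDiff ℝ ∞ ψ) (hc : HasCompactSupport ψ) (i : Fin 3),
        {p | inner ℝ p.fst ((memLp_test_deriv h hc (EuclideanSpace.single i 1)).toLp _ : L2)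
          = - inner ℝ p.snd ((memLp_single (memLp_test h hc) i).toLp _ : L2Vec)} := by
    ext p
    simp only [mem_iInter, mem_ofPred_eq]
    refine forall_congr' fun ψ => forall_congr' fun h => forall_congr' fun hc =>
      forall_congr' fun i => ?_
    rw [← integral_mul_eq_inner, L2.inner_def]
    have e1 : ∫ x, p.fst x * (((memLp_test_deriv h hc (EuclideanSpace.single i 1)).toLp _ : L2)) x
        = ∫ x, p.fst x * fderiv ℝ ψ x (EuclideanSpace.single i 1) := by
      refine integral_congr_ae ?_
      filter_upwards [(memLp_test_deriv h hc (EuclideanSpace.single i 1)).coeFn_toLp] with x hx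
      rw [hx]
    have e2 : ∫ x, inner ℝ (p.snd x) (((memLp_single (memLp_test h hc) i).toLp _ : L2Vec) x)
        = ∫ x, p.snd x i * ψ x := by
      refine integral_congr_ae ?_
      filter_upwards [(memLp_single (memLp_test h hc) i).coeFn_toLp] with x hx
      rw [hx, EuclideanSpace.inner_single_right]
      simp [mul_comm]
    rw [e1, e2]
  rw [key]
  refine isClosed_iInter fun ψ => isClosed_iInter fun h => isClosed_iInter fun hc =>
    isClosed_iInter fun i => isClosed_eq ?_ ?_
  · exact (WithLp.fstL 2 ℝ L2 L2Vec).continuous.inner continuous_const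
  · exact ((WithLp.sndL 2 ℝ L2 L2Vec).continuous.inner continuous_const).neg

instance : CompleteSpace H1 := isClosed_H1.completeSpace_coe

/-- The bilinear form `∫ γ∇u·∇φ + τ² ∫ uφ` of the resolvent problem. -/
def resolventForm (γ : E3 → Matrix (Fin 3) (Fin 3) ℝ) (τ : ℝ) (u φ : H1) : ℝ :=
  form γ u φ + τ ^ 2 * inner ℝ (toL2 u) (toL2 φ)

lemma isResolventSolution_iff {γ : E3 → Matrix (Fin 3) (Fin 3) ℝ} {τ : ℝ} {f : L2} {v : H1} :
    IsResolventSolution γ τ f v ↔ ∀ φ, resolventForm γ τ v φ = inner ℝ f (toL2 φ) := by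
  simp only [IsResolventSolution, resolventForm, integral_mul_eq_inner]

section resolventForm

variable {γ : E3 → Matrix (Fin 3) (Fin 3) ℝ}

lemma resolventForm_add_left (hγ : IsCoefficient γ) (τ : ℝ) (u u' φ : H1) :
    resolventForm γ τ (u + u') φ = resolventForm γ τ u φ + resolventForm γ τ u' φ := by
  simp only [resolventForm, form_add_left hγ, map_add, inner_add_left]; ring

lemma resolventForm_add_right (hγ : IsCoefficient γ) (τ : ℝ) (u φ φ' : H1) :
    resolventForm γ τ u (φ + φ') = resolventForm γ τ u φ + resolventForm γ τ u φ' := by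
  simp only [resolventForm, form_add_right hγ, map_add, inner_add_right]; ring

lemma resolventForm_smul_left (τ c : ℝ) (u φ : H1) :
    resolventForm γ τ (c • u) φ = c * resolventForm γ τ u φ := by
  simp only [resolventForm, form_smul_left, map_smul, real_inner_smul_left]; ring

lemma resolventForm_smul_right (τ c : ℝ) (u φ : H1) :
    resolventForm γ τ u (c • φ) = c * resolventForm γ τ u φ := by
  simp only [resolventForm, form_smul_right, map_smul, real_inner_smul_right]; ring

lemma resolventForm_sub_left (hγ : IsCoefficient γ) (τ : ℝ) (u u' φ : H1) :
    resolventForm γ τ (u - u') φ = resolventForm γ τ u φ - resolventForm γ τ u' φ := by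
  have := resolventForm_add_left hγ τ (u - u') u' φ
  rw [sub_add_cancel] at this
  linarith

lemma resolventForm_sub_right (hγ : IsCoefficient γ) (τ : ℝ) (u φ φ' : H1) :
    resolventForm γ τ u (φ - φ') = resolventForm γ τ u φ - resolventForm γ τ u φ' := by
  have := resolventForm_add_right hγ τ u (φ - φ') φ'
  rw [sub_add_cancel] at this
  linarith

lemma resolventForm_comm (hγ : IsCoefficient γ) (τ : ℝ) (u φ : H1) :
    resolventForm γ τ u φ = resolventForm γ τ φ u := by
  simp only [resolventForm, form_comm hγ u φ, real_inner_comm]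

/-- The form of the resolvent problem as a bounded bilinear form. -/
lemma exists_bilin (hγ : IsCoefficient γ) (τ : ℝ) :
    ∃ A : H1 →L[ℝ] H1 →L[ℝ] ℝ, ∀ u φ, A u φ = resolventForm γ τ u φ := by
  obtain ⟨C, hC, hb⟩ := hγ.exists_bound
  refine ⟨LinearMap.mkContinuous₂ (LinearMap.mk₂ ℝ (resolventForm γ τ)
    (resolventForm_add_left hγ τ) (resolventForm_smul_left τ)
    (resolventForm_add_right hγ τ) (resolventForm_smul_right τ)) (C + τ ^ 2) fun u φ => ?_,
    fun u φ => rfl⟩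
  change |resolventForm γ τ u φ| ≤ _
  have h1 : |form γ u φ| ≤ C * ‖u‖ * ‖φ‖ := by
    refine (abs_integral_quad_le hC.le hb _ _).trans ?_
    have := norm_grad_le u
    have := norm_grad_le φ
    gcongr
  have h2 : |inner ℝ (toL2 u) (toL2 φ)| ≤ ‖u‖ * ‖φ‖ :=
    (abs_real_inner_le_norm _ _).trans (by gcongr <;> exact norm_toL2_le _)
  calc |resolventForm γ τ u φ| ≤ |form γ u φ| + τ ^ 2 * |inner ℝ (toL2 u) (toL2 φ)| := by
        refine (abs_add_le _ _).trans (le_of_eq ?_)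
        rw [abs_mul, abs_of_nonneg (sq_nonneg τ)]
    _ ≤ C * ‖u‖ * ‖φ‖ + τ ^ 2 * (‖u‖ * ‖φ‖) := by gcongr
    _ = _ := by ring

/-- The constant comes from ellipticity alone and does not depend on `τ`; this makes the later
estimates uniform as `τ → ∞`. -/
lemma exists_resolventForm_ge (hγ : IsCoefficient γ) :
    ∃ c : ℝ, 0 < c ∧ ∀ τ : ℝ, ∀ u : H1,
      c * ‖grad u‖ ^ 2 + τ ^ 2 * ‖toL2 u‖ ^ 2 ≤ resolventForm γ τ u u := by
  obtain ⟨c, hc, h⟩ := hγ.exists_form_ge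
  refine ⟨c, hc, fun τ u => ?_⟩
  simp only [resolventForm, real_inner_self_eq_norm_sq]
  linarith [h u]

/-- Solvability of the resolvent problem. -/
theorem exists_isResolventSolution (hγ : IsCoefficient γ) {τ : ℝ} (hτ : τ ≠ 0) (f : L2) :
    ∃ v : H1, IsResolventSolution γ τ f v := by
  obtain ⟨A, hA⟩ := exists_bilin hγ τ
  obtain ⟨c, hc, hge⟩ := exists_resolventForm_ge hγ
  have hco : IsCoercive A := by
    refine ⟨min c (τ ^ 2), lt_min hc (by positivity), fun u => ?_⟩
    rw [hA, mul_assoc, ← sq, H1.norm_sq_eq]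
    refine le_trans ?_ (hge τ u)
    have h1 := mul_le_mul_of_nonneg_right (min_le_left c (τ ^ 2)) (sq_nonneg ‖grad u‖)
    have h2 := mul_le_mul_of_nonneg_right (min_le_right c (τ ^ 2)) (sq_nonneg ‖toL2 u‖)
    linarith
  -- Lax–Milgram, applied to the Riesz representative of `φ ↦ ∫ f φ`.
  refine ⟨hco.continuousLinearEquivOfBilin.symm
    ((InnerProductSpace.toDual ℝ H1).symm (toDual f)), isResolventSolution_iff.2 fun φ => ?_⟩
  rw [← hA, ← hco.continuousLinearEquivOfBilin_apply, ContinuousLinearEquiv.apply_symm_apply,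
    InnerProductSpace.toDual_symm_apply]
  rfl

/-- Decay in `τ` of the solution of the resolvent problem. -/
theorem exists_resolvent_bound (hγ : IsCoefficient γ) (f : L2) :
    ∃ C : ℝ, 0 < C ∧ ∀ τ : ℝ, 1 ≤ τ → ∀ v : H1, IsResolventSolution γ τ f v →
      τ ^ 2 * ‖toL2 v‖ ≤ C ∧ τ * ‖grad v‖ ≤ C := by
  obtain ⟨c, hc, hge⟩ := exists_resolventForm_ge hγ
  refine ⟨max (‖f‖ + 1) (‖f‖ / √c), lt_max_of_lt_left (by positivity), fun τ hτ v hv => ?_⟩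
  have hτ0 : 0 < τ := by linarith
  have h := hge τ v
  rw [isResolventSolution_iff.1 hv] at h
  have h' := h.trans (real_inner_le_norm f (toL2 v))
  -- Testing with `v` itself gives `τ²‖v‖² ≤ ‖f‖ ‖v‖`; the case `v = 0` is separated before
  -- cancelling the norm.
  have h1 : τ ^ 2 * ‖toL2 v‖ ≤ ‖f‖ := by
    rcases (norm_nonneg (toL2 v)).eq_or_lt with h0 | h0
    · rw [← h0]; simp
    · have : τ ^ 2 * ‖toL2 v‖ * ‖toL2 v‖ ≤ ‖f‖ * ‖toL2 v‖ := by
        nlinarith [mul_nonneg hc.le (sq_nonneg ‖grad v‖)]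
      exact le_of_mul_le_mul_right this h0
  refine ⟨h1.trans (le_max_of_le_left (by linarith)), le_max_of_le_right ?_⟩
  rw [le_div_iff₀ (Real.sqrt_pos.2 hc)]
  refine le_of_sq_le_sq ?_ (norm_nonneg f)
  rw [mul_pow, mul_pow, Real.sq_sqrt hc.le]
  have h2 : c * ‖grad v‖ ^ 2 ≤ ‖f‖ * ‖toL2 v‖ := by nlinarith [sq_nonneg (τ * ‖toL2 v‖)]
  calc τ ^ 2 * ‖grad v‖ ^ 2 * c = τ ^ 2 * (c * ‖grad v‖ ^ 2) := by ring
    _ ≤ τ ^ 2 * (‖f‖ * ‖toL2 v‖) := by gcongr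
    _ = ‖f‖ * (τ ^ 2 * ‖toL2 v‖) := by ring
    _ ≤ ‖f‖ * ‖f‖ := by gcongr
    _ = ‖f‖ ^ 2 := by ring

end resolventForm

/-! ### The Laplace transform of the wave -/

/-- Integration by parts against `e^{-τt}` for the primitive `P` of an integrable function. -/
lemma integral_exp_mul_eq {T : ℝ} (τ a : ℝ) {g P : ℝ → ℝ}
    (hT : 0 ≤ T) (hg : IntervalIntegrable g volume 0 T)
    (hP : ∀ᵐ t ∂(volume.restrict (Ioo 0 T)), P t = a + ∫ s in (0 : ℝ)..t, g s) :
    ∫ t in (0 : ℝ)..T, Real.exp (-(τ * t)) * g t =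
      Real.exp (-(τ * T)) * (a + ∫ s in (0 : ℝ)..T, g s) - a
        + τ * ∫ t in (0 : ℝ)..T, Real.exp (-(τ * t)) * P t := by
  have hexp : ∀ t, HasDerivAt (fun t => Real.exp (-(τ * t))) (-τ * Real.exp (-(τ * t))) t :=
    fun t => by
      have h1 : HasDerivAt (fun t => -(τ * t)) (-τ) t := by
        simpa using ((hasDerivAt_id t).const_mul τ).fun_neg
      simpa [mul_comm] using h1.exp
  -- Since `g` is merely integrable, its primitive is only absolutely continuous, and integration by
  -- parts is needed at that level of regularity.
  have hac1 : AbsolutelyContinuousOnInterval (fun t => Real.exp (-(τ * t))) 0 T := by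
    apply ContDiffOn.absolutelyContinuousOnInterval
    exact ContDiff.contDiffOn (by fun_prop)
  have hac2 := hg.absolutelyContinuousOnInterval_intervalIntegral (c := 0) (by simp)
  have hac3 : AbsolutelyContinuousOnInterval (fun t => a + ∫ s in (0 : ℝ)..t, g s) 0 T :=
    (ContDiffOn.absolutelyContinuousOnInterval (by fun_prop)).fun_add hac2
  have key := hac1.integral_mul_deriv_eq_deriv_mul hac3
  have e1 : ∫ t in (0 : ℝ)..T, Real.exp (-(τ * t)) * g t
      = ∫ t in (0 : ℝ)..T, Real.exp (-(τ * t)) *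
        deriv (fun t => a + ∫ s in (0 : ℝ)..t, g s) t := by
    apply intervalIntegral.integral_congr_ae
    filter_upwards [hg.ae_hasDerivAt_integral] with x hx hx'
    rw [((hx (uIoc_subset_uIcc hx') 0 (by simp)).const_add a).deriv]
  have e2 : ∫ t in (0 : ℝ)..T, deriv (fun t => Real.exp (-(τ * t))) t
        * (a + ∫ s in (0 : ℝ)..t, g s)
      = -τ * ∫ t in (0 : ℝ)..T, Real.exp (-(τ * t)) * P t := by
    rw [← intervalIntegral.integral_const_mul]
    rw [intervalIntegral.integral_of_le hT, intervalIntegral.integral_of_le hT,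
      integral_Ioc_eq_integral_Ioo, integral_Ioc_eq_integral_Ioo]
    refine integral_congr_ae ?_
    filter_upwards [hP] with t ht
    rw [ht, (hexp t).deriv, mul_assoc]
  rw [e1, key, e2]
  simp

lemma intervalIntegrable_of_memLp_two {X : Type*} [NormedAddCommGroup X] {T : ℝ} (hT : 0 ≤ T)
    {g : ℝ → X} (hg : MemLp g 2 (volume.restrict (Ioo 0 T))) :
    IntervalIntegrable g volume 0 T := by
  rw [intervalIntegrable_iff_integrableOn_Ioo_of_le hT]
  exact hg.integrable (by norm_num)

lemma intervalIntegrable_exp_smul {X : Type*} [NormedAddCommGroup X] [NormedSpace ℝ X] {T : ℝ}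
    {g : ℝ → X} (τ : ℝ) (hg : IntervalIntegrable g volume 0 T) :
    IntervalIntegrable (fun t => Real.exp (-(τ * t)) • g t) volume 0 T :=
  hg.continuousOn_smul (f := fun t => Real.exp (-(τ * t))) (by fun_prop)

lemma map_integral_exp_smul {X Y : Type*} [NormedAddCommGroup X] [NormedSpace ℝ X]
    [CompleteSpace X] [NormedAddCommGroup Y] [NormedSpace ℝ Y] [CompleteSpace Y]
    (L : X →L[ℝ] Y) {T : ℝ} {g : ℝ → X} (τ : ℝ) (hg : IntervalIntegrable g volume 0 T) :
    L (∫ t in (0 : ℝ)..T, Real.exp (-(τ * t)) • g t)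
      = ∫ t in (0 : ℝ)..T, Real.exp (-(τ * t)) • L (g t) := by
  rw [← ContinuousLinearMap.intervalIntegral_comp_comm _ (intervalIntegrable_exp_smul τ hg)]
  simp only [map_smul]

lemma intervalIntegrable_map {X Y : Type*} [NormedAddCommGroup X] [NormedSpace ℝ X]
    [NormedAddCommGroup Y] [NormedSpace ℝ Y] (L : X →L[ℝ] Y) {T : ℝ} {g : ℝ → X}
    (hg : IntervalIntegrable g volume 0 T) :
    IntervalIntegrable (fun t => L (g t)) volume 0 T :=
  ⟨L.integrable_comp hg.1, L.integrable_comp hg.2⟩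

lemma map_integral_of_mem_Icc {X Y : Type*} [NormedAddCommGroup X] [NormedSpace ℝ X]
    [CompleteSpace X] [NormedAddCommGroup Y] [NormedSpace ℝ Y] [CompleteSpace Y]
    (L : X →L[ℝ] Y) {T t : ℝ} (ht : t ∈ Icc 0 T) {g : ℝ → X}
    (hg : IntervalIntegrable g volume 0 T) :
    L (∫ s in (0 : ℝ)..t, g s) = ∫ s in (0 : ℝ)..t, L (g s) := by
  refine (L.intervalIntegral_comp_comm (hg.mono_set ?_)).symm
  rw [uIcc_of_le ht.1, uIcc_of_le (ht.1.trans ht.2)]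
  exact Icc_subset_Icc_right ht.2

/-- Two integrations by parts in time show that the transform `W` of `u` solves the resolvent
equation up to the data of `u` at time `T`. Testing this with `v`, and the equation of `v` with `W`,
and using the symmetry of the form leaves only the boundary terms. -/
lemma exists_laplaceT_eq {γ : E3 → Matrix (Fin 3) (Fin 3) ℝ} (hγ : IsCoefficient γ)
    {T : ℝ} (hT : 0 < T) {f : L2} {u : ℝ → H1} (hu : IsWaveSolution γ T f u) :
    ∃ (U₁ : StrongDual ℝ H1) (U₀ : L2), ∀ τ : ℝ, ∀ v : H1, IsResolventSolution γ τ f v →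
      inner ℝ f (laplaceT T u τ) - inner ℝ f (toL2 v)
        = - (Real.exp (-(τ * T)) * (U₁ v + τ * inner ℝ U₀ (toL2 v))) := by
  obtain ⟨hu0, u₁, u₂, hu1, hu2, hp1, hp2, heq⟩ := hu
  have hi0 := intervalIntegrable_of_memLp_two hT.le hu0
  have hi1 := intervalIntegrable_of_memLp_two hT.le hu1
  have hi2 := intervalIntegrable_of_memLp_two (X := StrongDual ℝ H1) hT.le hu2
  -- These are `∂ₜu(T)`, as a functional on `H¹`, and `u(T)`: the primitives evaluated at the
  -- endpoint.
  refine ⟨toDual f + ∫ s in (0 : ℝ)..T, u₂ s, ∫ s in (0 : ℝ)..T, u₁ s, fun τ v hv => ?_⟩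
  -- At `τ = 0` the resolvent form reduces to `form γ`; it is needed as a bounded bilinear map to
  -- pass through the Bochner integral.
  obtain ⟨A, hA⟩ := exists_bilin hγ 0
  have hA' : ∀ u φ, A u φ = form γ u φ := fun u φ => by rw [hA]; simp [resolventForm]
  set W : H1 := ∫ t in (0 : ℝ)..T, Real.exp (-(τ * t)) • u t with hW
  have hWL : toL2 W = laplaceT T u τ := map_integral_exp_smul toL2 τ hi0
  have hinner : inner ℝ (toL2 W) (toL2 v)
      = ∫ t in (0 : ℝ)..T, Real.exp (-(τ * t)) * inner ℝ (toL2 (u t)) (toL2 v) := by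
    have := map_integral_exp_smul ((innerSL ℝ (toL2 v)).comp toL2) τ hi0
    simpa only [ContinuousLinearMap.comp_apply, innerSL_apply_apply, smul_eq_mul,
      real_inner_comm (toL2 v)] using this
  have hform : form γ W v = ∫ t in (0 : ℝ)..T, Real.exp (-(τ * t)) * form γ (u t) v := by
    have := map_integral_exp_smul (A.flip v) τ hi0
    simpa only [ContinuousLinearMap.flip_apply, hA', smul_eq_mul] using this
  have hform2 : form γ W v = - ∫ t in (0 : ℝ)..T, Real.exp (-(τ * t)) * u₂ t v := by
    rw [hform, ← intervalIntegral.integral_neg, intervalIntegral.integral_of_le hT.le,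
      intervalIntegral.integral_of_le hT.le,
      integral_Ioc_eq_integral_Ioo, integral_Ioc_eq_integral_Ioo]
    refine integral_congr_ae ?_
    filter_upwards [heq] with t ht
    have := ht v
    rw [show form γ (u t) v = - u₂ t v by linarith]
    ring
  have hsub : ∀ᵐ t ∂(volume.restrict (Ioo 0 T)), t ∈ Ioo 0 T :=
    ae_restrict_mem measurableSet_Ioo
  have hi2v : IntervalIntegrable (fun t => u₂ t v) volume 0 T :=
    intervalIntegrable_map (ContinuousLinearMap.apply ℝ ℝ v) hi2
  have hi1v : IntervalIntegrable (fun t => inner ℝ (u₁ t) (toL2 v)) volume 0 T := by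
    have := intervalIntegrable_map (innerSL ℝ (toL2 v)) hi1
    simpa only [innerSL_apply_apply, real_inner_comm (toL2 v)] using this
  have hQ : ∀ t ∈ Icc 0 T, (∫ s in (0 : ℝ)..t, u₂ s) v = ∫ s in (0 : ℝ)..t, u₂ s v :=
    fun t ht => map_integral_of_mem_Icc (ContinuousLinearMap.apply ℝ ℝ v) ht hi2
  have hR : ∀ t ∈ Icc 0 T, inner ℝ (∫ s in (0 : ℝ)..t, u₁ s) (toL2 v)
        = ∫ s in (0 : ℝ)..t, inner ℝ (u₁ s) (toL2 v) := fun t ht => by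
    have := map_integral_of_mem_Icc (innerSL ℝ (toL2 v)) ht hi1
    simpa only [innerSL_apply_apply, real_inner_comm (toL2 v)] using this
  have ibp2 := integral_exp_mul_eq (P := fun t => inner ℝ (u₁ t) (toL2 v)) τ
    (inner ℝ f (toL2 v)) hT.le hi2v (by
      filter_upwards [hp2, hsub] with t ht ht'
      have := congrArg (fun L : StrongDual ℝ H1 => L v) ht
      simp only [toDual, add_apply, ContinuousLinearMap.comp_apply,
        innerSL_apply_apply] at this
      rw [this, hQ t (Ioo_subset_Icc_self ht')])
  have ibp1 := integral_exp_mul_eq (P := fun t => inner ℝ (toL2 (u t)) (toL2 v)) τ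
    0 hT.le hi1v (by
      filter_upwards [hp1, hsub] with t ht ht'
      rw [ht, zero_add, zero_add, hR t (Ioo_subset_Icc_self ht')])
  have hU₁v : (toDual f + ∫ s in (0 : ℝ)..T, u₂ s) v
      = inner ℝ f (toL2 v) + ∫ s in (0 : ℝ)..T, u₂ s v := by
    rw [add_apply, hQ T (right_mem_Icc.2 hT.le)]; rfl
  have hU₀v : inner ℝ (∫ s in (0 : ℝ)..T, u₁ s) (toL2 v)
      = ∫ s in (0 : ℝ)..T, inner ℝ (u₁ s) (toL2 v) :=
    hR T (right_mem_Icc.2 hT.le)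
  have h1 : resolventForm γ τ W v = inner ℝ f (toL2 W) := by
    rw [resolventForm_comm hγ, isResolventSolution_iff.1 hv]
  rw [← hWL, ← h1, resolventForm, hform2, ibp2, ibp1, hinner, hU₁v, hU₀v]
  ring

/-- Up to an error `O(e^{-τT}/τ)`, the Laplace transform of the wave pairs with `f` like the
solution of the resolvent problem. -/
theorem exists_laplaceT_error {γ : E3 → Matrix (Fin 3) (Fin 3) ℝ} (hγ : IsCoefficient γ)
    {T : ℝ} (hT : 0 < T) {f : L2} {u : ℝ → H1} (hu : IsWaveSolution γ T f u) :
    ∃ C : ℝ, 0 < C ∧ ∀ τ : ℝ, 1 ≤ τ → ∀ v : H1, IsResolventSolution γ τ f v →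
      |inner ℝ f (laplaceT T u τ) - inner ℝ f (toL2 v)| ≤ C * Real.exp (-(τ * T)) / τ := by
  obtain ⟨C, hC, hbound⟩ := exists_resolvent_bound hγ f
  obtain ⟨U₁, U₀, hmain⟩ := exists_laplaceT_eq hγ hT hu
  refine ⟨2 * C * ‖U₁‖ + C * ‖U₀‖ + 1, by positivity, fun τ hτ v hv => ?_⟩
  have hτ0 : 0 < τ := by linarith
  obtain ⟨hb1, hb2⟩ := hbound τ hτ v hv
  have hvnorm : τ * ‖v‖ ≤ 2 * C := by
    have h1 : ‖v‖ ≤ ‖toL2 v‖ + ‖grad v‖ := by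
      refine le_of_sq_le_sq ?_ (by positivity)
      rw [H1.norm_sq_eq]
      nlinarith [norm_nonneg (toL2 v), norm_nonneg (grad v)]
    have h2 : τ * ‖toL2 v‖ ≤ τ ^ 2 * ‖toL2 v‖ := by
      refine mul_le_mul_of_nonneg_right ?_ (norm_nonneg _)
      nlinarith
    nlinarith
  -- The gain of `1/τ`: `U₁` sees the `H¹` norm, which is `O(1/τ)`, and `τ U₀` sees the `L²` norm,
  -- which is `O(1/τ²)`.
  have hF : τ * |U₁ v + τ * inner ℝ U₀ (toL2 v)| ≤ 2 * C * ‖U₁‖ + C * ‖U₀‖ := by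
    have h1 : |U₁ v| ≤ ‖U₁‖ * ‖v‖ := U₁.le_opNorm v
    have h2 : |inner ℝ U₀ (toL2 v)| ≤ ‖U₀‖ * ‖toL2 v‖ := abs_real_inner_le_norm _ _
    calc τ * |U₁ v + τ * inner ℝ U₀ (toL2 v)|
        ≤ τ * (|U₁ v| + |τ * inner ℝ U₀ (toL2 v)|) := by
          gcongr; exact abs_add_le _ _
      _ = τ * |U₁ v| + τ ^ 2 * |inner ℝ U₀ (toL2 v)| := by
          rw [abs_mul, abs_of_pos hτ0]; ring
      _ ≤ τ * (‖U₁‖ * ‖v‖) + τ ^ 2 * (‖U₀‖ * ‖toL2 v‖) := by gcongr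
      _ = ‖U₁‖ * (τ * ‖v‖) + ‖U₀‖ * (τ ^ 2 * ‖toL2 v‖) := by ring
      _ ≤ ‖U₁‖ * (2 * C) + ‖U₀‖ * C := by gcongr
      _ = _ := by ring
  rw [hmain τ v hv, abs_neg, abs_mul, abs_of_pos (Real.exp_pos _), le_div_iff₀ hτ0]
  calc Real.exp (-(τ * T)) * |U₁ v + τ * inner ℝ U₀ (toL2 v)| * τ
      = Real.exp (-(τ * T)) * (τ * |U₁ v + τ * inner ℝ U₀ (toL2 v)|) := by ring
    _ ≤ Real.exp (-(τ * T)) * (2 * C * ‖U₁‖ + C * ‖U₀‖ + 1) := by gcongr; linarith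
    _ = _ := by ring

/-! ### Comparison of the perturbed with the unperturbed medium -/

/-- The Dirichlet energy `∫_D |∇v|²`. -/
def energyOn (D : Set E3) (v : H1) : ℝ := ∫ x in D, ‖grad v x‖ ^ 2

lemma energyOn_nonneg (D : Set E3) (v : H1) : 0 ≤ energyOn D v :=
  integral_nonneg fun _ => sq_nonneg _

section comparison

variable {γ γ' : E3 → Matrix (Fin 3) (Fin 3) ℝ} {D : Set E3} {τ : ℝ} {f : L2} {v v' : H1}

lemma form_sub_form (hγ : IsCoefficient γ) (hγ' : IsCoefficient γ') (hD : MeasurableSet D)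
    (hbg : ∀ᵐ x : E3, x ∉ D → γ' x = γ x) (u φ : H1) :
    form γ' u φ - form γ u φ
      = ∫ x in D, (quad (γ' x) (grad u x) (grad φ x) - quad (γ x) (grad u x) (grad φ x)) := by
  rw [form_eq, form_eq, ← integral_sub (integrable_quad hγ' _ _) (integrable_quad hγ _ _),
    ← integral_indicator hD]
  refine integral_congr_ae ?_
  filter_upwards [hbg] with x hx
  by_cases hxD : x ∈ D
  · rw [indicator_of_mem hxD]
  · rw [indicator_of_notMem hxD, hx hxD, sub_self]

lemma integrableOn_quad_sub (hγ : IsCoefficient γ) (hγ' : IsCoefficient γ') (u φ : H1) :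
    IntegrableOn (fun x => quad (γ' x) (grad u x) (grad φ x)
      - quad (γ x) (grad u x) (grad φ x)) D volume :=
  ((integrable_quad hγ' _ _).sub (integrable_quad hγ _ _)).integrableOn

/-- Expanding the square, all terms containing `v'` become pairings with `f`. Exchanging the two
coefficients gives a second identity with the opposite sign on the left; the two together yield
one-sided bounds for raised as well as for lowered coefficients. -/
lemma inner_sub_eq (hγ' : IsCoefficient γ')
    (hv : IsResolventSolution γ τ f v) (hv' : IsResolventSolution γ' τ f v') :
    inner ℝ f (toL2 v') - inner ℝ f (toL2 v)
      = resolventForm γ' τ (v' - v) (v' - v) - (form γ' v v - form γ v v) := by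
  have h := isResolventSolution_iff.1 hv
  have h' := isResolventSolution_iff.1 hv'
  have e : form γ' v v - form γ v v = resolventForm γ' τ v v - resolventForm γ τ v v := by
    simp [resolventForm]
  rw [e, resolventForm_sub_left hγ', resolventForm_sub_right hγ', resolventForm_sub_right hγ',
    resolventForm_comm hγ' τ v v', h', h', h]
  ring

/-- A perturbation in `D` changes `⟨f, v⟩` by at most a multiple of the energy in `D`. -/
theorem exists_abs_inner_sub_le (hγ : IsCoefficient γ) (hγ' : IsCoefficient γ')
    (hD : MeasurableSet D) (hbg : ∀ᵐ x : E3, x ∉ D → γ' x = γ x) (f : L2) :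
    ∃ C : ℝ, 0 < C ∧ ∀ (τ : ℝ) (v v' : H1), IsResolventSolution γ τ f v →
      IsResolventSolution γ' τ f v' →
      |inner ℝ f (toL2 v') - inner ℝ f (toL2 v)| ≤ C * energyOn D v := by
  obtain ⟨C₁, hC₁, hb₁⟩ := hγ.exists_bound
  obtain ⟨C₂, hC₂, hb₂⟩ := hγ'.exists_bound
  obtain ⟨c, hc, hge⟩ := exists_resolventForm_ge hγ'
  set C := C₁ + C₂ with hCdef
  have hC : 0 < C := by positivity
  refine ⟨C ^ 2 / c + C, by positivity, fun τ v v' hv hv' => ?_⟩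
  have hquad : ∀ᵐ x : E3, ∀ ξ ζ : E3, |quad (γ' x) ξ ζ - quad (γ x) ξ ζ| ≤ C * ‖ξ‖ * ‖ζ‖ := by
    filter_upwards [hb₁, hb₂] with x h1 h2 ξ ζ
    have h3 := h1 ξ ζ
    have h4 := h2 ξ ζ
    refine (abs_sub _ _).trans ?_
    rw [hCdef]
    nlinarith
  set E := energyOn D v with hE
  have hE0 : 0 ≤ E := energyOn_nonneg D v
  have h1 : |form γ' v v - form γ v v| ≤ C * E := by
    rw [form_sub_form hγ hγ' hD hbg, hE, energyOn, ← integral_const_mul, ← Real.norm_eq_abs]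
    refine norm_integral_le_of_norm_le ((integrable_norm_sq _).integrableOn.const_mul C) ?_
    filter_upwards [ae_restrict_of_ae hquad] with x hx
    have := hx (grad v x) (grad v x)
    rw [Real.norm_eq_abs]
    linarith
  set r := v' - v with hr
  -- The remainder `r` solves the perturbed equation with a right-hand side that lives on `D` and
  -- involves only `∇v`.
  have h2 : resolventForm γ' τ r r = -(form γ' v r - form γ v r) := by
    have e : form γ' v r - form γ v r = resolventForm γ' τ v r - resolventForm γ τ v r := by
      simp [resolventForm]
    have h3 : resolventForm γ' τ r r = resolventForm γ' τ v' r - resolventForm γ' τ v r := by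
      conv_lhs => rw [hr, resolventForm_sub_left hγ']
    rw [h3, e, isResolventSolution_iff.1 hv, isResolventSolution_iff.1 hv']
    ring
  have hpos : c * ‖grad r‖ ^ 2 ≤ resolventForm γ' τ r r := by
    have := hge τ r
    nlinarith [sq_nonneg (τ * ‖toL2 r‖)]
  -- Young's inequality weighted so that the `∇r` term is exactly `c‖∇r‖²`, which coercivity
  -- absorbs.
  have h3 : 2 * |form γ' v r - form γ v r| ≤ C ^ 2 / c * E + c * ‖grad r‖ ^ 2 := by
    rw [form_sub_form hγ hγ' hD hbg]
    have e1 : C ^ 2 / c * E + c * ‖grad r‖ ^ 2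
        ≥ ∫ x in D, (C ^ 2 / c * ‖grad v x‖ ^ 2 + c * ‖grad r x‖ ^ 2) := by
      rw [integral_add ((integrable_norm_sq _).integrableOn.const_mul _)
        ((integrable_norm_sq _).integrableOn.const_mul _), integral_const_mul,
        integral_const_mul, ← integral_norm_sq]
      have : ∫ x in D, ‖grad r x‖ ^ 2 ≤ ∫ x, ‖grad r x‖ ^ 2 :=
        setIntegral_le_integral (integrable_norm_sq _) (ae_of_all _ fun _ => sq_nonneg _)
      have := mul_le_mul_of_nonneg_left this hc.le
      rw [hE, energyOn]
      linarith
    refine le_trans ?_ e1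
    have e2 : (2 : ℝ) * |∫ x in D, (quad (γ' x) (grad v x) (grad r x)
          - quad (γ x) (grad v x) (grad r x))|
        = |∫ x in D, 2 * (quad (γ' x) (grad v x) (grad r x)
          - quad (γ x) (grad v x) (grad r x))| := by
      rw [integral_const_mul, abs_mul]; simp
    rw [e2, ← Real.norm_eq_abs]
    refine norm_integral_le_of_norm_le ?_ ?_
    · exact ((integrable_norm_sq _).integrableOn.const_mul _).add
        ((integrable_norm_sq _).integrableOn.const_mul _)
    · filter_upwards [ae_restrict_of_ae hquad] with x hx
      have h4 := hx (grad v x) (grad r x)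
      rw [Real.norm_eq_abs, abs_mul, abs_two]
      have h5 : C ^ 2 / c * ‖grad v x‖ ^ 2 + c * ‖grad r x‖ ^ 2
          - 2 * (C * ‖grad v x‖ * ‖grad r x‖)
          = (C * ‖grad v x‖ - c * ‖grad r x‖) ^ 2 / c := by
        field_simp; ring
      have h6 : 0 ≤ (C * ‖grad v x‖ - c * ‖grad r x‖) ^ 2 / c := by positivity
      linarith
  have h4 : |form γ' v r - form γ v r| ≤ C ^ 2 / c * E := by
    have : resolventForm γ' τ r r ≤ |form γ' v r - form γ v r| := by
      rw [h2]; exact neg_le_abs _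
    linarith
  have h5 : |resolventForm γ' τ r r| ≤ C ^ 2 / c * E := by rwa [h2, abs_neg]
  rw [inner_sub_eq hγ' hv hv']
  refine (abs_sub _ _).trans ?_
  linarith

lemma resolventForm_self_nonneg (hγ : IsCoefficient γ) (τ : ℝ) (u : H1) :
    0 ≤ resolventForm γ τ u u := by
  obtain ⟨c, hc, hge⟩ := exists_resolventForm_ge hγ
  refine le_trans ?_ (hge τ u)
  positivity

/-- If the coefficient is lowered in `D`, then `⟨f, v⟩` grows by at least a multiple of the
energy in `D`. -/
theorem le_inner_sub_of_le {c : ℝ} (hγ : IsCoefficient γ) (hγ' : IsCoefficient γ')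
    (hD : MeasurableSet D) (hbg : ∀ᵐ x : E3, x ∉ D → γ' x = γ x)
    (hle : ∀ᵐ x : E3, x ∈ D → ∀ ξ : E3, quad (γ' x) ξ ξ + c * ‖ξ‖ ^ 2 ≤ quad (γ x) ξ ξ)
    (hv : IsResolventSolution γ τ f v) (hv' : IsResolventSolution γ' τ f v') :
    c * energyOn D v ≤ inner ℝ f (toL2 v') - inner ℝ f (toL2 v) := by
  rw [inner_sub_eq hγ' hv hv']
  -- The quadratic term in the identity is nonnegative and can be dropped.
  have h0 := resolventForm_self_nonneg hγ' τ (v' - v)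
  have h1 : c * energyOn D v ≤ -(form γ' v v - form γ v v) := by
    rw [form_sub_form hγ hγ' hD hbg, energyOn, ← integral_const_mul, ← integral_neg]
    refine integral_mono_ae ((integrable_norm_sq _).integrableOn.const_mul _)
      (integrableOn_quad_sub hγ hγ' v v).neg ?_
    filter_upwards [ae_restrict_of_ae hle, ae_restrict_mem hD] with x hx hxD
    have := hx hxD (grad v x)
    linarith
  linarith

/-- If the coefficient is raised in `D`, then `⟨f, v⟩` drops by at least a multiple of the
energy in `D`. -/
theorem le_inner_sub_of_ge {c c₀ : ℝ} (hc : 0 < c) (hc₀ : 0 < c₀)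
    (hγ : IsCoefficient γ) (hγ' : IsCoefficient γ')
    (hD : MeasurableSet D) (hbg : ∀ᵐ x : E3, x ∉ D → γ' x = γ x)
    (hell : ∀ᵐ x : E3, ∀ ξ : E3, 0 ≤ quad (γ x) ξ ξ)
    (hell' : ∀ᵐ x : E3, x ∈ D → ∀ ξ : E3, c₀ * ‖ξ‖ ^ 2 ≤ quad (γ x) ξ ξ)
    (hge : ∀ᵐ x : E3, x ∈ D → ∀ ξ : E3, quad (γ x) ξ ξ + c * ‖ξ‖ ^ 2 ≤ quad (γ' x) ξ ξ)
    (hv : IsResolventSolution γ τ f v) (hv' : IsResolventSolution γ' τ f v') :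
    min c c₀ / 2 * energyOn D v ≤ inner ℝ f (toL2 v) - inner ℝ f (toL2 v') := by
  have hbg' : ∀ᵐ x : E3, x ∉ D → γ x = γ' x := by
    filter_upwards [hbg] with x hx hxD using (hx hxD).symm
  -- With the roles exchanged, the identity is favourable for a raised coefficient, but the energy
  -- it produces is that of `v'` instead of `v`.
  rw [inner_sub_eq hγ hv' hv]
  set r := v - v' with hr
  have h0 : ∫ x in D, quad (γ x) (grad r x) (grad r x) ≤ resolventForm γ τ r r := by
    have : ∫ x in D, quad (γ x) (grad r x) (grad r x) ≤ form γ r r := by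
      refine setIntegral_le_integral (integrable_quad hγ _ _) ?_
      filter_upwards [hell] with x hx using hx _
    rw [resolventForm, real_inner_self_eq_norm_sq]
    have : 0 ≤ τ ^ 2 * ‖toL2 r‖ ^ 2 := by positivity
    linarith
  refine le_trans ?_ (sub_le_sub_right h0 _)
  rw [form_sub_form hγ' hγ hD hbg', energyOn, ← integral_const_mul,
    ← integral_sub (integrable_quad hγ _ _).integrableOn (integrableOn_quad_sub hγ' hγ v' v')]
  refine integral_mono_ae ((integrable_norm_sq _).integrableOn.const_mul _)
    ((integrable_quad hγ _ _).integrableOn.sub (integrableOn_quad_sub hγ' hγ v' v')) ?_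
  have hadd : ∀ᵐ x : E3, grad v x = grad r x + grad v' x := by
    have : grad v = grad r + grad v' := by rw [hr, map_sub, sub_add_cancel]
    filter_upwards [Lp.coeFn_add (grad r) (grad v')] with x hx
    rw [this, hx, Pi.add_apply]
  filter_upwards [ae_restrict_of_ae hell', ae_restrict_of_ae hge, ae_restrict_mem hD,
    ae_restrict_of_ae hadd] with x h1 h2 hxD h3
  have h4 := h1 hxD (grad r x)
  have h5 := h2 hxD (grad v' x)
  -- The energy of `v` is recovered from those of `r` and `v'`, both of which are available on `D`;
  -- this is the source of `min c c₀ / 2`.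
  have h6 : ‖grad v x‖ ^ 2 ≤ 2 * ‖grad r x‖ ^ 2 + 2 * ‖grad v' x‖ ^ 2 := by
    rw [h3]
    have := norm_add_le (grad r x) (grad v' x)
    have h7 : ‖grad r x + grad v' x‖ ^ 2 ≤ (‖grad r x‖ + ‖grad v' x‖) ^ 2 := by gcongr
    nlinarith [sq_nonneg (‖grad r x‖ - ‖grad v' x‖)]
  have hm : 0 < min c c₀ := lt_min hc hc₀
  have h8 : min c c₀ * ‖grad r x‖ ^ 2 ≤ c₀ * ‖grad r x‖ ^ 2 := by gcongr; exact min_le_right _ _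
  have h9 : min c c₀ * ‖grad v' x‖ ^ 2 ≤ c * ‖grad v' x‖ ^ 2 := by
    gcongr; exact min_le_left _ _
  nlinarith

end comparison

/-! ### Elements of `H¹` given by functions -/

/-- The partial derivative `∂ᵢψ`. -/
def partialDeriv (i : Fin 3) (ψ : E3 → ℝ) (x : E3) : ℝ :=
  fderiv ℝ ψ x (EuclideanSpace.single i 1)

/-- The Laplacian. -/
def lap (ψ : E3 → ℝ) (x : E3) : ℝ := ∑ i, partialDeriv i (partialDeriv i ψ) x

lemma gradient_apply (ψ : E3 → ℝ) (x : E3) (i : Fin 3) :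
    gradient ψ x i = partialDeriv i ψ x := by
  rw [partialDeriv, ← inner_gradient_left, EuclideanSpace.inner_single_right]
  simp

lemma norm_gradient (ψ : E3 → ℝ) (x : E3) : ‖gradient ψ x‖ = ‖fderiv ℝ ψ x‖ := by
  rw [gradient, LinearIsometryEquiv.norm_map]

lemma inner_gradient_eq_sum (ξ : E3) (ψ : E3 → ℝ) (x : E3) :
    inner ℝ ξ (gradient ψ x) = ∑ i, ξ i * partialDeriv i ψ x := by
  rw [PiLp.inner_apply]
  exact Finset.sum_congr rfl fun i _ => by rw [gradient_apply]; simp [mul_comm]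

lemma contDiff_partialDeriv {ψ : E3 → ℝ} (h : ContDiff ℝ ∞ ψ) (i : Fin 3) :
    ContDiff ℝ ∞ (partialDeriv i ψ) :=
  (h.fderiv_right (m := ∞) (by simp)).clm_apply contDiff_const

lemma hasCompactSupport_partialDeriv {ψ : E3 → ℝ} (hc : HasCompactSupport ψ) (i : Fin 3) :
    HasCompactSupport (partialDeriv i ψ) :=
  hc.fderiv_apply (𝕜 := ℝ) _

lemma continuous_lap {ψ : E3 → ℝ} (h : ContDiff ℝ ∞ ψ) : Continuous (lap ψ) :=
  continuous_finsetSum _ fun i _ =>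
    (contDiff_partialDeriv (contDiff_partialDeriv h i) i).continuous

lemma hasCompactSupport_lap {ψ : E3 → ℝ} (hc : HasCompactSupport ψ) :
    HasCompactSupport (lap ψ) := by
  refine HasCompactSupport.intro hc fun x hx => ?_
  refine Finset.sum_eq_zero fun i _ => ?_
  by_contra h
  have h1 : x ∈ tsupport (partialDeriv i (partialDeriv i ψ)) :=
    subset_closure h
  have h2 : ∀ φ : E3 → ℝ, tsupport (partialDeriv i φ) ⊆ tsupport φ := fun φ =>
    tsupport_fderiv_apply_subset ℝ _
  exact hx (h2 _ (h2 _ h1))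

lemma continuous_gradient {ψ : E3 → ℝ} (h : ContDiff ℝ ∞ ψ) : Continuous (gradient ψ) :=
  (LinearIsometryEquiv.continuous _).comp (h.continuous_fderiv (by simp))

lemma memLp_gradient {ψ : E3 → ℝ} (h : ContDiff ℝ ∞ ψ) (hc : HasCompactSupport ψ) :
    MemLp (gradient ψ) 2 (volume : Measure E3) := by
  refine (continuous_gradient h).memLp_of_hasCompactSupport ?_
  exact (hc.fderiv (𝕜 := ℝ)).comp_left (map_zero _)

lemma partialDeriv_mul {φ ψ : E3 → ℝ} {x : E3} (hφ : DifferentiableAt ℝ φ x)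
    (hψ : DifferentiableAt ℝ ψ x) (i : Fin 3) :
    partialDeriv i (fun y => φ y * ψ y) x
      = φ x * partialDeriv i ψ x + ψ x * partialDeriv i φ x := by
  simp [partialDeriv, fderiv_fun_mul hφ hψ]

lemma contDiff_differentiableAt {ψ : E3 → ℝ} (h : ContDiff ℝ ∞ ψ) (x : E3) :
    DifferentiableAt ℝ ψ x := (h.differentiable (by simp)).differentiableAt

/-- The defining property of the weak gradient. -/
lemma integral_mul_partialDeriv (u : H1) {ψ : E3 → ℝ} (h : ContDiff ℝ ∞ ψ)
    (hc : HasCompactSupport ψ) (i : Fin 3) :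
    ∫ x, toL2 u x * partialDeriv i ψ x = - ∫ x, grad u x i * ψ x := u.2 ψ h hc i

/-- A function with a weak gradient, both square integrable, is an element of `H¹`. -/
lemma exists_H1 {u : E3 → ℝ} {G : E3 → E3} (hu : MemLp u 2 (volume : Measure E3))
    (hG : MemLp G 2 (volume : Measure E3))
    (h : ∀ ψ : E3 → ℝ, ContDiff ℝ ∞ ψ → HasCompactSupport ψ → ∀ i : Fin 3,
      ∫ x, u x * partialDeriv i ψ x = - ∫ x, G x i * ψ x) :
    ∃ p : H1, toL2 p =ᵐ[volume] u ∧ grad p =ᵐ[volume] G := by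
  refine ⟨⟨WithLp.toLp 2 (hu.toLp u, hG.toLp G), fun ψ hψ hc i => ?_⟩, hu.coeFn_toLp,
    hG.coeFn_toLp⟩
  have e1 : ∫ x, (hu.toLp u : L2) x * partialDeriv i ψ x = ∫ x, u x * partialDeriv i ψ x := by
    refine integral_congr_ae ?_
    filter_upwards [hu.coeFn_toLp] with x hx
    rw [hx]
  have e2 : ∫ x, (hG.toLp G : L2Vec) x i * ψ x = ∫ x, G x i * ψ x := by
    refine integral_congr_ae ?_
    filter_upwards [hG.coeFn_toLp] with x hx
    rw [hx]
  exact e1.trans ((h ψ hψ hc i).trans (congrArg Neg.neg e2.symm))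

/-- Test functions belong to `H¹`. -/
lemma exists_H1_test {ψ : E3 → ℝ} (h : ContDiff ℝ ∞ ψ) (hc : HasCompactSupport ψ) :
    ∃ p : H1, toL2 p =ᵐ[volume] ψ ∧ grad p =ᵐ[volume] gradient ψ := by
  refine exists_H1 (memLp_test h hc) (memLp_gradient h hc) fun φ hφ hcφ i => ?_
  simp only [gradient_apply]
  refine integral_mul_fderiv_eq_neg_fderiv_mul_of_integrable ?_ ?_ ?_
    (fun x _ => contDiff_differentiableAt h x) (fun x _ => contDiff_differentiableAt hφ x)
  · exact (memLp_test_deriv h hc _).integrable_mul (memLp_test hφ hcφ)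
  · exact (memLp_test h hc).integrable_mul (memLp_test_deriv hφ hcφ _)
  · exact (memLp_test h hc).integrable_mul (memLp_test hφ hcφ)

/-- `H¹` is stable under multiplication by bounded smooth functions with bounded gradient. -/
lemma exists_H1_mul (u : H1) {ρ : E3 → ℝ} (hρ : ContDiff ℝ ∞ ρ) {M : ℝ}
    (hb : ∀ x, |ρ x| ≤ M) (hb' : ∀ x, ‖gradient ρ x‖ ≤ M) :
    ∃ p : H1, toL2 p =ᵐ[volume] (fun x => ρ x * toL2 u x) ∧
      grad p =ᵐ[volume] fun x => ρ x • grad u x + toL2 u x • gradient ρ x := by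
  have hρm : AEStronglyMeasurable ρ (volume : Measure E3) := hρ.continuous.aestronglyMeasurable
  have hρm' : AEStronglyMeasurable (gradient ρ) (volume : Measure E3) :=
    (continuous_gradient hρ).aestronglyMeasurable
  have hu := Lp.memLp (toL2 u)
  have h1 : MemLp (fun x => ρ x * toL2 u x) 2 (volume : Measure E3) :=
    hu.of_le_mul (c := M) (hρm.mul hu.1) (ae_of_all _ fun x => by
      rw [norm_mul]
      exact mul_le_mul_of_nonneg_right (hb x) (norm_nonneg _))
  have h2 : MemLp (fun x => ρ x • grad u x) 2 (volume : Measure E3) :=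
    (Lp.memLp (grad u)).of_le_mul (c := M) (hρm.smul (Lp.memLp (grad u)).1)
      (ae_of_all _ fun x => by
        rw [norm_smul]
        exact mul_le_mul_of_nonneg_right (hb x) (norm_nonneg _))
  have h3 : MemLp (fun x => toL2 u x • gradient ρ x) 2 (volume : Measure E3) :=
    hu.of_le_mul (c := M) (hu.1.smul hρm') (ae_of_all _ fun x => by
      rw [norm_smul, mul_comm]
      exact mul_le_mul_of_nonneg_right (hb' x) (norm_nonneg _))
  refine exists_H1 h1 (h2.add h3) fun ψ hψ hc i => ?_
  -- The product rule is obtained by testing the weak gradient of `u` with `ρψ`.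
  have key := integral_mul_partialDeriv u (hρ.mul hψ) (hc.mul_left (f := ρ)) i
  have ei : ∀ x, partialDeriv i (fun y => ρ y * ψ y) x
      = ρ x * partialDeriv i ψ x + ψ x * partialDeriv i ρ x :=
    fun x => partialDeriv_mul (contDiff_differentiableAt hρ x) (contDiff_differentiableAt hψ x) i
  have i1 : Integrable (fun x => ρ x * toL2 u x * partialDeriv i ψ x) (volume : Measure E3) :=
    h1.integrable_mul (memLp_test_deriv hψ hc _)
  have h3i : MemLp (fun x => toL2 u x * partialDeriv i ρ x) 2 (volume : Measure E3) := by
    have := (EuclideanSpace.proj i : E3 →L[ℝ] ℝ).comp_memLp' h3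
    refine this.ae_eq (ae_of_all _ fun x => ?_)
    simp [gradient_apply]
  have i2 : Integrable (fun x => toL2 u x * partialDeriv i ρ x * ψ x) (volume : Measure E3) :=
    h3i.integrable_mul (memLp_test hψ hc)
  have h2i : MemLp (fun x => ρ x * grad u x i) 2 (volume : Measure E3) := by
    have := (EuclideanSpace.proj i : E3 →L[ℝ] ℝ).comp_memLp' h2
    refine this.ae_eq (ae_of_all _ fun x => ?_)
    simp
  have i3 : Integrable (fun x => ρ x * grad u x i * ψ x) (volume : Measure E3) :=
    h2i.integrable_mul (memLp_test hψ hc)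
  have e1 : ∫ x, toL2 u x * partialDeriv i (fun y => ρ y * ψ y) x
      = (∫ x, ρ x * toL2 u x * partialDeriv i ψ x)
        + ∫ x, toL2 u x * partialDeriv i ρ x * ψ x := by
    rw [← integral_add i1 i2]
    exact integral_congr_ae (ae_of_all _ fun x => by simp only [ei]; ring)
  have e2 : ∫ x, (ρ x • grad u x + toL2 u x • gradient ρ x) i * ψ x
      = (∫ x, ρ x * grad u x i * ψ x) + ∫ x, toL2 u x * partialDeriv i ρ x * ψ x := by
    rw [← integral_add i3 i2]
    refine integral_congr_ae (ae_of_all _ fun x => ?_)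
    simp only [PiLp.add_apply, PiLp.smul_apply, smul_eq_mul, gradient_apply]
    ring
  have e3 : ∫ x, grad u x i * (ρ x * ψ x) = ∫ x, ρ x * grad u x i * ψ x :=
    integral_congr_ae (ae_of_all _ fun x => by ring)
  rw [e2]
  linarith

/-- Integration by parts with the smooth multiplier `θ`. -/
lemma integral_mul_inner_gradient (u : H1) {θ s : E3 → ℝ} (hθ : ContDiff ℝ ∞ θ)
    (hs : ContDiff ℝ ∞ s) (hc : HasCompactSupport s) :
    ∫ x, θ x * inner ℝ (grad u x) (gradient s x)
      = - ∫ x, toL2 u x * (θ x * lap s x + ∑ i, partialDeriv i s x * partialDeriv i θ x) := by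
  have hd := fun i => contDiff_partialDeriv hs i
  have hdc := fun i => hasCompactSupport_partialDeriv hc i
  have h : ∀ i, ∫ x, toL2 u x * partialDeriv i (fun y => θ y * partialDeriv i s y) x
      = - ∫ x, grad u x i * (θ x * partialDeriv i s x) := fun i =>
    integral_mul_partialDeriv u (hθ.mul (hd i)) ((hdc i).mul_left (f := θ)) i
  have i1 : ∀ i, Integrable (fun x => toL2 u x *
      partialDeriv i (fun y => θ y * partialDeriv i s y) x) (volume : Measure E3) := fun i =>
    (Lp.memLp (toL2 u)).integrable_mul
      (memLp_test_deriv (hθ.mul (hd i)) ((hdc i).mul_left (f := θ)) _)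
  have i2 : ∀ i, Integrable (fun x => grad u x i * (θ x * partialDeriv i s x))
      (volume : Measure E3) := fun i =>
    (memLp_coord (grad u) i).integrable_mul
      (memLp_test (hθ.mul (hd i)) ((hdc i).mul_left (f := θ)))
  have e1 : ∀ x, θ x * inner ℝ (grad u x) (gradient s x)
      = ∑ i, grad u x i * (θ x * partialDeriv i s x) := fun x => by
    rw [inner_gradient_eq_sum, Finset.mul_sum]
    exact Finset.sum_congr rfl fun i _ => by ring
  have e2 : ∀ x, toL2 u x * (θ x * lap s x + ∑ i, partialDeriv i s x * partialDeriv i θ x)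
      = ∑ i, toL2 u x * partialDeriv i (fun y => θ y * partialDeriv i s y) x := fun x => by
    rw [lap, Finset.mul_sum, ← Finset.sum_add_distrib, Finset.mul_sum]
    refine Finset.sum_congr rfl fun i _ => ?_
    rw [partialDeriv_mul (contDiff_differentiableAt hθ x) (contDiff_differentiableAt (hd i) x)]
  simp only [e1, e2]
  rw [integral_finsetSum _ fun i _ => i2 i, integral_finsetSum _ fun i _ => i1 i,
    Finset.sum_congr rfl fun i _ => h i]
  simp

lemma integral_inner_gradient (u : H1) {s : E3 → ℝ}
    (hs : ContDiff ℝ ∞ s) (hc : HasCompactSupport s) :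
    ∫ x, inner ℝ (grad u x) (gradient s x) = - ∫ x, toL2 u x * lap s x := by
  have := integral_mul_inner_gradient u (θ := fun _ => 1) contDiff_const hs hc
  simpa [partialDeriv] using this

/-! ### Density of test functions in `H¹` -/

/-- If the second derivative at a maximum were positive, the point would also be a local minimum;
then `g` would be locally constant and the second derivative zero. -/
lemma second_deriv_nonpos_of_isMax {g g' : ℝ → ℝ} {c : ℝ} (hmax : ∀ t, g t ≤ g 0)
    (h1 : ∀ t, HasDerivAt g (g' t) t) (h2 : HasDerivAt g' c 0) : c ≤ 0 := by
  by_contra! hc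
  have hd : deriv g = g' := funext fun t => (h1 t).deriv
  have hmax' : IsLocalMax g 0 := Eventually.of_forall hmax
  have hmin : IsLocalMin g 0 := isLocalMin_of_deriv_deriv_pos (by rw [hd, h2.deriv]; exact hc)
    hmax'.deriv_eq_zero (h1 0).continuousAt
  have hconst : g =ᶠ[𝓝 0] fun _ => g 0 := by
    filter_upwards [hmax', hmin] with t h3 h4 using le_antisymm h3 h4
  have h3 : g' =ᶠ[𝓝 0] fun _ => 0 := by
    have := hconst.deriv
    rw [hd] at this
    filter_upwards [this] with t ht
    simpa using ht
  have := h3.deriv_eq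
  rw [h2.deriv] at this
  simp at this
  exact absurd this (ne_of_gt hc)

/-- A bounded solution of `Δu = u` is nonpositive. -/
lemma nonpos_of_lap_eq {u : E3 → ℝ} {du ddu : Fin 3 → E3 → ℝ} {M : ℝ} (hM : ∀ x, u x ≤ M)
    (hu : Continuous u)
    (h1 : ∀ i x t, HasDerivAt (fun t : ℝ => u (x + t • EuclideanSpace.single i (1 : ℝ)))
      (du i (x + t • EuclideanSpace.single i (1 : ℝ))) t)
    (h2 : ∀ i x, HasDerivAt (fun t : ℝ => du i (x + t • EuclideanSpace.single i (1 : ℝ)))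
      (ddu i x) 0)
    (heq : ∀ x, ∑ i, ddu i x = u x) (x₁ : E3) : u x₁ ≤ 0 := by
  by_contra! hpos
  -- Subtracting `δ(|x|² + 6)` forces a maximum point `z` to exist, and this `δ` is small enough to
  -- keep the maximum positive. The `6` is the Laplacian of `|x|²`: at `z` one has `u = Δu ≤ 6δ`,
  -- while positivity of the maximum says `u > 6δ`.
  set δ : ℝ := u x₁ / (2 * (‖x₁‖ ^ 2 + 6)) with hδ
  have hδ0 : 0 < δ := by positivity
  set U : E3 → ℝ := fun x => u x - δ * (‖x‖ ^ 2 + 6) with hU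
  have hUc : Continuous U := by fun_prop
  have htend : Tendsto U (cocompact E3) atBot := by
    have h3 : Tendsto (fun x : E3 => M - δ * (‖x‖ ^ 2 + 6)) (cocompact E3) atBot := by
      have h4 : Tendsto (fun x : E3 => ‖x‖ ^ 2) (cocompact E3) atTop :=
        (tendsto_pow_atTop two_ne_zero).comp (tendsto_norm_cocompact_atTop (E := E3))
      have h5 := (tendsto_atTop_add_const_right _ (6 : ℝ) h4).const_mul_atTop hδ0
      exact tendsto_const_nhds.add_atBot (tendsto_neg_atTop_atBot.comp h5)
    refine tendsto_atBot_mono (fun x => ?_) h3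
    simp only [hU]
    linarith [hM x]
  obtain ⟨z, hz⟩ := hUc.exists_forall_ge htend
  have hUz : 0 < U z := by
    refine lt_of_lt_of_le ?_ (hz x₁)
    have : δ * (‖x₁‖ ^ 2 + 6) = u x₁ / 2 := by rw [hδ]; field_simp
    simp only [hU, this]
    linarith
  have key : ∀ i, ddu i z ≤ 2 * δ := by
    intro i
    have hq : ∀ t : ℝ, ‖z + t • (EuclideanSpace.single i (1 : ℝ) : E3)‖ ^ 2
        = ‖z‖ ^ 2 + 2 * t * z i + t ^ 2 := by
      intro t
      rw [norm_add_sq_real, norm_smul, real_inner_smul_right, EuclideanSpace.inner_single_right]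
      simp
      ring
    have h3 : ∀ t, HasDerivAt (fun t => U (z + t • EuclideanSpace.single i (1 : ℝ)))
        (du i (z + t • EuclideanSpace.single i (1 : ℝ)) - δ * (2 * z i + 2 * t)) t := by
      intro t
      simp only [hU, hq]
      have h4 : HasDerivAt (fun t : ℝ => ‖z‖ ^ 2 + 2 * t * z i + t ^ 2 + 6)
          (2 * z i + 2 * t) t := by
        have h5 : HasDerivAt (fun t : ℝ => 2 * t * z i) (2 * z i) t := by
          simpa using ((hasDerivAt_id t).const_mul 2).mul_const (z i)
        have h6 : HasDerivAt (fun t : ℝ => t ^ 2) (2 * t) t := by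
          simpa using hasDerivAt_pow 2 t
        exact ((h5.const_add _).add h6).add_const 6
      exact (h1 i z t).sub (h4.const_mul δ)
    have h4 : HasDerivAt (fun t : ℝ => du i (z + t • EuclideanSpace.single i (1 : ℝ))
        - δ * (2 * z i + 2 * t)) (ddu i z - δ * 2) 0 := by
      refine (h2 i z).sub ?_
      have : HasDerivAt (fun t : ℝ => 2 * z i + 2 * t) 2 0 := by
        simpa using ((hasDerivAt_id (0 : ℝ)).const_mul 2).const_add (2 * z i)
      exact this.const_mul δ
    have := second_deriv_nonpos_of_isMax (fun t => by simpa using hz _) h3 h4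
    linarith
  have hsum : u z ≤ 6 * δ := by
    rw [← heq z, Fin.sum_univ_three]
    linarith [key 0, key 1, key 2]
  simp only [hU] at hUz
  nlinarith [sq_nonneg ‖z‖]

lemma lap_comp_sub {g : E3 → ℝ} (x t : E3) :
    lap (fun y => g (x - y)) t = lap g (x - t) := by
  have h : ∀ (φ : E3 → ℝ) (i : Fin 3) (t : E3),
      partialDeriv i (fun y => φ (x - y)) t = - partialDeriv i φ (x - t) := by
    intro φ i t
    simp only [partialDeriv]
    have h1 : (fun y => φ (x - y)) = (fun z => φ (x + z)) ∘ (ContinuousLinearEquiv.neg ℝ) :=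
      funext fun y => by simp [sub_eq_add_neg]
    rw [h1, ContinuousLinearEquiv.comp_right_fderiv, fderiv_comp_add_left]
    simp [sub_eq_add_neg]
  unfold lap
  refine Finset.sum_congr rfl fun i _ => ?_
  have h1 : partialDeriv i (fun y => g (x - y)) = fun y => - partialDeriv i g (x - y) :=
    funext fun y => h g i y
  have h2 : ∀ φ : E3 → ℝ, partialDeriv i (fun y => - φ y) t = - partialDeriv i φ t := by
    intro φ
    simp [partialDeriv]
  rw [h1, h2 (fun y => partialDeriv i g (x - y)), h (partialDeriv i g) i t, neg_neg]

/-- A square integrable distributional solution of `Δr = r` vanishes. -/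
lemma ae_eq_zero_of_forall_test {r : L2}
    (h : ∀ ψ : E3 → ℝ, ContDiff ℝ ∞ ψ → HasCompactSupport ψ →
      ∫ x, r x * ψ x = ∫ x, r x * lap ψ x) : r = 0 := by
  have hloc : LocallyIntegrable r (volume : Measure E3) :=
    (Lp.memLp r).locallyIntegrable (by norm_num)
  have hcs : ∀ {g : E3 → ℝ} (x : E3), HasCompactSupport g →
      HasCompactSupport fun y => g (x - y) := fun {g} x hg =>
    hg.comp_homeomorph (Homeomorph.subLeft x)
  -- The mollification `r ∗ g` is a classical solution of `Δu = u`, bounded by Cauchy–Schwarz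
  -- because `r` and `g` are square integrable; the maximum principle applies to it.
  have key : ∀ g : E3 → ℝ, ContDiff ℝ ∞ g → HasCompactSupport g →
      ∀ x, ∫ t, r t * g (x - t) ≤ 0 := by
    intro g hg hc
    set L := ContinuousLinearMap.mul ℝ ℝ
    set conv : (E3 → ℝ) → E3 → ℝ := fun φ => convolution r φ L volume with hconv
    have hconv_eq : ∀ φ x, conv φ x = ∫ t, r t * φ (x - t) := fun φ x => rfl
    have hderiv : ∀ φ : E3 → ℝ, ContDiff ℝ ∞ φ → HasCompactSupport φ → ∀ (i : Fin 3) (x : E3)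
        (t : ℝ), HasDerivAt (fun t => conv φ (x + t • EuclideanSpace.single i (1 : ℝ)))
        (conv (partialDeriv i φ) (x + t • EuclideanSpace.single i (1 : ℝ))) t := by
      intro φ hφ hcφ i x t
      have h1 := hcφ.hasFDerivAt_convolution_right L hloc (hφ.of_le (by simp))
        (x + t • EuclideanSpace.single i (1 : ℝ))
      have h2 : HasDerivAt (fun t : ℝ => x + t • (EuclideanSpace.single i (1 : ℝ) : E3))
          (EuclideanSpace.single i (1 : ℝ)) t := by
        simpa using ((hasDerivAt_id t).smul_const
          (EuclideanSpace.single i (1 : ℝ) : E3)).const_add x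
      have h3 := h1.comp_hasDerivAt t h2
      rw [convolution_precompR_apply L hloc (hcφ.fderiv (𝕜 := ℝ))
        (hφ.continuous_fderiv (by simp))] at h3
      exact h3
    have hd := fun i => contDiff_partialDeriv hg i
    have hdc := fun i => hasCompactSupport_partialDeriv hc i
    have hbound : ∃ M, ∀ x, conv g x ≤ M := by
      refine ⟨‖r‖ * ‖((memLp_test hg hc).toLp g : L2)‖, fun x => ?_⟩
      have hm := memLp_test (hg.comp (contDiff_const.sub contDiff_id)) (hcs x hc)
      have h1 : conv g x = inner ℝ r (hm.toLp _) := by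
        rw [hconv_eq, ← integral_mul_eq_inner]
        refine integral_congr_ae ?_
        filter_upwards [hm.coeFn_toLp] with t ht
        rw [ht]
        rfl
      have h2 : ‖(hm.toLp _ : L2)‖ = ‖((memLp_test hg hc).toLp g : L2)‖ := by
        rw [Lp.norm_toLp, Lp.norm_toLp]
        congr 1
        exact eLpNorm_comp_measurePreserving hg.continuous.aestronglyMeasurable
          (Measure.measurePreserving_sub_left volume x)
      rw [h1, ← h2]
      exact real_inner_le_norm _ _
    obtain ⟨M, hM⟩ := hbound
    refine nonpos_of_lap_eq (u := conv g) (du := fun i => conv (partialDeriv i g))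
      (ddu := fun i => conv (partialDeriv i (partialDeriv i g))) hM ?_
      (hderiv g hg hc) (fun i x => ?_) fun x => ?_
    · exact hc.continuous_convolution_right L hloc hg.continuous
    · simpa using hderiv _ (hd i) (hdc i) i x 0
    · have h1 := h (fun y => g (x - y)) (hg.comp (contDiff_const.sub contDiff_id)) (hcs x hc)
      simp only [lap_comp_sub] at h1
      rw [hconv_eq, h1]
      simp only [hconv_eq]
      rw [← integral_finsetSum]
      · refine integral_congr_ae (ae_of_all _ fun t => ?_)
        simp only [lap, Finset.mul_sum]
      · intro i _
        refine (Lp.memLp r).integrable_mul (memLp_test (ψ := fun t =>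
          partialDeriv i (partialDeriv i g) (x - t)) ?_ (hcs x ?_))
        · exact (contDiff_partialDeriv (hd i) i).comp (contDiff_const.sub contDiff_id)
        · exact hasCompactSupport_partialDeriv (hdc i) i
  have hz : ∀ᵐ x : E3, r x = 0 := by
    refine ae_eq_zero_of_integral_contDiff_smul_eq_zero hloc fun g hg hc => ?_
    have hg' : ContDiff ℝ ∞ fun y => g (-y) := hg.comp contDiff_neg
    have hc' : HasCompactSupport fun y => g (-y) := hc.comp_homeomorph (Homeomorph.neg E3)
    -- At the origin, the reflected test function and its negative give both inequalities for `∫ r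
    -- g`.
    have h1 := key _ hg' hc' 0
    have h2 := key (fun y => - g (-y)) hg'.neg hc'.neg 0
    simp only [zero_sub, neg_neg, mul_neg, integral_neg] at h1 h2
    simp only [smul_eq_mul, mul_comm (g _)]
    linarith
  exact Lp.eq_zero_iff_ae_eq_zero.2 hz

lemma grad_eq_zero_of_toL2_eq_zero {u : H1} (h : toL2 u = 0) : grad u = 0 := by
  rw [Lp.eq_zero_iff_ae_eq_zero]
  have hi : ∀ i, ∀ᵐ x : E3, grad u x i = 0 := fun i => by
    refine ae_eq_zero_of_integral_contDiff_smul_eq_zero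
      ((memLp_coord (grad u) i).locallyIntegrable (by norm_num)) fun g hg hc => ?_
    have h1 := integral_mul_partialDeriv u hg hc i
    have h2 : ∫ x, toL2 u x * partialDeriv i g x = 0 := by
      rw [h]
      refine integral_eq_zero_of_ae ?_
      filter_upwards [Lp.coeFn_zero ℝ 2 (volume : Measure E3)] with x hx
      rw [hx]; simp
    simp only [smul_eq_mul, mul_comm (g _)]
    linarith
  filter_upwards [ae_all_iff.2 hi] with x hx
  ext i
  simpa using hx i

/-- Test functions are dense in `H¹`. -/
theorem exists_test_norm_sub_lt (u : H1) {ε : ℝ} (hε : 0 < ε) :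
    ∃ (ψ : E3 → ℝ) (p : H1), ContDiff ℝ ∞ ψ ∧ HasCompactSupport ψ ∧
      toL2 p =ᵐ[volume] ψ ∧ grad p =ᵐ[volume] gradient ψ ∧ ‖p - u‖ < ε := by
  set S : Set H1 := {p | ∃ ψ : E3 → ℝ, ContDiff ℝ ∞ ψ ∧ HasCompactSupport ψ ∧
    toL2 p =ᵐ[volume] ψ ∧ grad p =ᵐ[volume] gradient ψ} with hS
  have hgrad_add : ∀ φ ψ : E3 → ℝ, ContDiff ℝ ∞ φ → ContDiff ℝ ∞ ψ → ∀ x,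
      gradient (φ + ψ) x = gradient φ x + gradient ψ x := fun φ ψ hφ hψ x => by
    simp only [gradient]
    rw [fderiv_add (contDiff_differentiableAt hφ x) (contDiff_differentiableAt hψ x), map_add]
  have hgrad_smul : ∀ (c : ℝ) (φ : E3 → ℝ), ContDiff ℝ ∞ φ → ∀ x,
      gradient (c • φ) x = c • gradient φ x := fun c φ hφ x => by
    simp only [gradient]
    rw [fderiv_const_smul (contDiff_differentiableAt hφ x)]
    simp
  let K : Submodule ℝ H1 :=
    { carrier := S
      zero_mem' := by
        refine ⟨0, contDiff_const, HasCompactSupport.zero, ?_, ?_⟩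
        · rw [map_zero]; exact Lp.coeFn_zero _ _ _
        · rw [map_zero]
          filter_upwards [Lp.coeFn_zero E3 2 (volume : Measure E3)] with x hx
          rw [hx]
          simp [gradient]
      add_mem' := by
        rintro p q ⟨φ, h1, h2, h3, h4⟩ ⟨ψ, h1', h2', h3', h4'⟩
        refine ⟨φ + ψ, h1.add h1', h2.add h2', ?_, ?_⟩
        · rw [map_add]
          filter_upwards [Lp.coeFn_add (toL2 p) (toL2 q), h3, h3'] with x e1 e2 e3
          rw [e1, Pi.add_apply, e2, e3, Pi.add_apply]
        · rw [map_add]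
          filter_upwards [Lp.coeFn_add (grad p) (grad q), h4, h4'] with x e1 e2 e3
          rw [e1, Pi.add_apply, e2, e3, hgrad_add φ ψ h1 h1']
      smul_mem' := by
        rintro c p ⟨φ, h1, h2, h3, h4⟩
        refine ⟨c • φ, h1.const_smul c, h2.smul_left (f := fun _ => c), ?_, ?_⟩
        · rw [map_smul]
          filter_upwards [Lp.coeFn_smul c (toL2 p), h3] with x e1 e2
          rw [e1, Pi.smul_apply, e2, Pi.smul_apply]
        · rw [map_smul]
          filter_upwards [Lp.coeFn_smul c (grad p), h4] with x e1 e2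
          rw [e1, Pi.smul_apply, e2, hgrad_smul c φ h1] }
  -- Density by duality: an element of `H¹` orthogonal to all test functions is a weak solution of
  -- `Δr = r`.
  have horth : Kᗮ = ⊥ := by
    rw [Submodule.eq_bot_iff]
    intro r hr
    have h0 : toL2 r = 0 := by
      refine ae_eq_zero_of_forall_test fun ψ hψ hc => ?_
      obtain ⟨p, hp1, hp2⟩ := exists_H1_test hψ hc
      have h1 : inner ℝ p r = 0 :=
        Submodule.inner_right_of_mem_orthogonal (K := K) ⟨ψ, hψ, hc, hp1, hp2⟩ hr
      have h2 : inner ℝ p r = inner ℝ (toL2 p) (toL2 r) + inner ℝ (grad p) (grad r) := rfl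
      have h3 : inner ℝ (toL2 p) (toL2 r) = ∫ x, toL2 r x * ψ x := by
        rw [real_inner_comm, ← integral_mul_eq_inner]
        refine integral_congr_ae ?_
        filter_upwards [hp1] with x hx
        rw [hx]
      have h4 : inner ℝ (grad p) (grad r) = ∫ x, inner ℝ (grad r x) (gradient ψ x) := by
        rw [real_inner_comm, L2.inner_def]
        refine integral_congr_ae ?_
        filter_upwards [hp2] with x hx
        rw [hx]
      rw [integral_inner_gradient r hψ hc] at h4
      linarith
    have h1 := grad_eq_zero_of_toL2_eq_zero h0
    have h2 := H1.norm_sq_eq r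
    rw [h0, h1] at h2
    simpa using h2
  have hdense : u ∈ K.topologicalClosure := by
    rw [Submodule.topologicalClosure_eq_top_iff.2 horth]
    trivial
  obtain ⟨p, ⟨ψ, h1, h2, h3, h4⟩, hp⟩ := Metric.mem_closure_iff.1 hdense ε hε
  refine ⟨ψ, p, h1, h2, h3, h4, ?_⟩
  rwa [← dist_eq_norm, dist_comm]

/-! ### Positivity of the resolvent -/

lemma form_layered (γp γm : ℝ) (u φ : H1) :
    form (layered γp γm) u φ
      = ∫ x, layeredScalar γp γm x * inner ℝ (grad u x) (grad φ x) := by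
  simp only [form_eq, quad_layered]

/-- The solution minimises `a(p,p) - 2⟨f, p⟩`, and the squared energy distance to it is the excess
over the minimum. A competitor that hardly increases this functional therefore stays close to `v`.
-/
lemma resolventForm_sub_sub {γ : E3 → Matrix (Fin 3) (Fin 3) ℝ} (hγ : IsCoefficient γ) {τ : ℝ}
    {f : L2} {v : H1} (hv : IsResolventSolution γ τ f v) (p : H1) :
    resolventForm γ τ (p - v) (p - v)
      = resolventForm γ τ p p - 2 * inner ℝ f (toL2 p) + inner ℝ f (toL2 v) := by
  have h := isResolventSolution_iff.1 hv
  rw [resolventForm_sub_left hγ, resolventForm_sub_right hγ, resolventForm_sub_right hγ,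
    resolventForm_comm hγ τ p v, h, h]
  ring

/-- The smoothed absolute value `√(ψ² + δ²) - δ` of a test function. -/
lemma smoothAbs_spec {ψ : E3 → ℝ} (h : ContDiff ℝ ∞ ψ) (hc : HasCompactSupport ψ) {δ : ℝ}
    (hδ : 0 < δ) :
    ContDiff ℝ ∞ (fun x => √(ψ x ^ 2 + δ ^ 2) - δ) ∧
    HasCompactSupport (fun x => √(ψ x ^ 2 + δ ^ 2) - δ) ∧
    (∀ x, 0 ≤ √(ψ x ^ 2 + δ ^ 2) - δ) ∧
    (∀ x, √(ψ x ^ 2 + δ ^ 2) - δ ≤ |ψ x|) ∧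
    (∀ x, ‖gradient (fun x => √(ψ x ^ 2 + δ ^ 2) - δ) x‖ ≤ ‖gradient ψ x‖) := by
  have hpos : ∀ x, 0 < ψ x ^ 2 + δ ^ 2 := fun x => by positivity
  refine ⟨?_, ?_, fun x => ?_, fun x => ?_, fun x => ?_⟩
  · exact ((h.pow 2).add contDiff_const).sqrt (fun x => (hpos x).ne') |>.sub contDiff_const
  · refine hc.comp_left (g := fun t => √(t ^ 2 + δ ^ 2) - δ) ?_
    simp [Real.sqrt_sq hδ.le]
  · rw [sub_nonneg]
    exact Real.le_sqrt_of_sq_le (by nlinarith [sq_nonneg (ψ x)])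
  · rw [sub_le_iff_le_add, Real.sqrt_le_left (by positivity)]
    have := abs_nonneg (ψ x)
    nlinarith [sq_abs (ψ x)]
  · rw [norm_gradient, norm_gradient]
    have h1 : HasFDerivAt ψ (fderiv ℝ ψ x) x := (contDiff_differentiableAt h x).hasFDerivAt
    have h2 : HasDerivAt (fun t : ℝ => √(t ^ 2 + δ ^ 2) - δ)
        (2 * ψ x / (2 * √(ψ x ^ 2 + δ ^ 2))) (ψ x) := by
      have h3 : HasDerivAt (fun t : ℝ => t ^ 2 + δ ^ 2) (2 * ψ x) (ψ x) := by
        simpa using (hasDerivAt_pow 2 (ψ x)).add_const (δ ^ 2)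
      exact (h3.sqrt (hpos x).ne').sub_const δ
    have h4 := h2.comp_hasFDerivAt x h1
    have h5 : fderiv ℝ (fun x => √(ψ x ^ 2 + δ ^ 2) - δ) x
        = (2 * ψ x / (2 * √(ψ x ^ 2 + δ ^ 2))) • fderiv ℝ ψ x := h4.fderiv
    rw [h5, norm_smul]
    have h6 : ‖2 * ψ x / (2 * √(ψ x ^ 2 + δ ^ 2))‖ ≤ 1 := by
      rw [mul_div_mul_left _ _ two_ne_zero, norm_div, Real.norm_eq_abs, Real.norm_eq_abs,
        abs_of_nonneg (Real.sqrt_nonneg _)]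
      refine div_le_one_of_le₀ (Real.abs_le_sqrt ?_) (Real.sqrt_nonneg _)
      nlinarith
    exact mul_le_of_le_one_left (norm_nonneg _) h6

/-- The resolvent of the layered medium preserves positivity. -/
theorem nonneg_of_isResolventSolution {γp γm : ℝ} (hp : 0 < γp) (hm : 0 < γm) {τ : ℝ}
    (hτ : τ ≠ 0) {f : L2} (hf : ∀ᵐ x : E3, 0 ≤ f x) {v : H1}
    (hv : IsResolventSolution (layered γp γm) τ f v) : ∀ᵐ x : E3, 0 ≤ toL2 v x := by
  have hγ := isCoefficient_layered hp hm
  obtain ⟨A, hA⟩ := exists_bilin hγ τ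
  obtain ⟨c, hc, hge⟩ := exists_resolventForm_ge hγ
  -- The positive cone of `L²` is closed, so it is enough to approximate `v` by nonnegative
  -- functions.
  suffices hcl : toL2 v ∈ closure (Ici (0 : L2)) by
    rw [IsClosed.closure_eq isClosed_Ici] at hcl
    exact (Lp.coeFn_nonneg _).2 hcl
  rw [Metric.mem_closure_iff]
  intro ε hε
  set η : ℝ := τ ^ 2 * ε ^ 2 with hη
  have hη0 : 0 < η := by positivity
  have hAc : Tendsto (fun q : H1 => resolventForm (layered γp γm) τ q q) (𝓝 0) (𝓝 0) := by
    have h1 : Continuous fun q : H1 => A q q := by fun_prop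
    have := h1.tendsto 0
    simpa [hA] using this
  obtain ⟨ε₁, hε₁, hball⟩ := Metric.eventually_nhds_iff.1
    (hAc.eventually (gt_mem_nhds (show (0 : ℝ) < η / 2 by positivity)))
  obtain ⟨ψ, p, hψ, hcψ, hpL, hpG, hpv⟩ := exists_test_norm_sub_lt v hε₁
  have hApv : resolventForm (layered γp γm) τ (p - v) (p - v) < η / 2 :=
    hball (by rwa [dist_zero_right])
  set K := tsupport ψ with hK
  have hKm : MeasurableSet K := (isClosed_tsupport ψ).measurableSet
  have hfK : IntegrableOn f K volume :=
    ((Lp.memLp f).locallyIntegrable (by norm_num)).integrableOn_isCompact hcψ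
  set m := ∫ x in K, f x with hm'
  have hm0 : 0 ≤ m := integral_nonneg_of_ae (ae_restrict_of_ae hf)
  -- Replacing `p` by its smoothed absolute value `q` costs at most `2δm ≤ η/4` in the functional.
  -- The integral `m` is taken over the support of `ψ`, because `f` need not be globally integrable.
  set δ : ℝ := η / (8 * (m + 1)) with hδ
  have hδ0 : 0 < δ := by positivity
  obtain ⟨hq1, hq2, hq3, hq4, hq5⟩ := smoothAbs_spec hψ hcψ hδ0
  obtain ⟨q, hqL, hqG⟩ := exists_H1_test hq1 hq2
  -- The smoothed absolute value decreases both the modulus and the gradient; the scalar coefficient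
  -- makes the gradient norm the relevant quantity.
  have hle : resolventForm (layered γp γm) τ q q ≤ resolventForm (layered γp γm) τ p p := by
    simp only [resolventForm]
    refine add_le_add ?_ (mul_le_mul_of_nonneg_left ?_ (sq_nonneg τ))
    · rw [form_eq, form_eq]
      refine integral_mono_ae (integrable_quad hγ _ _) (integrable_quad hγ _ _) ?_
      filter_upwards [hpG, hqG] with x h1 h2
      rw [quad_layered, quad_layered, h1, h2, real_inner_self_eq_norm_sq,
        real_inner_self_eq_norm_sq]
      have := layeredScalar_pos hp hm x
      have := hq5 x
      gcongr
    · rw [← integral_mul_eq_inner, ← integral_mul_eq_inner]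
      refine integral_mono_ae ((Lp.memLp _).integrable_mul (Lp.memLp _))
        ((Lp.memLp _).integrable_mul (Lp.memLp _)) ?_
      filter_upwards [hpL, hqL] with x h1 h2
      rw [h1, h2, ← abs_mul_abs_self (ψ x)]
      have := hq3 x
      have := hq4 x
      gcongr
  have hfle : inner ℝ f (toL2 p) - δ * m ≤ inner ℝ f (toL2 q) := by
    have h1 : δ * m = ∫ x, K.indicator (fun x => δ * f x) x := by
      rw [integral_indicator hKm, integral_const_mul]
    have hi : Integrable (K.indicator fun x => δ * f x) (volume : Measure E3) :=
      (integrable_indicator_iff hKm).2 (hfK.const_mul δ)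
    have hip : Integrable (fun x => f x * toL2 p x) (volume : Measure E3) :=
      (Lp.memLp f).integrable_mul (Lp.memLp _)
    rw [← integral_mul_eq_inner, ← integral_mul_eq_inner, h1, ← integral_sub hip hi]
    refine integral_mono_ae (hip.sub hi) ((Lp.memLp f).integrable_mul (Lp.memLp _)) ?_
    filter_upwards [hpL, hqL, hf] with x h1 h2 h3
    by_cases hxK : x ∈ K
    · rw [indicator_of_mem hxK, h1, h2]
      have h4 : ψ x ≤ √(ψ x ^ 2 + δ ^ 2) := Real.le_sqrt_of_sq_le (by nlinarith)
      nlinarith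
    · rw [indicator_of_notMem hxK, h1, h2, image_eq_zero_of_notMem_tsupport hxK]
      simp [Real.sqrt_sq hδ0.le]
  have hAq : resolventForm (layered γp γm) τ (q - v) (q - v) < η := by
    rw [resolventForm_sub_sub hγ hv] at hApv ⊢
    have : δ * m ≤ η / 8 := by
      rw [hδ, div_mul_eq_mul_div, div_le_div_iff₀ (by positivity) (by norm_num)]
      nlinarith
    linarith
  refine ⟨toL2 q, ?_, ?_⟩
  · refine (Lp.coeFn_nonneg _).1 ?_
    filter_upwards [hqL] with x hx
    rw [hx]
    exact hq3 x
  · have h1 := hge τ (q - v)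
    have h2 : τ ^ 2 * ‖toL2 (q - v)‖ ^ 2 < τ ^ 2 * ε ^ 2 := by
      nlinarith [mul_nonneg hc.le (sq_nonneg ‖grad (q - v)‖)]
    have h3 : ‖toL2 (q - v)‖ < ε := by
      refine lt_of_pow_lt_pow_left₀ 2 hε.le (lt_of_mul_lt_mul_left h2 (sq_nonneg τ))
    rwa [dist_comm, dist_eq_norm, ← map_sub]

/-! ### A smooth ramp function -/

/-- A smooth convex function that vanishes for `t ≤ 0` and has slope `1` for `t ≥ 1`. -/
def ramp (t : ℝ) : ℝ := ∫ s in (0 : ℝ)..t, Real.smoothTransition s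

lemma intervalIntegrable_smoothTransition (a b : ℝ) :
    IntervalIntegrable Real.smoothTransition volume a b :=
  Real.smoothTransition.continuous.intervalIntegrable a b

lemma hasDerivAt_ramp (t : ℝ) : HasDerivAt ramp (Real.smoothTransition t) t :=
  intervalIntegral.integral_hasDerivAt_right (intervalIntegrable_smoothTransition 0 t)
    (Real.smoothTransition.continuous.stronglyMeasurableAtFilter _ _)
    Real.smoothTransition.continuousAt

lemma contDiff_ramp : ContDiff ℝ ∞ ramp := by
  rw [contDiff_infty_iff_deriv]
  refine ⟨fun t => (hasDerivAt_ramp t).differentiableAt, ?_⟩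
  rw [show deriv ramp = Real.smoothTransition from funext fun t => (hasDerivAt_ramp t).deriv]
  exact Real.smoothTransition.contDiff

lemma ramp_of_nonpos {t : ℝ} (ht : t ≤ 0) : ramp t = 0 := by
  rw [ramp, intervalIntegral.integral_symm, neg_eq_zero]
  rw [intervalIntegral.integral_congr (g := fun _ => 0)]
  · simp
  · intro s hs
    rw [uIcc_of_le ht] at hs
    exact Real.smoothTransition.zero_of_nonpos hs.2

lemma ramp_nonneg (t : ℝ) : 0 ≤ ramp t := by
  rcases le_total t 0 with ht | ht
  · exact (ramp_of_nonpos ht).ge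
  · exact intervalIntegral.integral_nonneg ht fun s _ => Real.smoothTransition.nonneg s

/-- Convexity: the slope at `t` bounds all earlier slopes. This lets a barrier be compared with its
own slope factor. -/
lemma ramp_le_mul (t : ℝ) : ramp t ≤ t * Real.smoothTransition t := by
  rcases le_total t 0 with ht | ht
  · rw [ramp_of_nonpos ht, Real.smoothTransition.zero_of_nonpos ht, mul_zero]
  · have := intervalIntegral.integral_mono_on ht (intervalIntegrable_smoothTransition 0 t)
      (intervalIntegrable_const (c := Real.smoothTransition t))
      fun s hs => Real.smoothTransition.monotone hs.2
    simpa [ramp] using this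

lemma sub_one_le_ramp (t : ℝ) : t - 1 ≤ ramp t := by
  rcases le_total t 1 with ht | ht
  · linarith [ramp_nonneg t]
  · have h1 : ramp t = ramp 1 + ∫ s in (1 : ℝ)..t, Real.smoothTransition s :=
      (intervalIntegral.integral_add_adjacent_intervals
        (intervalIntegrable_smoothTransition 0 1) (intervalIntegrable_smoothTransition 1 t)).symm
    have h2 : ∫ s in (1 : ℝ)..t, Real.smoothTransition s = ∫ s in (1 : ℝ)..t, (1 : ℝ) := by
      refine intervalIntegral.integral_congr fun s hs => ?_
      rw [uIcc_of_le ht] at hs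
      exact Real.smoothTransition.one_of_one_le hs.1
    rw [h1, h2]
    simp
    exact ramp_nonneg 1

lemma deriv_smoothTransition_nonneg (t : ℝ) : 0 ≤ deriv Real.smoothTransition t :=
  Real.smoothTransition.monotone.deriv_nonneg

lemma hasDerivAt_smoothTransition (t : ℝ) :
    HasDerivAt Real.smoothTransition (deriv Real.smoothTransition t) t :=
  (Real.smoothTransition.contDiffAt (n := 1)).differentiableAt (by simp) |>.hasDerivAt

/-- Such points are global minima of the transition function, which covers the endpoint `t = 0` as
well. -/
lemma deriv_smoothTransition_of_nonpos {t : ℝ} (ht : t ≤ 0) :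
    deriv Real.smoothTransition t = 0 := by
  refine IsLocalMin.deriv_eq_zero (Eventually.of_forall fun s => ?_)
  rw [Real.smoothTransition.zero_of_nonpos ht]
  exact Real.smoothTransition.nonneg s

lemma deriv_smoothTransition_of_one_le {t : ℝ} (ht : 1 ≤ t) :
    deriv Real.smoothTransition t = 0 := by
  refine IsLocalMax.deriv_eq_zero (Eventually.of_forall fun s => ?_)
  rw [Real.smoothTransition.one_of_one_le ht]
  exact Real.smoothTransition.le_one s

/-! ### Integration by parts across the interface -/

lemma partialDeriv_comp_coord {g : ℝ → ℝ} {g' : ℝ} {x : E3} (h : HasDerivAt g g' (x 2))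
    (i : Fin 3) : partialDeriv i (fun y => g (y 2)) x = if i = 2 then g' else 0 := by
  have h1 : HasFDerivAt (fun y : E3 => y 2) (EuclideanSpace.proj 2 : E3 →L[ℝ] ℝ) x :=
    (EuclideanSpace.proj 2 : E3 →L[ℝ] ℝ).hasFDerivAt
  have h2 := h.comp_hasFDerivAt x h1
  have h3 : fderiv ℝ (fun y : E3 => g (y 2)) x
      = g' • (EuclideanSpace.proj 2 : E3 →L[ℝ] ℝ) := h2.fderiv
  rw [partialDeriv, h3]
  by_cases hi : i = 2
  · simp [hi]
  · simp [hi, Ne.symm hi]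

lemma integrable_inner_gradient (v : H1) {s : E3 → ℝ} (hs : ContDiff ℝ ∞ s)
    (hc : HasCompactSupport s) :
    Integrable (fun x => inner ℝ (grad v x) (gradient s x)) (volume : Measure E3) := by
  simp only [inner_gradient_eq_sum]
  exact integrable_finsetSum _ fun i _ =>
    (memLp_coord (grad v) i).integrable_mul (memLp_test_deriv hs hc _)

/-- One-sided integration by parts for a nonnegative function: the surface term has a sign. -/
lemma integral_layered_inner_le {γp γm : ℝ} (hp : 0 < γp) (hm : 0 < γm) {v : H1}
    (hv : ∀ᵐ x : E3, 0 ≤ toL2 v x) {s : E3 → ℝ} (hs : ContDiff ℝ ∞ s)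
    (hc : HasCompactSupport s) {ε : ℝ} (hε : 0 < ε)
    (hside : ∀ x : E3, 0 < x 2 → x 2 < ε → 0 ≤ (γp - γm) * partialDeriv 2 s x) :
    ∫ x, layeredScalar γp γm x * inner ℝ (grad v x) (gradient s x)
      ≤ - ∫ x, toL2 v x * (layeredScalar γp γm x * lap s x) := by
  -- A smooth coefficient whose transition layer `0 < x₃ < 1/n` lies above the plane, so that it
  -- converges at every point, including `x₃ = 0`, where `layeredScalar` takes the lower value.
  set a : ℕ → E3 → ℝ := fun n x => γm + (γp - γm) * Real.smoothTransition (n * x 2) with ha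
  have hacd : ∀ n, ContDiff ℝ ∞ (a n) := fun n => by
    refine contDiff_const.add (contDiff_const.mul (Real.smoothTransition.contDiff.comp ?_))
    exact contDiff_const.mul (EuclideanSpace.proj 2 : E3 →L[ℝ] ℝ).contDiff
  have hbd : ∀ n x, |a n x| ≤ max γp γm := fun n x => by
    have h0 := Real.smoothTransition.nonneg (n * x 2)
    have h1 := Real.smoothTransition.le_one (n * x 2)
    have h2 := le_max_left γp γm
    have h3 := le_max_right γp γm
    simp only [ha]
    rw [abs_of_nonneg (by nlinarith)]
    nlinarith
  have hlim : ∀ x, Tendsto (fun n => a n x) atTop (𝓝 (layeredScalar γp γm x)) := fun x => by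
    refine tendsto_const_nhds.congr' ?_
    unfold layeredScalar
    split_ifs with hx
    · obtain ⟨N, hN⟩ := exists_nat_gt (1 / x 2)
      filter_upwards [eventually_ge_atTop N] with n hn
      have : (1 : ℝ) ≤ n * x 2 := by
        rw [div_lt_iff₀ hx] at hN
        have : (N : ℝ) ≤ n := by exact_mod_cast hn
        nlinarith
      simp only [ha]
      rw [Real.smoothTransition.one_of_one_le this]
      ring
    · refine Eventually.of_forall fun n => ?_
      have : (n : ℝ) * x 2 ≤ 0 := mul_nonpos_of_nonneg_of_nonpos n.cast_nonneg (not_lt.1 hx)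
      simp only [ha]
      rw [Real.smoothTransition.zero_of_nonpos this]
      ring
  have hint1 : Integrable (fun x => inner ℝ (grad v x) (gradient s x)) (volume : Measure E3) :=
    integrable_inner_gradient v hs hc
  have hlapc : MemLp (lap s) 2 (volume : Measure E3) :=
    (continuous_lap hs).memLp_of_hasCompactSupport (hasCompactSupport_lap hc)
  have hint2 : Integrable (fun x => toL2 v x * lap s x) (volume : Measure E3) :=
    (Lp.memLp (toL2 v)).integrable_mul hlapc
  have ht1 : Tendsto (fun n => ∫ x, a n x * inner ℝ (grad v x) (gradient s x)) atTop
      (𝓝 (∫ x, layeredScalar γp γm x * inner ℝ (grad v x) (gradient s x))) := by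
    refine tendsto_integral_of_dominated_convergence
      (fun x => max γp γm * ‖inner ℝ (grad v x) (gradient s x)‖)
      (fun n => (hacd n).continuous.aestronglyMeasurable.mul hint1.1)
      (hint1.norm.const_mul _) (fun n => ae_of_all _ fun x => ?_)
      (ae_of_all _ fun x => (hlim x).mul_const _)
    rw [norm_mul]
    exact mul_le_mul_of_nonneg_right (hbd n x) (norm_nonneg _)
  have ht2 : Tendsto (fun n => - ∫ x, toL2 v x * (a n x * lap s x)) atTop
      (𝓝 (- ∫ x, toL2 v x * (layeredScalar γp γm x * lap s x))) := by
    refine (tendsto_integral_of_dominated_convergence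
      (fun x => max γp γm * ‖toL2 v x * lap s x‖)
      (fun n => (Lp.memLp (toL2 v)).1.mul
        ((hacd n).continuous.aestronglyMeasurable.mul hlapc.1))
      (hint2.norm.const_mul _) (fun n => ae_of_all _ fun x => ?_)
      (ae_of_all _ fun x => ((hlim x).mul_const _).const_mul _)).neg
    change ‖toL2 v x * (a n x * lap s x)‖ ≤ _
    rw [show toL2 v x * (a n x * lap s x) = a n x * (toL2 v x * lap s x) by ring, norm_mul]
    exact mul_le_mul_of_nonneg_right (hbd n x) (norm_nonneg _)
  refine le_of_tendsto_of_tendsto ht1 ht2 ?_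
  -- For `n > 1/ε` the transition layer fits inside the slab where the sign of `∂₃s` is prescribed.
  obtain ⟨N, hN⟩ := exists_nat_gt (1 / ε)
  filter_upwards [eventually_ge_atTop N] with n hn
  have hn' : 1 < n * ε := by
    rw [div_lt_iff₀ hε] at hN
    have : (N : ℝ) ≤ n := by exact_mod_cast hn
    nlinarith
  have hn0 : (0 : ℝ) < n := by
    by_contra! h
    nlinarith
  have hpd : ∀ x i, partialDeriv i (a n) x
      = if i = 2 then (γp - γm) * (deriv Real.smoothTransition (n * x 2) * n) else 0 := by
    intro x i
    refine partialDeriv_comp_coord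
      (g := fun t => γm + (γp - γm) * Real.smoothTransition (n * t)) ?_ i
    have h1 : HasDerivAt (fun t : ℝ => n * t) n (x 2) := by
      simpa using (hasDerivAt_id (x 2)).const_mul (n : ℝ)
    exact ((((hasDerivAt_smoothTransition (n * x 2)).comp (x 2) h1).const_mul _).const_add _)
  rw [integral_mul_inner_gradient v (hacd n) hs hc, neg_le_neg_iff]
  -- Before the limit this is the surface term `∇s · ∇aₙ`. It has a sign, and so it can be dropped
  -- against the nonnegative `v`.
  have hsum : ∀ x, 0 ≤ ∑ i, partialDeriv i s x * partialDeriv i (a n) x := by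
    intro x
    simp only [hpd, mul_ite, mul_zero, Finset.sum_ite_eq', Finset.mem_univ, if_true]
    by_cases h1 : 0 < x 2
    · by_cases h2 : x 2 < ε
      · have h3 := hside x h1 h2
        have h4 := deriv_smoothTransition_nonneg (n * x 2)
        have h5 : 0 ≤ (γp - γm) * partialDeriv 2 s x
          * (deriv Real.smoothTransition (n * x 2) * n) := by positivity
        linarith
      · rw [deriv_smoothTransition_of_one_le (by nlinarith)]
        simp
    · rw [deriv_smoothTransition_of_nonpos (by nlinarith)]
      simp
  have hpc : ∀ i, Continuous (partialDeriv i (a n)) := fun i =>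
    (contDiff_partialDeriv (hacd n) i).continuous
  have hsc : Continuous fun x => ∑ i, partialDeriv i s x * partialDeriv i (a n) x :=
    continuous_finsetSum _ fun i _ => (contDiff_partialDeriv hs i).continuous.mul (hpc i)
  have hscs : HasCompactSupport fun x => ∑ i, partialDeriv i s x * partialDeriv i (a n) x := by
    refine HasCompactSupport.intro hc fun x hx => Finset.sum_eq_zero fun i _ => ?_
    have : partialDeriv i s x = 0 := by
      by_contra h
      exact hx (tsupport_fderiv_apply_subset ℝ _ (subset_closure h))
    rw [this, zero_mul]
  have hal : MemLp (fun x => a n x * lap s x) 2 (volume : Measure E3) :=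
    ((hacd n).continuous.mul (continuous_lap hs)).memLp_of_hasCompactSupport
      ((hasCompactSupport_lap hc).mul_left (f := a n))
  refine integral_mono_ae ((Lp.memLp (toL2 v)).integrable_mul hal)
    ((Lp.memLp (toL2 v)).integrable_mul
      (hal.add (hsc.memLp_of_hasCompactSupport hscs))) ?_
  filter_upwards [hv] with x hx
  refine mul_le_mul_of_nonneg_left ?_ hx
  simpa using hsum x

/-! ### Radial barriers -/

lemma coord_sub_single (x x₀ : E3) (i : Fin 3) :
    inner ℝ (x - x₀) (EuclideanSpace.single i (1 : ℝ) : E3) = x i - x₀ i := by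
  rw [EuclideanSpace.inner_single_right]
  simp

lemma partialDeriv_radial {Q : ℝ → ℝ} {Q' : ℝ} {x x₀ : E3} (h : HasDerivAt Q Q' (‖x - x₀‖ ^ 2))
    (i : Fin 3) :
    partialDeriv i (fun y => Q (‖y - x₀‖ ^ 2)) x = 2 * (x i - x₀ i) * Q' := by
  have h1 : HasFDerivAt (fun y : E3 => ‖y - x₀‖ ^ 2) (2 • innerSL ℝ (x - x₀)) x := by
    have := ((hasFDerivAt_id x).sub_const x₀).norm_sq
    simpa using this
  have h2 := h.comp_hasFDerivAt x h1
  have h3 : fderiv ℝ (fun y : E3 => Q (‖y - x₀‖ ^ 2)) x = Q' • (2 • innerSL ℝ (x - x₀)) :=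
    h2.fderiv
  rw [partialDeriv, h3]
  have := coord_sub_single x x₀ i
  simp only [smul_apply, innerSL_apply_apply, this, smul_eq_mul, nsmul_eq_mul]
  push_cast
  ring

/-- Profiles are taken as functions of the squared distance, which keeps the chain rule smooth at
the centre; the `6` is `Δ|x - x₀|²` in three dimensions. -/
lemma lap_radial {Q Q₁ Q₂ : ℝ → ℝ} (h1 : ∀ q, 0 ≤ q → HasDerivAt Q (Q₁ q) q)
    (h2 : ∀ q, 0 ≤ q → HasDerivAt Q₁ (Q₂ q) q) (x x₀ : E3) :
    lap (fun y => Q (‖y - x₀‖ ^ 2)) x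
      = 6 * Q₁ (‖x - x₀‖ ^ 2) + 4 * ‖x - x₀‖ ^ 2 * Q₂ (‖x - x₀‖ ^ 2) := by
  have hi : ∀ i, partialDeriv i (partialDeriv i fun y => Q (‖y - x₀‖ ^ 2)) x
      = 2 * Q₁ (‖x - x₀‖ ^ 2) + 4 * (x i - x₀ i) ^ 2 * Q₂ (‖x - x₀‖ ^ 2) := by
    intro i
    have e1 : (partialDeriv i fun y => Q (‖y - x₀‖ ^ 2))
        = fun y => (2 * (y i - x₀ i)) * Q₁ (‖y - x₀‖ ^ 2) :=
      funext fun y => partialDeriv_radial (h1 _ (sq_nonneg _)) i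
    have hd1 : HasFDerivAt (fun y : E3 => 2 * (y i - x₀ i))
        ((2 : ℝ) • (EuclideanSpace.proj i : E3 →L[ℝ] ℝ)) x :=
      (((EuclideanSpace.proj i : E3 →L[ℝ] ℝ).hasFDerivAt).sub_const _).const_mul 2
    have hd2 : DifferentiableAt ℝ (fun y : E3 => Q₁ (‖y - x₀‖ ^ 2)) x := by
      have h3 : DifferentiableAt ℝ (fun y : E3 => ‖y - x₀‖ ^ 2) x :=
        ((differentiableAt_id).sub_const x₀).norm_sq ℝ
      exact (h2 _ (sq_nonneg _)).differentiableAt.comp x h3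
    rw [e1, partialDeriv_mul hd1.differentiableAt hd2,
      partialDeriv_radial (h2 _ (sq_nonneg _)) i]
    have e2 : partialDeriv i (fun y : E3 => 2 * (y i - x₀ i)) x = 2 := by
      rw [partialDeriv, hd1.fderiv]
      simp
    rw [e2]
    ring
  have hn : ‖x - x₀‖ ^ 2 = (x 0 - x₀ 0) ^ 2 + (x 1 - x₀ 1) ^ 2 + (x 2 - x₀ 2) ^ 2 := by
    rw [EuclideanSpace.real_norm_sq_eq, Fin.sum_univ_three]
    simp
  rw [lap, Fin.sum_univ_three, hi, hi, hi]
  linear_combination (-4 * Q₂ (‖x - x₀‖ ^ 2)) * hn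

/-- The profile `exp(-k √(q + η²))`. -/
def expProfile (k η q : ℝ) : ℝ := Real.exp (-(k * √(q + η ^ 2)))

lemma hasDerivAt_sqrt_add {η q : ℝ} (hη : 0 < η) (hq : 0 ≤ q) :
    HasDerivAt (fun q => √(q + η ^ 2)) (1 / (2 * √(q + η ^ 2))) q :=
  ((hasDerivAt_id q).add_const (η ^ 2)).sqrt (by positivity)

lemma hasDerivAt_expProfile {k η q : ℝ} (hη : 0 < η) (hq : 0 ≤ q) :
    HasDerivAt (expProfile k η) (-(k / (2 * √(q + η ^ 2))) * expProfile k η q) q := by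
  have h1 := (((hasDerivAt_sqrt_add hη hq).const_mul k).fun_neg).exp
  refine h1.congr_deriv ?_
  rw [expProfile]
  ring

lemma hasDerivAt_expProfile_deriv {k η q : ℝ} (hη : 0 < η) (hq : 0 ≤ q) :
    HasDerivAt (fun q => -(k / (2 * √(q + η ^ 2))) * expProfile k η q)
      ((k ^ 2 / (4 * (q + η ^ 2)) + k / (4 * ((q + η ^ 2) * √(q + η ^ 2))))
        * expProfile k η q) q := by
  have hpos : 0 < √(q + η ^ 2) := Real.sqrt_pos.2 (by positivity)
  have hsq : √(q + η ^ 2) ^ 2 = q + η ^ 2 := Real.sq_sqrt (by positivity)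
  have h1 : HasDerivAt (fun q => -(k / (2 * √(q + η ^ 2))))
      (-(-(k * (2 * (1 / (2 * √(q + η ^ 2))))) / (2 * √(q + η ^ 2)) ^ 2)) q := by
    have h2 := (hasDerivAt_const q k).fun_div ((hasDerivAt_sqrt_add hη hq).const_mul 2)
      (by positivity)
    simpa using h2.fun_neg
  refine (h1.mul (hasDerivAt_expProfile hη hq)).congr_deriv ?_
  set R := √(q + η ^ 2)
  rw [← hsq]
  field_simp
  ring

/-- The barrier `t₀ · ramp(exp(-k √(|x - x₀|² + η²)) / t₀ - 1)`. -/
def barrier (k η t₀ : ℝ) (x₀ x : E3) : ℝ :=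
  t₀ * ramp (expProfile k η (‖x - x₀‖ ^ 2) / t₀ - 1)

section barrier

variable {k η t₀ : ℝ}

lemma hasDerivAt_barrierProfile (hη : 0 < η) (ht₀ : 0 < t₀) {q : ℝ} (hq : 0 ≤ q) :
    HasDerivAt (fun q => t₀ * ramp (expProfile k η q / t₀ - 1))
      (Real.smoothTransition (expProfile k η q / t₀ - 1)
        * (-(k / (2 * √(q + η ^ 2))) * expProfile k η q)) q := by
  have h1 := ((hasDerivAt_expProfile (k := k) hη hq).div_const t₀).sub_const 1
  refine (((hasDerivAt_ramp _).comp q h1).const_mul t₀).congr_deriv ?_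
  field_simp

lemma hasDerivAt_barrierProfile_deriv (hη : 0 < η) {q : ℝ} (hq : 0 ≤ q) :
    HasDerivAt (fun q => Real.smoothTransition (expProfile k η q / t₀ - 1)
        * (-(k / (2 * √(q + η ^ 2))) * expProfile k η q))
      (deriv Real.smoothTransition (expProfile k η q / t₀ - 1)
          * ((-(k / (2 * √(q + η ^ 2))) * expProfile k η q) / t₀)
          * (-(k / (2 * √(q + η ^ 2))) * expProfile k η q)
        + Real.smoothTransition (expProfile k η q / t₀ - 1)
          * ((k ^ 2 / (4 * (q + η ^ 2)) + k / (4 * ((q + η ^ 2) * √(q + η ^ 2))))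
            * expProfile k η q)) q := by
  have h1 := ((hasDerivAt_expProfile (k := k) hη hq).div_const t₀).sub_const 1
  exact ((hasDerivAt_smoothTransition _).comp q h1).mul (hasDerivAt_expProfile_deriv hη hq)

lemma contDiff_barrier (hη : 0 < η) (x₀ : E3) : ContDiff ℝ ∞ (barrier k η t₀ x₀) := by
  have h1 : ContDiff ℝ ∞ fun x : E3 => √(‖x - x₀‖ ^ 2 + η ^ 2) :=
    (((contDiff_id.sub contDiff_const).norm_sq ℝ).add contDiff_const).sqrt
      fun x => by positivity
  have h2 : ContDiff ℝ ∞ fun x : E3 => expProfile k η (‖x - x₀‖ ^ 2) :=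
    (contDiff_const.mul h1).neg.exp
  exact contDiff_const.mul (contDiff_ramp.comp ((h2.div_const t₀).sub contDiff_const))

lemma barrier_nonneg (ht₀ : 0 < t₀) (x₀ x : E3) : 0 ≤ barrier k η t₀ x₀ x :=
  mul_nonneg ht₀.le (ramp_nonneg _)

/-- The barrier is dominated by the product of profile and slope factor, which is the same product
that multiplies the lower bound for its Laplacian. The two can then be compared even where the ramp
bends. -/
lemma barrier_le_profile (ht₀ : 0 < t₀) (x₀ x : E3) :
    barrier k η t₀ x₀ x ≤ expProfile k η (‖x - x₀‖ ^ 2)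
      * Real.smoothTransition (expProfile k η (‖x - x₀‖ ^ 2) / t₀ - 1) := by
  set F := expProfile k η (‖x - x₀‖ ^ 2)
  have h1 := mul_le_mul_of_nonneg_left (ramp_le_mul (F / t₀ - 1)) ht₀.le
  have h2 := Real.smoothTransition.nonneg (F / t₀ - 1)
  have h3 : t₀ * ((F / t₀ - 1) * Real.smoothTransition (F / t₀ - 1))
      = (F - t₀) * Real.smoothTransition (F / t₀ - 1) := by field_simp
  unfold barrier
  rw [h3] at h1
  nlinarith

lemma partialDeriv_barrier (hη : 0 < η) (ht₀ : 0 < t₀) (x₀ x : E3) (i : Fin 3) :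
    partialDeriv i (barrier k η t₀ x₀) x
      = - (x i - x₀ i) * (Real.smoothTransition (expProfile k η (‖x - x₀‖ ^ 2) / t₀ - 1)
        * (k / √(‖x - x₀‖ ^ 2 + η ^ 2) * expProfile k η (‖x - x₀‖ ^ 2))) := by
  have := partialDeriv_radial (x := x) (x₀ := x₀)
    (hasDerivAt_barrierProfile (k := k) hη ht₀ (sq_nonneg ‖x - x₀‖)) i
  unfold barrier
  rw [this]
  field_simp

/-- Cutting off with a convex ramp only adds the nonnegative term `θ'|∇F|²/t₀`. What remains is `θ
ΔF`, from which a positive term of lower order is dropped and `√(q + η²)` is replaced by `η`. -/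
lemma lap_barrier_ge (hk : 0 < k) (hη : 0 < η) (ht₀ : 0 < t₀) (x₀ x : E3) :
    Real.smoothTransition (expProfile k η (‖x - x₀‖ ^ 2) / t₀ - 1)
      * (expProfile k η (‖x - x₀‖ ^ 2)
        * (k ^ 2 * (‖x - x₀‖ ^ 2 / (‖x - x₀‖ ^ 2 + η ^ 2)) - 3 * k / η))
      ≤ lap (barrier k η t₀ x₀) x := by
  have h := lap_radial (fun q hq => hasDerivAt_barrierProfile (k := k) hη ht₀ hq)
    (fun q hq => hasDerivAt_barrierProfile_deriv (k := k) (t₀ := t₀) hη hq) x x₀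
  unfold barrier
  rw [h]
  set q := ‖x - x₀‖ ^ 2
  have hq : 0 ≤ q := sq_nonneg _
  set F := expProfile k η q
  have hF : 0 < F := Real.exp_pos _
  set θ := Real.smoothTransition (F / t₀ - 1)
  have hθ : 0 ≤ θ := Real.smoothTransition.nonneg _
  set θ' := deriv Real.smoothTransition (F / t₀ - 1)
  have hθ' : 0 ≤ θ' := deriv_smoothTransition_nonneg _
  set R := √(q + η ^ 2)
  have hR : η ≤ R := Real.le_sqrt_of_sq_le (by linarith)
  have hR0 : 0 < R := hη.trans_le hR
  have h1 : 0 ≤ 4 * q * (θ' * ((-(k / (2 * R)) * F) / t₀) * (-(k / (2 * R)) * F)) := by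
    have : θ' * ((-(k / (2 * R)) * F) / t₀) * (-(k / (2 * R)) * F)
        = θ' * (k / (2 * R) * F) ^ 2 / t₀ := by ring
    rw [this]
    positivity
  have h2 : 3 * k / R ≤ 3 * k / η := by gcongr
  have h3 : 0 ≤ 4 * q * (k / (4 * ((q + η ^ 2) * R))) := by positivity
  have h4 : θ * (F * (k ^ 2 * (q / (q + η ^ 2)) - 3 * k / η))
      ≤ θ * (F * (k ^ 2 * (q / (q + η ^ 2)) - 3 * k / R
        + 4 * q * (k / (4 * ((q + η ^ 2) * R))))) := by
    gcongr
    linarith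
  refine h4.trans ?_
  have h5 : θ * (F * (k ^ 2 * (q / (q + η ^ 2)) - 3 * k / R
        + 4 * q * (k / (4 * ((q + η ^ 2) * R)))))
      = 6 * (θ * (-(k / (2 * R)) * F)) + 4 * q * (θ * ((k ^ 2 / (4 * (q + η ^ 2))
        + k / (4 * ((q + η ^ 2) * R))) * F)) := by
    have : 0 < q + η ^ 2 := by positivity
    field_simp
    ring
  rw [h5]
  linarith

/-- Outside the ball of radius `R₁` the barrier of height `exp(-k R₁)` is flat. -/
lemma profile_sub_one_nonpos {R₁ : ℝ} (hk : 0 < k) {x₀ x : E3}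
    (hx : R₁ ≤ ‖x - x₀‖) :
    expProfile k η (‖x - x₀‖ ^ 2) / Real.exp (-(k * R₁)) - 1 ≤ 0 := by
  rw [sub_nonpos, div_le_one (Real.exp_pos _), expProfile, Real.exp_le_exp, neg_le_neg_iff]
  refine mul_le_mul_of_nonneg_left (hx.trans ?_) hk.le
  exact Real.le_sqrt_of_sq_le (by nlinarith)

lemma hasCompactSupport_barrier {R₁ : ℝ} (hk : 0 < k) (x₀ : E3) :
    HasCompactSupport (barrier k η (Real.exp (-(k * R₁))) x₀) := by
  refine HasCompactSupport.intro (isCompact_closedBall x₀ R₁) fun x hx => ?_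
  rw [mem_closedBall_iff_norm, not_le] at hx
  rw [barrier, ramp_of_nonpos (profile_sub_one_nonpos hk hx.le), mul_zero]

end barrier

/-! ### Propagation of lower bounds for positive supersolutions -/

/-- A family of nonnegative supersolutions of `-div(γ₀∇v) + τ²v = 0`. -/
def IsSuperFamily (γp γm : ℝ) (v : ℝ → H1) : Prop :=
  ∀ τ : ℝ, 1 ≤ τ → (∀ᵐ x : E3, 0 ≤ toL2 (v τ) x) ∧
    ∀ s : E3 → ℝ, ContDiff ℝ ∞ s → HasCompactSupport s → (∀ x, 0 ≤ s x) →
      0 ≤ (∫ x, layeredScalar γp γm x * inner ℝ (grad (v τ) x) (gradient s x))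
        + τ ^ 2 * ∫ x, toL2 (v τ) x * s x

/-- The mass of `v(·; τ)` near `x` decays at most like `e^{-ατ}`, up to subexponential factors. -/
def HasMass (v : ℝ → H1) (x : E3) (α : ℝ) : Prop :=
  ∀ β, α < β → ∀ r, 0 < r → ∃ c, 0 < c ∧ ∃ τ₀, ∀ τ, τ₀ ≤ τ →
    c * Real.exp (-(β * τ)) ≤ ∫ y in Metric.ball x r, toL2 (v τ) y

lemma integrableOn_ball (u : L2) (x : E3) (r : ℝ) :
    IntegrableOn u (Metric.ball x r) volume :=
  (((Lp.memLp u).locallyIntegrable (by norm_num)).integrableOn_isCompact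
    (isCompact_closedBall x r)).mono_set Metric.ball_subset_closedBall

lemma HasMass.mono {v : ℝ → H1} {x : E3} {α α' : ℝ} (h : HasMass v x α) (hα : α ≤ α') :
    HasMass v x α' := fun β hβ => h β (hα.trans_lt hβ)

lemma hasMass_of_forall_pos {v : ℝ → H1} {x : E3} {α : ℝ}
    (h : ∀ ε, 0 < ε → HasMass v x (α + ε)) : HasMass v x α := fun β hβ =>
  h ((β - α) / 2) (by linarith) β (by linarith)

lemma expProfile_le_one {k η : ℝ} (hk : 0 < k) (q : ℝ) : expProfile k η q ≤ 1 := by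
  rw [expProfile, Real.exp_le_one_iff, neg_nonpos]
  positivity

lemma barrier_le_one {k η t₀ : ℝ} (hk : 0 < k) (ht₀ : 0 < t₀) (x₀ x : E3) :
    barrier k η t₀ x₀ x ≤ 1 :=
  (barrier_le_profile ht₀ x₀ x).trans <| mul_le_one₀ (expProfile_le_one hk _)
    (Real.smoothTransition.nonneg _) (Real.smoothTransition.le_one _)

/-- The barrier is a strict subsolution where its gradient is large. -/
lemma barrier_far {k η t₀ a τ ε : ℝ} (hk : 0 < k) (hη : 0 < η) (ht₀ : 0 < t₀) (ha : 0 < a)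
    (hε : 0 < ε) {x₀ x : E3}
    (h : (1 + ε) * τ ^ 2 ≤ a * (k ^ 2 * (‖x - x₀‖ ^ 2 / (‖x - x₀‖ ^ 2 + η ^ 2)) - 3 * k / η)) :
    -(a * lap (barrier k η t₀ x₀) x) + τ ^ 2 * barrier k η t₀ x₀ x
      ≤ -(ε * τ ^ 2 * barrier k η t₀ x₀ x) := by
  have hlap := mul_le_mul_of_nonneg_left
    (lap_barrier_ge (x := x) (x₀ := x₀) hk hη ht₀) ha.le
  have hsle := barrier_le_profile (k := k) (η := η) ht₀ x₀ x
  have hF : 0 < expProfile k η (‖x - x₀‖ ^ 2) := Real.exp_pos _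
  have hθ := Real.smoothTransition.nonneg (expProfile k η (‖x - x₀‖ ^ 2) / t₀ - 1)
  have h1 := mul_le_mul_of_nonneg_left hsle (show 0 ≤ (1 + ε) * τ ^ 2 by positivity)
  have h2 := mul_le_mul_of_nonneg_right h (mul_nonneg hF.le hθ)
  linarith

/-- Near its regularised tip the barrier need not be a subsolution. A bound polynomial in `k` and
`τ` suffices there, since only exponential rates matter. -/
lemma barrier_near {k η t₀ a a₁ τ : ℝ} (hk : 0 < k) (hη : 0 < η) (ht₀ : 0 < t₀) (ha : 0 < a)
    (haa₁ : a ≤ a₁) (x₀ x : E3) :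
    -(a * lap (barrier k η t₀ x₀) x) + τ ^ 2 * barrier k η t₀ x₀ x
      ≤ a₁ * (3 * k / η) + τ ^ 2 := by
  have hlap := lap_barrier_ge (x := x) (x₀ := x₀) hk hη ht₀
  have hs := mul_le_mul_of_nonneg_left (barrier_le_one (η := η) hk ht₀ x₀ x) (sq_nonneg τ)
  have hF : 0 < expProfile k η (‖x - x₀‖ ^ 2) := Real.exp_pos _
  have hF1 := expProfile_le_one (η := η) hk (‖x - x₀‖ ^ 2)
  set F := expProfile k η (‖x - x₀‖ ^ 2)
  have hθ := Real.smoothTransition.nonneg (F / t₀ - 1)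
  have hθ1 := Real.smoothTransition.le_one (F / t₀ - 1)
  set θ := Real.smoothTransition (F / t₀ - 1)
  have h1 : -(3 * k / η) ≤ lap (barrier k η t₀ x₀) x := by
    refine le_trans ?_ hlap
    have h2 : 0 ≤ θ * (F * (k ^ 2 * (‖x - x₀‖ ^ 2 / (‖x - x₀‖ ^ 2 + η ^ 2)))) := by positivity
    have h3 : θ * F * (3 * k / η) ≤ 1 * (3 * k / η) := by
      gcongr
      exact mul_le_one₀ hθ1 hF.le hF1
    linarith
  have h4 : -(a * lap (barrier k η t₀ x₀) x) ≤ a₁ * (3 * k / η) := by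
    calc -(a * lap (barrier k η t₀ x₀) x) = a * (-lap (barrier k η t₀ x₀) x) := by ring
      _ ≤ a * (3 * k / η) := by gcongr; linarith
      _ ≤ a₁ * (3 * k / η) := by gcongr
  linarith

/-- Beyond `R₁` the cut-off makes the barrier vanish, and its slope factor vanishes with it. -/
lemma barrier_flat {k η R₁ a τ : ℝ} (hk : 0 < k) (hη : 0 < η) (ha : 0 < a) {x₀ x : E3}
    (hx : R₁ ≤ ‖x - x₀‖) :
    -(a * lap (barrier k η (Real.exp (-(k * R₁))) x₀) x)
      + τ ^ 2 * barrier k η (Real.exp (-(k * R₁))) x₀ x ≤ 0 := by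
  have hlap := lap_barrier_ge (x := x) (x₀ := x₀) hk hη (Real.exp_pos (-(k * R₁)))
  have h0 := profile_sub_one_nonpos (η := η) hk hx
  rw [Real.smoothTransition.zero_of_nonpos h0, zero_mul] at hlap
  rw [show barrier k η (Real.exp (-(k * R₁))) x₀ x = 0 by
    rw [barrier, ramp_of_nonpos h0, mul_zero], mul_zero, add_zero, neg_nonpos]
  positivity

lemma sqrt_sq_add_sq_le {a b : ℝ} (ha : 0 ≤ a) (hb : 0 ≤ b) : √(a ^ 2 + b ^ 2) ≤ a + b := by
  rw [Real.sqrt_le_left (by positivity)]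
  nlinarith [mul_nonneg ha hb]

/-- The gap condition makes the profile at least three times the cut-off height `t₀`, and `ramp t ≥
t - 1` then gives a ramp value of at least `1`. -/
lemma le_barrier {k η R₁ R₂ : ℝ} (hk : 0 < k) (hη : 0 < η) {x₀ x : E3}
    (hx : ‖x - x₀‖ + η ≤ R₂) (hR : 2 ≤ k * (R₁ - R₂)) :
    Real.exp (-(k * R₁)) ≤ barrier k η (Real.exp (-(k * R₁))) x₀ x := by
  have h2 := mul_le_mul_of_nonneg_left
    ((sqrt_sq_add_sq_le (norm_nonneg (x - x₀)) hη.le).trans hx) hk.le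
  have h3 : 3 ≤ expProfile k η (‖x - x₀‖ ^ 2) / Real.exp (-(k * R₁)) := by
    rw [expProfile, ← Real.exp_sub]
    linarith [Real.add_one_le_exp (-(k * √(‖x - x₀‖ ^ 2 + η ^ 2)) - -(k * R₁))]
  have h4 := sub_one_le_ramp (expProfile k η (‖x - x₀‖ ^ 2) / Real.exp (-(k * R₁)) - 1)
  exact le_mul_of_one_le_right (Real.exp_pos _).le (by linarith)

lemma integral_mul_le_of_balls {u : L2} (hu : ∀ᵐ x : E3, 0 ≤ u x) {g : E3 → ℝ}
    (hg : Integrable (fun x => u x * g x) (volume : Measure E3)) {x₀ y : E3} {r r' a b : ℝ}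
    (h1 : ∀ x, g x ≤ a) (h2 : ∀ x, x ∉ Metric.ball x₀ r → g x ≤ 0)
    (h3 : ∀ x ∈ Metric.ball y r', x ∉ Metric.ball x₀ r → g x ≤ -b)
    (hdisj : Disjoint (Metric.ball x₀ r) (Metric.ball y r')) :
    ∫ x, u x * g x ≤ a * (∫ x in Metric.ball x₀ r, u x) - b * ∫ x in Metric.ball y r', u x := by
  have hB1 := ((integrable_indicator_iff Metric.isOpen_ball.measurableSet).2
    (integrableOn_ball u x₀ r)).const_mul a
  have hB2 := ((integrable_indicator_iff Metric.isOpen_ball.measurableSet).2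
    (integrableOn_ball u y r')).const_mul b
  rw [← integral_indicator Metric.isOpen_ball.measurableSet,
    ← integral_indicator Metric.isOpen_ball.measurableSet, ← integral_const_mul,
    ← integral_const_mul, ← integral_sub hB1 hB2]
  refine integral_mono_ae hg (hB1.sub hB2) ?_
  filter_upwards [hu] with x hx
  by_cases hx1 : x ∈ Metric.ball x₀ r
  · rw [indicator_of_mem hx1, indicator_of_notMem (disjoint_left.1 hdisj hx1)]
    have := mul_le_mul_of_nonneg_left (h1 x) hx
    linarith
  · rw [indicator_of_notMem hx1]
    by_cases hx2 : x ∈ Metric.ball y r'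
    · rw [indicator_of_mem hx2]
      have := mul_le_mul_of_nonneg_left (h3 x hx2 hx1) hx
      linarith
    · rw [indicator_of_notMem hx2]
      have := mul_le_mul_of_nonneg_left (h2 x hx1) hx
      linarith

/-- The barrier estimate: mass near `y` forces mass near `x₀`. -/
lemma IsSuperFamily.exists_integral_ball_le {γp γm : ℝ} (hp : 0 < γp) (hm : 0 < γm) {v : ℝ → H1}
    (hv : IsSuperFamily γp γm v) {x₀ y : E3} {m κ R R₁ ε₀ : ℝ}
    (hκ : 0 < κ) (hκm : 1 < κ ^ 2 * m)
    (hma : ∀ x ∈ Metric.ball x₀ R, m ≤ layeredScalar γp γm x) (hε₀ : 0 < ε₀)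
    (hside : ∀ x ∈ Metric.ball x₀ R, 0 < x 2 → x 2 < ε₀ → (γp - γm) * (x 2 - x₀ 2) ≤ 0)
    (hyx : 0 < dist y x₀) (hR₁ : dist y x₀ < R₁) (hR : R₁ ≤ R) {r : ℝ} (hr : 0 < r) :
    ∃ r', 0 < r' ∧ ∃ c, 0 < c ∧ ∃ τ₀, ∀ τ, τ₀ ≤ τ →
      c * Real.exp (-(κ * R₁ * τ)) * ∫ z in Metric.ball y r', toL2 (v τ) z
        ≤ ∫ z in Metric.ball x₀ r, toL2 (v τ) z := by
  set R₀ := dist y x₀ with hR₀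
  -- The halves keep the balls around `x₀` and `y` disjoint.
  set r₀ := min r (R₀ / 2) with hr₀
  have hr₀pos : 0 < r₀ := lt_min hr (by positivity)
  -- The gap `R₁ - R₀` is split into four: one part for the ball around `y`, one for the
  -- regularisation `η`, and two for the height of the barrier above its cut-off.
  set d := (R₁ - R₀) / 4 with hd
  have hdpos : 0 < d := by rw [hd]; linarith
  set r' := min d (R₀ / 2) with hr'
  have hr'pos : 0 < r' := lt_min hdpos (by positivity)
  -- The surplus `κ²m = 1 + 3ε` is spent in three equal parts: on the regularised tip through `η`,
  -- on the first-order term `3k/η`, and on the strictness of the subsolution.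
  obtain ⟨ε, hε⟩ : ∃ ε, ε = (κ ^ 2 * m - 1) / 3 := ⟨_, rfl⟩
  have hεpos : 0 < ε := by rw [hε]; linarith
  set η := min d (r₀ * ε / (1 + 2 * ε)) with hη
  have hηpos : 0 < η := lt_min hdpos (by positivity)
  have hηsq : (1 + 2 * ε) * η ^ 2 ≤ ε * r₀ ^ 2 := by
    have h1 : η ≤ r₀ * ε / (1 + 2 * ε) := min_le_right _ _
    have h2 : η ^ 2 ≤ (r₀ * ε / (1 + 2 * ε)) ^ 2 := by gcongr
    have h3 : (1 + 2 * ε) * (r₀ * ε / (1 + 2 * ε)) ^ 2 = ε * r₀ ^ 2 * (ε / (1 + 2 * ε)) := by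
      field_simp
    have h4 : ε / (1 + 2 * ε) ≤ 1 := by rw [div_le_one (by positivity)]; linarith
    calc (1 + 2 * ε) * η ^ 2 ≤ (1 + 2 * ε) * (r₀ * ε / (1 + 2 * ε)) ^ 2 := by gcongr
      _ = ε * r₀ ^ 2 * (ε / (1 + 2 * ε)) := h3
      _ ≤ ε * r₀ ^ 2 * 1 := by gcongr
      _ = _ := mul_one _
  set a₁ := max γp γm with ha₁
  have ha₁pos : 0 < a₁ := lt_max_of_lt_left hp
  set C := 1 + 3 * a₁ * κ / η with hC
  have hCpos : 0 < C := by positivity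
  -- Besides `τ ≥ 1`, the thresholds make the first-order term at most `ετ²` and give the barrier
  -- its height near `y`.
  refine ⟨r', hr'pos, ε / C, by positivity,
    max 1 (max (3 * a₁ * κ / (η * ε)) (1 / (κ * d))), fun τ hτ => ?_⟩
  have hτ1 : 1 ≤ τ := (le_max_left _ _).trans hτ
  have hτ2 : 3 * a₁ * κ / (η * ε) ≤ τ := (le_max_left _ _).trans ((le_max_right _ _).trans hτ)
  have hτ3 : 1 / (κ * d) ≤ τ := (le_max_right _ _).trans ((le_max_right _ _).trans hτ)
  have hτ0 : 0 < τ := by linarith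
  obtain ⟨hvpos, hvsup⟩ := hv τ hτ1
  set k := κ * τ with hk
  have hkpos : 0 < k := by positivity
  set t₀ := Real.exp (-(k * R₁)) with ht₀
  have ht₀pos : 0 < t₀ := Real.exp_pos _
  set s := barrier k η t₀ x₀ with hs
  have hscd : ContDiff ℝ ∞ s := contDiff_barrier hηpos x₀
  have hscs : HasCompactSupport s := hasCompactSupport_barrier hkpos x₀
  have hs0 : ∀ x, 0 ≤ s x := barrier_nonneg ht₀pos x₀
  have hF0 : ∀ x, 0 < expProfile k η (‖x - x₀‖ ^ 2) := fun x => Real.exp_pos _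
  -- The barrier decreases radially, so the sign of its vertical derivative is opposite to that of
  -- `x₃ - (x₀)₃`; outside the radius `R₁` it is flat.
  have hsideS : ∀ x : E3, 0 < x 2 → x 2 < ε₀ → 0 ≤ (γp - γm) * partialDeriv 2 s x := by
    intro x hx1 hx2
    rw [hs, partialDeriv_barrier hηpos ht₀pos]
    by_cases hx : ‖x - x₀‖ < R₁
    · have h1 := hside x (by rw [mem_ball_iff_norm]; linarith) hx1 hx2
      have h2 : 0 ≤ Real.smoothTransition (expProfile k η (‖x - x₀‖ ^ 2) / t₀ - 1)
          * (k / √(‖x - x₀‖ ^ 2 + η ^ 2) * expProfile k η (‖x - x₀‖ ^ 2)) := by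
        have := Real.smoothTransition.nonneg (expProfile k η (‖x - x₀‖ ^ 2) / t₀ - 1)
        have := hF0 x
        positivity
      nlinarith
    · rw [Real.smoothTransition.zero_of_nonpos (profile_sub_one_nonpos hkpos (not_lt.1 hx))]
      simp
  set g : E3 → ℝ := fun x => - (layeredScalar γp γm x * lap s x) + τ ^ 2 * s x with hg
  have hfar : ∀ x, r₀ ≤ ‖x - x₀‖ → g x ≤ - (ε * τ ^ 2 * s x) := by
    intro x hx
    have hapos : 0 < layeredScalar γp γm x := layeredScalar_pos hp hm x
    by_cases hxR : ‖x - x₀‖ < R₁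
    · refine barrier_far hkpos hηpos ht₀pos hapos hεpos ?_
      have hma' : m ≤ layeredScalar γp γm x := hma x (by rw [mem_ball_iff_norm]; linarith)
      have haa₁ : layeredScalar γp γm x ≤ a₁ := layeredScalar_le_max γp γm x
      have h1 : (1 + 2 * ε) ≤ κ ^ 2 * m * (‖x - x₀‖ ^ 2 / (‖x - x₀‖ ^ 2 + η ^ 2)) := by
        have hx2 : ε * r₀ ^ 2 ≤ ε * ‖x - x₀‖ ^ 2 := by gcongr
        have e : κ ^ 2 * m = 1 + 3 * ε := by rw [hε]; ring
        rw [e, ← mul_div_assoc, le_div_iff₀ (by positivity)]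
        linarith
      have h2 : (1 + 2 * ε) * τ ^ 2 ≤ layeredScalar γp γm x
          * (k ^ 2 * (‖x - x₀‖ ^ 2 / (‖x - x₀‖ ^ 2 + η ^ 2))) := by
        calc (1 + 2 * ε) * τ ^ 2
            ≤ κ ^ 2 * m * (‖x - x₀‖ ^ 2 / (‖x - x₀‖ ^ 2 + η ^ 2)) * τ ^ 2 := by gcongr
          _ = m * (k ^ 2 * (‖x - x₀‖ ^ 2 / (‖x - x₀‖ ^ 2 + η ^ 2))) := by rw [hk]; ring
          _ ≤ _ := by gcongr
      have h3 : layeredScalar γp γm x * (3 * k / η) ≤ ε * τ ^ 2 := by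
        rw [div_le_iff₀ (by positivity)] at hτ2
        calc layeredScalar γp γm x * (3 * k / η) ≤ a₁ * (3 * k / η) := by gcongr
          _ = 3 * a₁ * κ * τ / η := by rw [hk]; ring
          _ ≤ τ * (η * ε) * τ / η := by gcongr
          _ = ε * τ ^ 2 := by field_simp
      linarith
    · have h1 := barrier_flat (τ := τ) hkpos hηpos hapos (not_lt.1 hxR)
      have h2 : s x = 0 := by
        rw [hs, barrier, ramp_of_nonpos (profile_sub_one_nonpos hkpos (not_lt.1 hxR)), mul_zero]
      rw [h2, mul_zero, neg_zero]
      exact h1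
  have hnear : ∀ x, g x ≤ C * τ ^ 2 := by
    intro x
    refine (barrier_near (τ := τ) hkpos hηpos ht₀pos (layeredScalar_pos hp hm x)
      (layeredScalar_le_max γp γm x) x₀ x).trans ?_
    have h1 : a₁ * (3 * k / η) ≤ 3 * a₁ * κ / η * τ ^ 2 := by
      calc a₁ * (3 * k / η) = 3 * a₁ * κ / η * τ := by rw [hk]; ring
        _ ≤ 3 * a₁ * κ / η * τ ^ 2 := by
          gcongr
          exact le_self_pow₀ hτ1 two_ne_zero
    rw [hC]
    linarith
  have hsy : ∀ x ∈ Metric.ball y r', t₀ ≤ s x := by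
    intro x hx
    refine le_barrier hkpos hηpos (R₂ := R₀ + 2 * d) ?_ ?_
    · have h1 : dist x x₀ ≤ dist x y + dist y x₀ := dist_triangle _ _ _
      rw [← dist_eq_norm]
      have h2 := Metric.mem_ball.1 hx
      have h3 : r' ≤ d := min_le_left _ _
      have h4 : η ≤ d := min_le_left _ _
      linarith
    · rw [div_le_iff₀ (by positivity)] at hτ3
      have h6 : R₁ - (R₀ + 2 * d) = 2 * d := by rw [hd]; ring
      rw [h6, hk]
      linarith
  have hlapm : MemLp (fun x => layeredScalar γp γm x * lap s x) 2 (volume : Measure E3) := by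
    have h1 : MemLp (lap s) 2 (volume : Measure E3) :=
      (continuous_lap hscd).memLp_of_hasCompactSupport (hasCompactSupport_lap hscs)
    refine h1.of_le_mul (c := a₁) ((measurable_layeredScalar γp γm).aestronglyMeasurable.mul h1.1)
      (ae_of_all _ fun x => ?_)
    rw [norm_mul, Real.norm_eq_abs, abs_of_pos (layeredScalar_pos hp hm x)]
    exact mul_le_mul_of_nonneg_right (layeredScalar_le_max γp γm x) (norm_nonneg _)
  have hi1 : Integrable (fun x => toL2 (v τ) x * (layeredScalar γp γm x * lap s x))
      (volume : Measure E3) := (Lp.memLp (toL2 (v τ))).integrable_mul hlapm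
  have hi2 : Integrable (fun x => toL2 (v τ) x * s x) (volume : Measure E3) :=
    (Lp.memLp (toL2 (v τ))).integrable_mul (memLp_test hscd hscs)
  have hgi : Integrable (fun x => toL2 (v τ) x * g x) (volume : Measure E3) := by
    have := hi1.neg.add (hi2.const_mul (τ ^ 2))
    refine this.congr (ae_of_all _ fun x => ?_)
    simp only [Pi.add_apply, Pi.neg_apply, hg]
    ring
  -- The supersolution is tested with the barrier, and the derivatives are moved onto the barrier by
  -- the one-sided integration by parts.
  have hkey : 0 ≤ ∫ x, toL2 (v τ) x * g x := by
    have h1 := hvsup s hscd hscs hs0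
    have h2 := integral_layered_inner_le hp hm hvpos hscd hscs hε₀ hsideS
    have h3 : ∫ x, toL2 (v τ) x * g x
        = -(∫ x, toL2 (v τ) x * (layeredScalar γp γm x * lap s x))
          + τ ^ 2 * ∫ x, toL2 (v τ) x * s x := by
      rw [← integral_const_mul, neg_add_eq_sub, ← integral_sub (hi2.const_mul _) hi1]
      refine integral_congr_ae (ae_of_all _ fun x => ?_)
      simp only [hg]
      ring
    linarith
  -- Only the ball around `x₀` contributes positively to this nonnegative integral, so it must
  -- compensate the loss on the ball around `y`.
  have hupper : ∫ x, toL2 (v τ) x * g x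
      ≤ C * τ ^ 2 * (∫ x in Metric.ball x₀ r₀, toL2 (v τ) x)
        - ε * τ ^ 2 * t₀ * ∫ x in Metric.ball y r', toL2 (v τ) x := by
    have hfar' : ∀ x, x ∉ Metric.ball x₀ r₀ → g x ≤ - (ε * τ ^ 2 * s x) := fun x hx =>
      hfar x (by rw [mem_ball_iff_norm, not_lt] at hx; exact hx)
    refine integral_mul_le_of_balls hvpos hgi hnear (fun x hx => ?_) (fun x hx hx' => ?_) ?_
    · refine (hfar' x hx).trans ?_
      have := hs0 x
      rw [neg_nonpos]
      positivity
    · refine (hfar' x hx').trans ?_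
      have := hsy x hx
      rw [neg_le_neg_iff]
      gcongr
    · refine Metric.ball_disjoint_ball ?_
      rw [dist_comm, ← hR₀]
      have h4 : r₀ ≤ R₀ / 2 := min_le_right _ _
      have h5 : r' ≤ R₀ / 2 := min_le_right _ _
      linarith
  have hmono : ∫ x in Metric.ball x₀ r₀, toL2 (v τ) x ≤ ∫ x in Metric.ball x₀ r, toL2 (v τ) x :=
    setIntegral_mono_set (integrableOn_ball _ _ _) (ae_restrict_of_ae hvpos)
      (Metric.ball_subset_ball (min_le_left _ _)).eventuallyLE
  have hfinal : τ ^ 2 * (ε * t₀ * ∫ x in Metric.ball y r', toL2 (v τ) x)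
      ≤ τ ^ 2 * (C * ∫ x in Metric.ball x₀ r, toL2 (v τ) x) := by
    have : C * τ ^ 2 * (∫ x in Metric.ball x₀ r₀, toL2 (v τ) x)
        ≤ C * τ ^ 2 * ∫ x in Metric.ball x₀ r, toL2 (v τ) x := by gcongr
    linarith
  have hfinal' := le_of_mul_le_mul_left hfinal (by positivity)
  have e : Real.exp (-(κ * R₁ * τ)) = t₀ := by
    rw [ht₀, hk]
    congr 1
    ring
  rw [e]
  calc ε / C * t₀ * ∫ z in Metric.ball y r', toL2 (v τ) z
      = (ε * t₀ * ∫ z in Metric.ball y r', toL2 (v τ) z) / C := by ring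
    _ ≤ _ := by
      rw [div_le_iff₀ hCpos]
      linarith

/-- The barrier exponent `κR₁` can be brought arbitrarily close to `dist y x₀ / √m`. The remaining
loss is absorbed by the gap that `HasMass` leaves between `β` and the rate. -/
lemma IsSuperFamily.hasMass_step {γp γm : ℝ} (hp : 0 < γp) (hm : 0 < γm) {v : ℝ → H1}
    (hv : IsSuperFamily γp γm v) {x₀ y : E3} {m R ε₀ α : ℝ} (hm0 : 0 < m)
    (hma : ∀ x ∈ Metric.ball x₀ R, m ≤ layeredScalar γp γm x) (hε₀ : 0 < ε₀)
    (hside : ∀ x ∈ Metric.ball x₀ R, 0 < x 2 → x 2 < ε₀ → (γp - γm) * (x 2 - x₀ 2) ≤ 0)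
    (hyR : dist y x₀ < R) (hy : HasMass v y α) : HasMass v x₀ (α + 1 / √m * dist y x₀) := by
  rcases (dist_nonneg (x := y) (y := x₀)).eq_or_lt with h0 | h0
  · rw [← h0, mul_zero, add_zero]
    rwa [← dist_eq_zero.1 h0.symm]
  intro β hβ r hr
  set g := β - (α + 1 / √m * dist y x₀) with hg
  have hg0 : 0 < g := by rw [hg]; linarith
  -- One `δ` enlarges both the slowness and the radius; by continuity their product grows by at most
  -- half the available gap `g`.
  obtain ⟨δ, hδ0, hδR, hδ⟩ : ∃ δ, 0 < δ ∧ dist y x₀ + δ ≤ R ∧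
      (1 / √m + δ) * (dist y x₀ + δ) ≤ 1 / √m * dist y x₀ + g / 2 := by
    have hc : Tendsto (fun δ : ℝ => (1 / √m + δ) * (dist y x₀ + δ)) (𝓝[>] 0)
        (𝓝 ((1 / √m + 0) * (dist y x₀ + 0))) := by
      refine Tendsto.mono_left ?_ nhdsWithin_le_nhds
      exact Continuous.tendsto (by fun_prop) 0
    have h1 : ∀ᶠ δ in 𝓝[>] (0 : ℝ),
        (1 / √m + δ) * (dist y x₀ + δ) ≤ 1 / √m * dist y x₀ + g / 2 :=
      hc.eventually_le_const (by rw [add_zero, add_zero]; linarith)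
    have h2 : ∀ᶠ δ : ℝ in 𝓝[>] 0, δ < R - dist y x₀ :=
      nhdsWithin_le_nhds (gt_mem_nhds (by linarith))
    obtain ⟨δ, h3, h4, h5⟩ := (h1.and (h2.and self_mem_nhdsWithin)).exists
    exact ⟨δ, h5, by linarith, h3⟩
  set κ := 1 / √m + δ with hκ
  have hsm : 0 < √m := Real.sqrt_pos.2 hm0
  have hκ0 : 0 < κ := by positivity
  have hκm : 1 < κ ^ 2 * m := by
    have h1 : 1 < κ * √m := by
      rw [hκ, add_mul, one_div, inv_mul_cancel₀ hsm.ne']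
      have : 0 < δ * √m := by positivity
      linarith
    have h2 : κ ^ 2 * m = (κ * √m) ^ 2 := by rw [mul_pow, Real.sq_sqrt hm0.le]
    rw [h2]
    exact one_lt_pow₀ h1 two_ne_zero
  obtain ⟨r', hr', c, hc, τ₁, hstep⟩ := hv.exists_integral_ball_le hp hm hκ0 hκm hma hε₀ hside h0
    (show dist y x₀ < dist y x₀ + δ by linarith) hδR hr
  obtain ⟨c', hc', τ₂, hmass⟩ := hy (α + g / 2) (by linarith) r' hr'
  refine ⟨c * c', by positivity, max (max τ₁ τ₂) 0, fun τ hτ => ?_⟩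
  have hτ1 : τ₁ ≤ τ := (le_max_left _ _).trans ((le_max_left _ _).trans hτ)
  have hτ2 : τ₂ ≤ τ := (le_max_right _ _).trans ((le_max_left _ _).trans hτ)
  have hτ0 : 0 ≤ τ := (le_max_right _ _).trans hτ
  refine le_trans ?_ (hstep τ hτ1)
  have h1 : Real.exp (-(β * τ))
      ≤ Real.exp (-(κ * (dist y x₀ + δ) * τ)) * Real.exp (-((α + g / 2) * τ)) := by
    rw [← Real.exp_add, Real.exp_le_exp]
    have : (κ * (dist y x₀ + δ) + (α + g / 2)) * τ ≤ β * τ :=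
      mul_le_mul_of_nonneg_right (by linarith) hτ0
    linarith
  calc c * c' * Real.exp (-(β * τ))
      ≤ c * c' * (Real.exp (-(κ * (dist y x₀ + δ) * τ)) * Real.exp (-((α + g / 2) * τ))) := by
        gcongr
    _ = c * Real.exp (-(κ * (dist y x₀ + δ) * τ)) * (c' * Real.exp (-((α + g / 2) * τ))) := by
        ring
    _ ≤ _ := by
        have := hmass τ hτ2
        gcongr

/-! ### Propagation inside each half-space and across the interface -/

lemma abs_coord_sub_le (x y : E3) (i : Fin 3) : |x i - y i| ≤ dist x y := by
  rw [dist_eq_norm]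
  exact PiLp.norm_apply_le (x - y) i

lemma layeredScalar_of_pos {γp γm : ℝ} {x : E3} (h : 0 < x 2) : layeredScalar γp γm x = γp :=
  if_pos h

lemma layeredScalar_of_nonpos {γp γm : ℝ} {x : E3} (h : x 2 ≤ 0) :
    layeredScalar γp γm x = γm := if_neg (not_lt.2 h)

/-- A radius halfway between `dist y x₀` and the height of `x₀` keeps the ball above the plane. With
`ε₀` equal to the remaining clearance the interface condition is vacuous. -/
lemma IsSuperFamily.hasMass_step_upper {γp γm : ℝ} (hp : 0 < γp) (hm : 0 < γm) {v : ℝ → H1}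
    (hv : IsSuperFamily γp γm v) {x₀ y : E3} {α : ℝ} (hyx : dist y x₀ < x₀ 2)
    (hy : HasMass v y α) : HasMass v x₀ (α + 1 / √γp * dist y x₀) := by
  set R := (dist y x₀ + x₀ 2) / 2 with hR
  have hx : ∀ x ∈ Metric.ball x₀ R, x₀ 2 - R < x 2 := fun x hx => by
    have h1 := abs_coord_sub_le x x₀ 2
    have h2 := Metric.mem_ball.1 hx
    have h3 := (abs_le.1 h1).1
    linarith
  refine hv.hasMass_step hp hm (R := R) (ε₀ := x₀ 2 - R) hp (fun x hxb => ?_)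
    (by rw [hR]; linarith) (fun x hxb _ h => absurd (hx x hxb) (not_lt.2 h.le))
    (by rw [hR]; linarith) hy
  rw [layeredScalar_of_pos]
  have := hx x hxb
  rw [hR] at this
  linarith [dist_nonneg (x := y) (y := x₀)]

lemma IsSuperFamily.hasMass_step_lower {γp γm : ℝ} (hp : 0 < γp) (hm : 0 < γm) {v : ℝ → H1}
    (hv : IsSuperFamily γp γm v) {x₀ y : E3} {α : ℝ} (hyx : dist y x₀ < - x₀ 2)
    (hy : HasMass v y α) : HasMass v x₀ (α + 1 / √γm * dist y x₀) := by
  have hx : ∀ x ∈ Metric.ball x₀ (- x₀ 2), x 2 < 0 := fun x hx => by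
    have h1 := abs_coord_sub_le x x₀ 2
    have h2 := Metric.mem_ball.1 hx
    have h3 := (abs_le.1 h1).2
    linarith
  refine hv.hasMass_step hp hm (R := - x₀ 2) (ε₀ := 1) hm (fun x hxb => ?_) one_pos
    (fun x hxb h _ => absurd (hx x hxb) (not_lt.2 h.le)) hyx hy
  rw [layeredScalar_of_nonpos (hx x hxb).le]

/-- Short steps inside a convex set can be chained along a segment. -/
lemma hasMass_chain {v : ℝ → H1} {S : Set E3} (hS : Convex ℝ S) {c h : ℝ} (hh : 0 < h)
    (hstep : ∀ x ∈ S, ∀ y ∈ S, dist y x < h → ∀ α, HasMass v y α →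
      HasMass v x (α + c * dist y x))
    {x y : E3} (hx : x ∈ S) (hy : y ∈ S) {α : ℝ} (hm : HasMass v y α) :
    HasMass v x (α + c * dist y x) := by
  obtain ⟨N, hN⟩ := exists_nat_gt (dist y x / h)
  have hN0 : (0 : ℝ) < N := lt_of_le_of_lt (by positivity) hN
  set z : ℕ → E3 := fun i => AffineMap.lineMap y x ((i : ℝ) / N) with hz
  have hzS : ∀ i ≤ N, z i ∈ S := fun i hi => by
    refine hS.segment_subset hy hx ?_
    rw [segment_eq_image_lineMap]
    refine ⟨(i : ℝ) / N, ⟨by positivity, ?_⟩, rfl⟩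
    rw [div_le_one hN0]
    exact_mod_cast hi
  have hdist : ∀ i, dist (z i) (z (i + 1)) = dist y x / N := fun i => by
    simp only [hz]
    rw [dist_lineMap_lineMap, Real.dist_eq]
    have : ((i : ℝ) / N - ((i + 1 : ℕ) : ℝ) / N) = -(1 / N) := by
      push_cast
      ring
    rw [this, abs_neg, abs_of_pos (by positivity)]
    ring
  have key : ∀ i ≤ N, HasMass v (z i) (α + c * (i * (dist y x / N))) := by
    intro i
    induction i with
    | zero => intro _; simpa [hz] using hm
    | succ i ih =>
      intro hi
      have h1 := hstep (z (i + 1)) (hzS _ hi) (z i) (hzS _ (by omega)) (by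
        rw [hdist, div_lt_iff₀ hN0]
        rwa [div_lt_iff₀ hh, mul_comm] at hN) _ (ih (by omega))
      rw [hdist] at h1
      refine h1.mono (le_of_eq ?_)
      push_cast
      ring
  have h1 := key N le_rfl
  have h2 : z N = x := by simp [hz, hN0.ne']
  rw [h2, mul_div_cancel₀ _ hN0.ne'] at h1
  exact h1

lemma convex_coord_ge (h : ℝ) : Convex ℝ {x : E3 | h ≤ x 2} :=
  convex_halfSpace_ge (EuclideanSpace.proj 2 : E3 →L[ℝ] ℝ).isLinear h

lemma convex_coord_le (h : ℝ) : Convex ℝ {x : E3 | x 2 ≤ h} :=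
  convex_halfSpace_le (EuclideanSpace.proj 2 : E3 →L[ℝ] ℝ).isLinear h

/-- The half-space at the lower of the two heights contains the segment and keeps a fixed clearance
from the interface, which gives a uniform step size. -/
lemma IsSuperFamily.hasMass_upper {γp γm : ℝ} (hp : 0 < γp) (hm : 0 < γm) {v : ℝ → H1}
    (hv : IsSuperFamily γp γm v) {x y : E3} (hx : 0 < x 2) (hy : 0 < y 2) {α : ℝ}
    (h : HasMass v y α) : HasMass v x (α + 1 / √γp * dist y x) := by
  refine hasMass_chain (convex_coord_ge (min (x 2) (y 2))) (lt_min hx hy) ?_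
    (min_le_left (x 2) (y 2)) (min_le_right (x 2) (y 2)) h
  intro x' hx' y' _ hd α hα
  exact hv.hasMass_step_upper hp hm (hd.trans_le hx') hα

lemma IsSuperFamily.hasMass_lower {γp γm : ℝ} (hp : 0 < γp) (hm : 0 < γm) {v : ℝ → H1}
    (hv : IsSuperFamily γp γm v) {x y : E3} (hx : x 2 < 0) (hy : y 2 < 0) {α : ℝ}
    (h : HasMass v y α) : HasMass v x (α + 1 / √γm * dist y x) := by
  refine hasMass_chain (convex_coord_le (max (x 2) (y 2))) (h := - max (x 2) (y 2))
    (neg_pos.2 (max_lt hx hy)) ?_ (le_max_left (x 2) (y 2)) (le_max_right (x 2) (y 2)) h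
  intro x' hlow y' _ hd α hα
  exact hv.hasMass_step_lower hp hm (hd.trans_le (neg_le_neg hlow)) hα

/-- The point `z` of the interface, shifted by `δ` in the vertical direction. -/
def shifted (z : EuclideanSpace ℝ (Fin 2)) (δ : ℝ) : E3 := !₂[z 0, z 1, δ]

lemma shifted_coord (z : EuclideanSpace ℝ (Fin 2)) (δ : ℝ) : shifted z δ 2 = δ := rfl

lemma dist_shifted (z : EuclideanSpace ℝ (Fin 2)) (δ δ' : ℝ) :
    dist (shifted z δ) (shifted z δ') = |δ - δ'| := by
  rw [dist_eq_norm, EuclideanSpace.norm_eq, Fin.sum_univ_three]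
  simp [shifted, Real.sqrt_sq_eq_abs]

/-- The target lies below the plane, so every point above the plane is higher than the centre, and
`γ₊ ≤ γ₋` gives the jump term its sign. Using the smaller coefficient throughout costs only `O(δ)`
on so short a step. -/
lemma IsSuperFamily.hasMass_cross_down {γp γm : ℝ} (hp : 0 < γp) (hm : 0 < γm) (hle : γp ≤ γm)
    {v : ℝ → H1} (hv : IsSuperFamily γp γm v) {z : EuclideanSpace ℝ (Fin 2)} {δ α : ℝ}
    (hδ : 0 < δ) (h : HasMass v (shifted z δ) α) :
    HasMass v (shifted z (-δ)) (α + 1 / √γp * (2 * δ)) := by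
  have hd : dist (shifted z δ) (shifted z (-δ)) = 2 * δ := by
    rw [dist_shifted, sub_neg_eq_add, abs_of_pos (by linarith)]
    ring
  rw [← hd]
  refine hv.hasMass_step hp hm (R := 3 * δ) (ε₀ := 1) hp (fun x _ => ?_) one_pos
    (fun x _ h1 _ => ?_) (by rw [hd]; linarith) h
  · have := min_le_layeredScalar γp γm x
    rwa [min_eq_left hle] at this
  · rw [shifted_coord]
    exact mul_nonpos_of_nonpos_of_nonneg (by linarith) (by linarith)

/-- Now the centre has height `δ`. Taking `ε₀ = δ` restricts the condition to points between the
plane and the centre, where the vertical difference is negative and `γ₋ ≤ γ₊` is the right order. -/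
lemma IsSuperFamily.hasMass_cross_up {γp γm : ℝ} (hp : 0 < γp) (hm : 0 < γm) (hle : γm ≤ γp)
    {v : ℝ → H1} (hv : IsSuperFamily γp γm v) {z : EuclideanSpace ℝ (Fin 2)} {δ α : ℝ}
    (hδ : 0 < δ) (h : HasMass v (shifted z (-δ)) α) :
    HasMass v (shifted z δ) (α + 1 / √γm * (2 * δ)) := by
  have hd : dist (shifted z (-δ)) (shifted z δ) = 2 * δ := by
    rw [dist_comm, dist_shifted, sub_neg_eq_add, abs_of_pos (by linarith)]
    ring
  rw [← hd]
  refine hv.hasMass_step hp hm (R := 3 * δ) (ε₀ := δ) hm (fun x _ => ?_) hδ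
    (fun x _ _ h1 => ?_) (by rw [hd]; linarith) h
  · have := min_le_layeredScalar γp γm x
    rwa [min_eq_right hle] at this
  · rw [shifted_coord]
    exact mul_nonpos_of_nonneg_of_nonpos (by linarith) (by linarith)

lemma dist_shifted_le (z : EuclideanSpace ℝ (Fin 2)) (x : E3) (δ : ℝ) :
    dist (shifted z δ) x ≤ ‖(!₂[z 0, z 1, 0] : E3) - x‖ + |δ| := by
  have h1 := dist_triangle (shifted z δ) (shifted z 0) x
  rw [dist_shifted, sub_zero, dist_eq_norm (shifted z 0)] at h1
  have : shifted z 0 = !₂[z 0, z 1, 0] := rfl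
  rw [this] at h1
  linarith

/-- Mass propagates downwards along broken rays if the lower medium is the faster one. -/
theorem IsSuperFamily.hasMass_down {γp γm : ℝ} (hp : 0 < γp) (hm : 0 < γm) (hle : γp ≤ γm)
    {v : ℝ → H1} (hv : IsSuperFamily γp γm v) {x y : E3} (hx : x 2 < 0) (hy : 0 < y 2) {α : ℝ}
    (h : HasMass v y α) (z : EuclideanSpace ℝ (Fin 2)) :
    HasMass v x (α + pathLength γp γm x y z) := by
  refine hasMass_of_forall_pos fun ε hε => ?_
  have hP : 0 < 1 / √γp := by positivity
  have hM : 0 < 1 / √γm := by positivity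
  -- The detour through the shifted points costs `δ` to reach the upper one and `2δ` to cross, both
  -- at slowness `1/√γ₊`, and `δ` at slowness `1/√γ₋` to leave the lower one.
  set δ := ε / (3 / √γp + 1 / √γm) with hδ
  have hδ0 : 0 < δ := by positivity
  have h1 := hv.hasMass_upper hp hm (x := shifted z δ) (by rwa [shifted_coord]) hy h
  have h2 := hv.hasMass_cross_down hp hm hle hδ0 h1
  have h3 := hv.hasMass_lower hp hm (x := x) hx (by rw [shifted_coord]; linarith) h2
  refine h3.mono ?_
  have e1 := dist_shifted_le z y δ
  have e2 := dist_shifted_le z x (-δ)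
  rw [abs_neg, abs_of_pos hδ0] at e2
  rw [abs_of_pos hδ0] at e1
  rw [dist_comm y]
  have e3 := mul_le_mul_of_nonneg_left e1 hP.le
  have e4 := mul_le_mul_of_nonneg_left e2 hM.le
  have e5 : (3 / √γp + 1 / √γm) * δ = ε := by
    rw [hδ]
    field_simp
  have e6 : 3 / √γp = 3 * (1 / √γp) := by ring
  rw [e6] at e5
  rw [pathLength]
  linarith

/-- Mass propagates upwards along broken rays if the upper medium is the faster one. -/
theorem IsSuperFamily.hasMass_up {γp γm : ℝ} (hp : 0 < γp) (hm : 0 < γm) (hle : γm ≤ γp)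
    {v : ℝ → H1} (hv : IsSuperFamily γp γm v) {x y : E3} (hx : x 2 < 0) (hy : 0 < y 2) {α : ℝ}
    (h : HasMass v x α) (z : EuclideanSpace ℝ (Fin 2)) :
    HasMass v y (α + pathLength γp γm x y z) := by
  refine hasMass_of_forall_pos fun ε hε => ?_
  have hP : 0 < 1 / √γp := by positivity
  have hM : 0 < 1 / √γm := by positivity
  set δ := ε / (3 / √γm + 1 / √γp) with hδ
  have hδ0 : 0 < δ := by positivity
  have h1 := hv.hasMass_lower hp hm (x := shifted z (-δ)) (by rw [shifted_coord]; linarith) hx h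
  have h2 := hv.hasMass_cross_up hp hm hle hδ0 h1
  have h3 := hv.hasMass_upper hp hm (x := y) hy (by rwa [shifted_coord]) h2
  refine h3.mono ?_
  have e1 := dist_shifted_le z y δ
  have e2 := dist_shifted_le z x (-δ)
  rw [abs_neg, abs_of_pos hδ0] at e2
  rw [abs_of_pos hδ0] at e1
  rw [dist_comm x]
  have e3 := mul_le_mul_of_nonneg_left e1 hP.le
  have e4 := mul_le_mul_of_nonneg_left e2 hM.le
  have e5 : (3 / √γm + 1 / √γp) * δ = ε := by
    rw [hδ]
    field_simp
  have e6 : 3 / √γm = 3 * (1 / √γm) := by ring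
  rw [e6] at e5
  rw [pathLength]
  linarith

/-! ### Testing resolvent solutions -/

lemma gradient_of_notMem_tsupport {s : E3 → ℝ} {x : E3} (hx : x ∉ tsupport s) :
    gradient s x = 0 := by
  rw [← norm_eq_zero, norm_gradient, fderiv_of_notMem_tsupport ℝ hx, norm_zero]

lemma partialDeriv_of_notMem_tsupport {s : E3 → ℝ} {x : E3} (hx : x ∉ tsupport s) (i : Fin 3) :
    partialDeriv i s x = 0 := by
  rw [← gradient_apply, gradient_of_notMem_tsupport hx, PiLp.zero_apply]

lemma tsupport_partialDeriv_subset (s : E3 → ℝ) (i : Fin 3) :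
    tsupport (partialDeriv i s) ⊆ tsupport s :=
  closure_minimal (fun x hx => by
    by_contra h
    exact hx (partialDeriv_of_notMem_tsupport h i)) (isClosed_tsupport s)

lemma lap_of_notMem_tsupport {s : E3 → ℝ} {x : E3} (hx : x ∉ tsupport s) : lap s x = 0 :=
  Finset.sum_eq_zero fun i _ =>
    partialDeriv_of_notMem_tsupport (fun h => hx (tsupport_partialDeriv_subset s i h)) i

lemma IsResolventSolution.test {γp γm τ : ℝ} {f : L2} {v : H1}
    (hv : IsResolventSolution (layered γp γm) τ f v) {s : E3 → ℝ} (hs : ContDiff ℝ ∞ s)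
    (hc : HasCompactSupport s) :
    (∫ x, layeredScalar γp γm x * inner ℝ (grad v x) (gradient s x))
      + τ ^ 2 * ∫ x, toL2 v x * s x = ∫ x, f x * s x := by
  obtain ⟨p, hp, hp'⟩ := exists_H1_test hs hc
  have h := hv p
  rw [form_layered] at h
  have h1 : ∫ x, layeredScalar γp γm x * inner ℝ (grad v x) (grad p x)
      = ∫ x, layeredScalar γp γm x * inner ℝ (grad v x) (gradient s x) :=
    integral_congr_ae (by filter_upwards [hp'] with x hx; rw [hx])
  have h2 : ∫ x, toL2 v x * toL2 p x = ∫ x, toL2 v x * s x :=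
    integral_congr_ae (by filter_upwards [hp] with x hx; rw [hx])
  have h3 : ∫ x, f x * toL2 p x = ∫ x, f x * s x :=
    integral_congr_ae (by filter_upwards [hp] with x hx; rw [hx])
  rwa [h1, h2, h3] at h

lemma isSuperFamily_of_isResolventSolution {γp γm : ℝ} (hp : 0 < γp) (hm : 0 < γm) {f : L2}
    (hf : ∀ᵐ x : E3, 0 ≤ f x) {v : ℝ → H1}
    (hv : ∀ τ, 1 ≤ τ → IsResolventSolution (layered γp γm) τ f (v τ)) :
    IsSuperFamily γp γm v := by
  intro τ hτ
  refine ⟨nonneg_of_isResolventSolution hp hm (by linarith) hf (hv τ hτ), fun s hs hc h0 => ?_⟩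
  rw [(hv τ hτ).test hs hc]
  exact integral_nonneg_of_ae (by filter_upwards [hf] with x hx using mul_nonneg hx (h0 x))

lemma exists_bump (y : E3) {r : ℝ} (hr : 0 < r) :
    ∃ s : E3 → ℝ, ContDiff ℝ ∞ s ∧ HasCompactSupport s ∧ (∀ x, 0 ≤ s x) ∧ (∀ x, s x ≤ 1) ∧
      (∀ x ∈ Metric.ball y (r / 4), s x = 1) ∧ tsupport s ⊆ Metric.ball y r := by
  let b : ContDiffBump y := ⟨r / 4, r / 2, by positivity, by linarith⟩
  refine ⟨b, b.contDiff, b.hasCompactSupport, fun x => b.nonneg, fun x => b.le_one, fun x hx => ?_,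
    ?_⟩
  · exact b.one_of_mem_closedBall (Metric.ball_subset_closedBall hx)
  · rw [b.tsupport_eq]
    exact Metric.closedBall_subset_ball (show r / 2 < r by linarith)

lemma integral_layered_inner_eq_of_tsupport {γp γm a : ℝ} (v : H1) {s : E3 → ℝ}
    (ha : ∀ x ∈ tsupport s, layeredScalar γp γm x = a) :
    ∫ x, layeredScalar γp γm x * inner ℝ (grad v x) (gradient s x)
      = a * ∫ x, inner ℝ (grad v x) (gradient s x) := by
  rw [← integral_const_mul]
  refine integral_congr_ae (ae_of_all _ fun x => ?_)
  by_cases hx : x ∈ tsupport s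
  · simp only [ha x hx]
  · simp only [gradient_of_notMem_tsupport hx, inner_zero_right, mul_zero]

lemma sq_mul_exp_neg_le {β : ℝ} (hβ : 0 < β) {τ : ℝ} (hτ : 0 ≤ τ) :
    τ ^ 2 * Real.exp (-(β * τ)) ≤ 2 / β ^ 2 := by
  have h1 := Real.quadratic_le_exp_of_nonneg (mul_nonneg hβ.le hτ)
  rw [Real.exp_neg, ← div_eq_mul_inv, div_le_div_iff₀ (Real.exp_pos _) (by positivity)]
  nlinarith [mul_nonneg hβ.le hτ]

/-- Mass near a point where the source is positive does not decay exponentially. -/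
lemma hasMass_of_source {γp γm : ℝ} (hp : 0 < γp) (hm : 0 < γm) {g : L2}
    (hg : ∀ᵐ x : E3, 0 ≤ g x) {v : ℝ → H1}
    (hv : ∀ τ, 1 ≤ τ → IsResolventSolution (layered γp γm) τ g (v τ)) {y : E3} {r₀ a c₁ : ℝ}
    (hr₀ : 0 < r₀) (ha0 : 0 < a) (ha : ∀ x ∈ Metric.ball y r₀, layeredScalar γp γm x = a)
    (hc₁ : 0 < c₁) (hgc : ∀ᵐ x : E3, x ∈ Metric.ball y r₀ → c₁ ≤ g x) : HasMass v y 0 := by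
  intro β hβ r hr
  have hr' : 0 < min r r₀ := lt_min hr hr₀
  obtain ⟨s, hs, hc, hs0, hs1, hs2, hs3⟩ := exists_bump y hr'
  have hs3r : tsupport s ⊆ Metric.ball y r := hs3.trans (Metric.ball_subset_ball (min_le_left _ _))
  have hs3r₀ : tsupport s ⊆ Metric.ball y r₀ :=
    hs3.trans (Metric.ball_subset_ball (min_le_right _ _))
  obtain ⟨M, hM⟩ := (hasCompactSupport_lap hc).exists_bound_of_continuous (continuous_lap hs)
  have hM0 : 0 ≤ M := (norm_nonneg _).trans (hM 0)
  have hsint : 0 < ∫ x, s x := by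
    rw [integral_pos_iff_support_of_nonneg hs0 (hs.continuous.integrable_of_hasCompactSupport hc)]
    refine (Metric.measure_ball_pos volume y (show 0 < min r r₀ / 4 by positivity)).trans_le
      (measure_mono fun x hx => ?_)
    rw [Function.mem_support, hs2 x hx]
    exact one_ne_zero
  have hlow : c₁ * ∫ x, s x ≤ ∫ x, g x * s x := by
    rw [← integral_const_mul]
    refine integral_mono_ae ((hs.continuous.integrable_of_hasCompactSupport hc).const_mul c₁)
      ((Lp.memLp g).integrable_mul (memLp_test hs hc)) ?_
    filter_upwards [hgc] with x hx
    by_cases h : x ∈ tsupport s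
    · exact mul_le_mul_of_nonneg_right (hx (hs3r₀ h)) (hs0 x)
    · simp [image_eq_zero_of_notMem_tsupport h]
  -- Testing the equation with the bump bounds the fixed positive source integral by `O(τ²)` times
  -- the local mass; the factor `τ²` is later absorbed by `e^{-βτ}`.
  have hup : ∀ τ, 1 ≤ τ → ∫ x, g x * s x
      ≤ (a * M + 1) * τ ^ 2 * ∫ x in Metric.ball y r, toL2 (v τ) x := by
    intro τ hτ
    have hnn := nonneg_of_isResolventSolution hp hm (by linarith) hg (hv τ hτ)
    rw [← (hv τ hτ).test hs hc, integral_layered_inner_eq_of_tsupport _ fun x hx => ha x (hs3r₀ hx),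
      integral_inner_gradient _ hs hc, ← integral_indicator Metric.isOpen_ball.measurableSet,
      mul_neg, ← mul_neg, ← integral_neg, ← integral_const_mul, ← integral_const_mul,
      ← integral_const_mul, ← integral_add]
    · refine integral_mono_ae ?_ ?_ ?_
      · refine Integrable.add (Integrable.const_mul (Integrable.neg ?_) _)
          (Integrable.const_mul ?_ _)
        · exact (Lp.memLp _).integrable_mul
            ((continuous_lap hs).memLp_of_hasCompactSupport (p := 2) (hasCompactSupport_lap hc))
        · exact (Lp.memLp _).integrable_mul (memLp_test hs hc)
      · exact ((integrable_indicator_iff Metric.isOpen_ball.measurableSet).2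
          (integrableOn_ball _ y r)).const_mul _
      · filter_upwards [hnn] with x hx
        by_cases h : x ∈ tsupport s
        · rw [indicator_of_mem (hs3r h)]
          have h1 := neg_le_of_abs_le (hM x)
          have h2 : 1 ≤ τ ^ 2 := one_le_pow₀ hτ
          have h3 : a * -lap s x + τ ^ 2 * s x ≤ (a * M + 1) * τ ^ 2 := by
            have h4 : a * -lap s x ≤ a * M := mul_le_mul_of_nonneg_left (by linarith) ha0.le
            have h5 : a * M * 1 ≤ a * M * τ ^ 2 := mul_le_mul_of_nonneg_left h2 (by positivity)
            have h6 : τ ^ 2 * s x ≤ τ ^ 2 * 1 := mul_le_mul_of_nonneg_left (hs1 x) (by positivity)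
            linarith
          calc a * -(toL2 (v τ) x * lap s x) + τ ^ 2 * (toL2 (v τ) x * s x)
              = (a * -lap s x + τ ^ 2 * s x) * toL2 (v τ) x := by ring
            _ ≤ _ := mul_le_mul_of_nonneg_right h3 hx
        · rw [lap_of_notMem_tsupport h, image_eq_zero_of_notMem_tsupport h]
          simp only [mul_zero, neg_zero, add_zero]
          exact mul_nonneg (by positivity) (indicator_apply_nonneg fun _ => hx)
    · exact Integrable.const_mul (Integrable.neg ((Lp.memLp _).integrable_mul
        ((continuous_lap hs).memLp_of_hasCompactSupport (p := 2) (hasCompactSupport_lap hc)))) _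
    · exact Integrable.const_mul ((Lp.memLp _).integrable_mul (memLp_test hs hc)) _
  have hK : 0 < a * M + 1 := by positivity
  refine ⟨c₁ * (∫ x, s x) / ((a * M + 1) * (2 / β ^ 2)), by positivity, 1, fun τ hτ => ?_⟩
  have h1 := hlow.trans (hup τ hτ)
  have h2 := sq_mul_exp_neg_le hβ (zero_le_one.trans hτ)
  have hτ2 : 0 < τ ^ 2 := by positivity
  rw [div_mul_eq_mul_div, div_le_iff₀ (by positivity)]
  have h3 : 0 ≤ ∫ x in Metric.ball y r, toL2 (v τ) x :=
    nonneg_of_mul_nonneg_right ((by positivity : 0 ≤ c₁ * ∫ x, s x).trans h1) (by positivity)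
  calc c₁ * (∫ x, s x) * Real.exp (-(β * τ))
      ≤ (a * M + 1) * τ ^ 2 * (∫ x in Metric.ball y r, toL2 (v τ) x) * Real.exp (-(β * τ)) := by
        gcongr
    _ = (a * M + 1) * (∫ x in Metric.ball y r, toL2 (v τ) x) * (τ ^ 2 * Real.exp (-(β * τ))) := by
        ring
    _ ≤ (a * M + 1) * (∫ x in Metric.ball y r, toL2 (v τ) x) * (2 / β ^ 2) := by gcongr
    _ = _ := by ring

/-- The energy in `D` controls averages of the solution over `D`. -/
lemma exists_sq_integral_le_energyOn {γp γm a : ℝ} {D : Set E3} (hD : MeasurableSet D)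
    {f : L2} (hf : ∀ᵐ x : E3, x ∈ D → f x = 0) {s : E3 → ℝ} (hs : ContDiff ℝ ∞ s)
    (hc : HasCompactSupport s) (hsD : tsupport s ⊆ D)
    (ha : ∀ x ∈ D, layeredScalar γp γm x = a) :
    ∃ C, 0 < C ∧ ∀ τ, 1 ≤ τ → ∀ v, IsResolventSolution (layered γp γm) τ f v →
      (∫ x, toL2 v x * s x) ^ 2 ≤ C * energyOn D v := by
  set K := ∫ x, ‖gradient s x‖ ^ 2 with hK
  have hKint : Integrable (fun x => ‖gradient s x‖ ^ 2) (volume : Measure E3) :=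
    (memLp_gradient hs hc).integrable_norm_pow two_ne_zero
  have hK0 : 0 ≤ K := integral_nonneg fun x => by positivity
  refine ⟨a ^ 2 * K + 1, by positivity, fun τ hτ v hv => ?_⟩
  -- No source acts on the support of `s`, so the equation ties `τ²∫ v s` to an integral of `∇v`
  -- over `D`.
  have h1 := hv.test hs hc
  rw [integral_layered_inner_eq_of_tsupport _ fun x hx => ha x (hsD hx)] at h1
  have h2 : ∫ x, f x * s x = 0 := by
    refine integral_eq_zero_of_ae ?_
    filter_upwards [hf] with x hx
    by_cases h : x ∈ tsupport s
    · simp [hx (hsD h)]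
    · simp [image_eq_zero_of_notMem_tsupport h]
  rw [h2] at h1
  set X := ∫ x, inner ℝ (grad v x) (gradient s x)
  set Y := ∫ x, toL2 v x * s x
  have h3 : ∀ l : ℝ, 2 * l * X ≤ energyOn D v + l ^ 2 * K := by
    intro l
    rw [energyOn, ← integral_indicator hD, hK, ← integral_const_mul, ← integral_const_mul,
      ← integral_add ((integrable_norm_sq (grad v)).indicator hD) (hKint.const_mul _)]
    refine integral_mono ((integrable_inner_gradient v hs hc).const_mul _)
      (((integrable_norm_sq (grad v)).indicator hD).add (hKint.const_mul _)) fun x => ?_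
    by_cases h : x ∈ tsupport s
    · simp only [indicator_of_mem (hsD h)]
      have h4 : 0 ≤ ‖grad v x - l • gradient s x‖ ^ 2 := by positivity
      rw [norm_sub_sq_real, inner_smul_right, norm_smul, mul_pow, Real.norm_eq_abs, sq_abs] at h4
      linarith
    · simp only [gradient_of_notMem_tsupport h, inner_zero_right, mul_zero, norm_zero,
        zero_pow two_ne_zero, add_zero]
      exact indicator_nonneg (fun x _ => by positivity) x
  have h4 : Y ^ 2 ≤ (a * X) ^ 2 := by
    have h5 : a * X = -(τ ^ 2 * Y) := by linarith
    rw [h5, neg_sq, mul_pow]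
    exact le_mul_of_one_le_left (sq_nonneg Y) (one_le_pow₀ (one_le_pow₀ hτ))
  have hE := energyOn_nonneg D v
  -- Cauchy–Schwarz through a quadratic in `l`; this nearly optimal `l` avoids dividing by `K`,
  -- whose positivity is not needed.
  have h6 := h3 (a ^ 2 * X / (a ^ 2 * K + 1))
  have hpos : 0 < a ^ 2 * K + 1 := by positivity
  have h7 : (a ^ 2 * X / (a ^ 2 * K + 1)) ^ 2 * K ≤ a ^ 2 * X ^ 2 / (a ^ 2 * K + 1) := by
    rw [div_pow, div_mul_eq_mul_div, div_le_div_iff₀ (by positivity) hpos]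
    have : 0 ≤ a ^ 2 * X ^ 2 * (a ^ 2 * K + 1) := by positivity
    nlinarith
  have h8 : 2 * (a ^ 2 * X / (a ^ 2 * K + 1)) * X = 2 * (a ^ 2 * X ^ 2 / (a ^ 2 * K + 1)) := by
    ring
  have h9 : a ^ 2 * X ^ 2 / (a ^ 2 * K + 1) ≤ energyOn D v := by linarith
  rw [div_le_iff₀ hpos] at h9
  calc Y ^ 2 ≤ (a * X) ^ 2 := h4
    _ = a ^ 2 * X ^ 2 := by ring
    _ ≤ _ := by linarith

/-! ### Consequences of the boundary conditions -/

/-- A truncated cone contains, at every small scale `ρ`, a ball of radius proportional to `ρ`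
centred on its axis. This is the form in which the cone condition is applied. -/
lemma ConeCondition.exists_ball_subset {A : Set E3} (hA : ConeCondition A) {x : E3}
    (hx : x ∈ frontier A) : ∃ (n : E3) (h c : ℝ), ‖n‖ = 1 ∧ 0 < h ∧ 0 < c ∧ c ≤ 1 / 4 ∧
      ∀ ρ, 0 < ρ → ρ ≤ h → Metric.ball (x + (ρ / 2) • n) (c * ρ) ⊆ A := by
  obtain ⟨n, h, θ, hn, hh, hθ, hθ', hsub⟩ := hA x hx
  have hcos : Real.cos θ < 1 := by
    rw [← Real.cos_zero]
    exact Real.cos_lt_cos_of_nonneg_of_le_pi le_rfl hθ'.le hθ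
  -- Truncating at `0` treats obtuse opening angles together with acute ones.
  set k := max (Real.cos θ) 0 with hk
  have hk0 : 0 ≤ k := le_max_right _ _
  have hk1 : k < 1 := max_lt hcos one_pos
  refine ⟨n, h, (1 - k) / 4, hn, hh, by linarith, by linarith, fun ρ hρ hρh y hy => hsub ?_⟩
  have he : ‖y - x - (ρ / 2) • n‖ < (1 - k) / 4 * ρ := by
    rwa [Metric.mem_ball, dist_eq_norm, ← sub_sub] at hy
  have hnn : ‖(ρ / 2) • n‖ = ρ / 2 := by
    rw [norm_smul, hn, mul_one, Real.norm_of_nonneg (by positivity)]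
  have h1 : ‖y - x‖ ≤ ρ / 2 + (1 - k) / 4 * ρ := by
    have := norm_le_norm_add_norm_sub' (y - x) ((ρ / 2) • n)
    linarith
  have h2 : ρ / 2 - (1 - k) / 4 * ρ ≤ inner ℝ (y - x) n := by
    have h3 : inner ℝ (y - x) n = inner ℝ (y - x - (ρ / 2) • n) n + ρ / 2 := by
      rw [inner_sub_left (y - x), inner_smul_left, real_inner_self_eq_norm_sq, hn]
      simp
    have h4 := neg_le_of_abs_le (abs_real_inner_le_norm (y - x - (ρ / 2) • n) n)
    rw [hn, mul_one] at h4
    linarith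
  have hkρ : 0 ≤ k * ρ := by positivity
  have hkρ' : k * ρ < ρ := by nlinarith
  refine ⟨⟨by linarith, ?_⟩, ?_⟩
  · calc ‖y - x‖ * Real.cos θ ≤ ‖y - x‖ * k :=
          mul_le_mul_of_nonneg_left (le_max_left _ _) (norm_nonneg _)
      _ ≤ (ρ / 2 + (1 - k) / 4 * ρ) * k := by gcongr
      _ ≤ ρ / 2 - (1 - k) / 4 * ρ := by nlinarith
      _ ≤ _ := h2
  · rintro rfl
    rw [sub_self, inner_zero_left] at h2
    nlinarith

lemma ConeCondition.subset_closure_interior {A : Set E3} (hA : ConeCondition A) :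
    A ⊆ closure (interior A) := by
  intro x hx
  by_cases hi : x ∈ interior A
  · exact subset_closure hi
  obtain ⟨n, h, c, hn, hh, hc, -, hsub⟩ := hA.exists_ball_subset ⟨subset_closure hx, hi⟩
  rw [Metric.mem_closure_iff]
  intro ε hε
  have hρ : 0 < min h ε := lt_min hh hε
  refine ⟨x + (min h ε / 2) • n, interior_maximal (hsub _ hρ (min_le_left _ _)) Metric.isOpen_ball
    (Metric.mem_ball_self (by positivity)), ?_⟩
  rw [dist_self_add_right, norm_smul, hn, mul_one, Real.norm_of_nonneg (by positivity)]
  linarith [min_le_right h ε]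

/-- Almost every point of `∂B` is a density point of it. But near each boundary point a fixed
fraction `c³` of every small ball lies in the open set `B`, which is disjoint from `∂B`. -/
lemma ConeCondition.volume_frontier {B : Set E3} (hB : ConeCondition B) (hBo : IsOpen B) :
    volume (frontier B) = 0 := by
  have hae := Besicovitch.ae_tendsto_measure_inter_div (volume : Measure E3) (frontier B)
  rw [ae_restrict_iff' isClosed_frontier.measurableSet] at hae
  rw [measure_eq_zero_iff_ae_notMem]
  filter_upwards [hae] with x hx hxB
  obtain ⟨n, h, c, hn, hh, hc, hc4, hsub⟩ := hB.exists_ball_subset hxB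
  have hbound : ∀ᶠ ρ in 𝓝[>] (0 : ℝ),
      volume (frontier B ∩ Metric.closedBall x ρ) / volume (Metric.closedBall x ρ)
        + ENNReal.ofReal (c ^ 3) ≤ 1 := by
    filter_upwards [Ioc_mem_nhdsGT hh] with ρ hρ
    set z := x + (ρ / 2) • n
    have hm0 : volume (Metric.closedBall x ρ) ≠ 0 :=
      (Metric.measure_closedBall_pos _ _ hρ.1).ne'
    have hmt : volume (Metric.closedBall x ρ) ≠ ⊤ := measure_closedBall_lt_top.ne
    have hball : volume (Metric.ball z (c * ρ))
        = ENNReal.ofReal (c ^ 3) * volume (Metric.closedBall x ρ) := by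
      rw [Measure.addHaar_ball_mul_of_pos volume z hc ρ, finrank_euclideanSpace_fin,
        Measure.addHaar_closedBall _ _ hρ.1.le, Measure.addHaar_ball_of_pos _ _ hρ.1]
    have hdisj : Disjoint (frontier B ∩ Metric.closedBall x ρ) (Metric.ball z (c * ρ)) := by
      refine Set.disjoint_left.2 fun y hy hy' => ?_
      have := hsub ρ hρ.1 hρ.2 hy'
      rw [← hBo.interior_eq] at this
      exact hy.1.2 this
    have hsubset : frontier B ∩ Metric.closedBall x ρ ∪ Metric.ball z (c * ρ)
        ⊆ Metric.closedBall x ρ := by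
      refine union_subset inter_subset_right fun y hy => ?_
      rw [Metric.mem_ball] at hy
      rw [Metric.mem_closedBall]
      have h1 : dist z x = ρ / 2 := by
        rw [dist_self_add_left, norm_smul, hn, mul_one, Real.norm_of_nonneg (by linarith [hρ.1])]
      have := dist_triangle y z x
      nlinarith [hρ.1]
    have hle := measure_mono (μ := volume) hsubset
    rw [measure_union hdisj Metric.isOpen_ball.measurableSet, hball] at hle
    calc _ = (volume (frontier B ∩ Metric.closedBall x ρ)
          + ENNReal.ofReal (c ^ 3) * volume (Metric.closedBall x ρ))
            / volume (Metric.closedBall x ρ) := by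
          rw [ENNReal.add_div, ENNReal.mul_div_cancel_right hm0 hmt]
      _ ≤ 1 := ENNReal.div_le_of_le_mul (by rwa [one_mul])
  have hlim := le_of_tendsto ((hx hxB).add_const (ENNReal.ofReal (c ^ 3))) hbound
  have hpos : 0 < ENNReal.ofReal (c ^ 3) := ENNReal.ofReal_pos.2 (by positivity)
  exact absurd hlim (not_le.2 (ENNReal.lt_add_right ENNReal.one_ne_top hpos.ne'))

/-- At a point of `A` outside its interior the defining function vanishes. If no interior points
were near, that function would have a local minimum there, although it has no critical points. -/
lemma HasC1Boundary.subset_closure_interior {A : Set E3} (hA : HasC1Boundary A) :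
    A ⊆ closure (interior A) := by
  intro x hx
  by_cases hi : x ∈ interior A
  · exact subset_closure hi
  obtain ⟨U, φ, hU, hxU, hφ, hd, hneg, hpos⟩ := hA x ⟨subset_closure hx, hi⟩
  have hcont := hφ.continuousOn
  have hop : ∀ y ∈ U, φ y < 0 → y ∈ interior A := fun y hy h0 => by
    have ho : IsOpen (U ∩ φ ⁻¹' Iio 0) := hcont.isOpen_inter_preimage hU isOpen_Iio
    exact interior_maximal (fun w hw => hneg w hw.1 hw.2) ho ⟨hy, h0⟩
  have h0 : φ x = 0 := by
    rcases lt_trichotomy (φ x) 0 with h | h | h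
    · exact absurd (hop x hxU h) hi
    · exact h
    · exact absurd hx (hpos x hxU h)
  by_contra hcl
  have hmin : IsLocalMin φ x := by
    filter_upwards [hU.mem_nhds hxU, isClosed_closure.isOpen_compl.mem_nhds hcl] with y hyU hy
    rw [h0]
    by_contra! hlt
    exact hy (subset_closure (hop y hyU hlt))
  exact hd x hxU hmin.fderiv_eq_zero

lemma pathLength_nonneg (γp γm : ℝ) (x y : E3) (z : EuclideanSpace ℝ (Fin 2)) :
    0 ≤ pathLength γp γm x y z := by
  unfold pathLength
  positivity

lemma bddBelow_pathLength (γp γm : ℝ) (x y : E3) : BddBelow (range (pathLength γp γm x y)) :=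
  ⟨0, by rintro _ ⟨z, rfl⟩; exact pathLength_nonneg γp γm x y z⟩

lemma opticalDist_nonneg (γp γm : ℝ) (x y : E3) : 0 ≤ opticalDist γp γm x y :=
  Real.iInf_nonneg fun z => pathLength_nonneg γp γm x y z

lemma opticalSetDist_le {D B : Set E3} {x y : E3} (γp γm : ℝ) (hx : x ∈ D) (hy : y ∈ B)
    (z : EuclideanSpace ℝ (Fin 2)) : opticalSetDist γp γm D B ≤ pathLength γp γm x y z := by
  have h1 : opticalSetDist γp γm D B ≤ opticalDist γp γm x y :=
    ciInf_le (f := fun p : D × B => opticalDist γp γm p.1 p.2)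
      ⟨0, by rintro _ ⟨z, rfl⟩; exact opticalDist_nonneg γp γm _ _⟩ (⟨x, hx⟩, ⟨y, hy⟩)
  exact h1.trans (ciInf_le (bddBelow_pathLength γp γm x y) z)

/-- A nearly optimal triple may have `x` on the boundary of `D`; continuity of the path length in
`x` moves it into the interior, where a bump function fits. -/
lemma exists_pathLength_lt {γp γm : ℝ} {D B : Set E3} (hD : D.Nonempty) (hB : B.Nonempty)
    (hDi : D ⊆ closure (interior D)) {β : ℝ} (hβ : opticalSetDist γp γm D B < β) :
    ∃ x ∈ interior D, ∃ y ∈ B, ∃ z, pathLength γp γm x y z < β := by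
  have := hD.to_subtype
  have := hB.to_subtype
  obtain ⟨⟨⟨x, hx⟩, ⟨y, hy⟩⟩, hxy⟩ := exists_lt_of_ciInf_lt hβ
  obtain ⟨z, hz⟩ := exists_lt_of_ciInf_lt hxy
  have hcont : Continuous fun x' => pathLength γp γm x' y z := by
    unfold pathLength
    fun_prop
  obtain ⟨w, hw, hwD⟩ := mem_closure_iff_nhds.1 (hDi hx) _
    (hcont.continuousAt.eventually_lt_const hz)
  exact ⟨w, hwD, y, hy, z, hw⟩

/-! ### The lower bound for the energy -/

lemma ae_nonneg_of_open {B : Set E3} (hB : volume (frontier B) = 0) (hBo : IsOpen B) {f : L2}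
    (hf : ∀ᵐ x : E3, x ∉ closure B → f x = 0) {c₁ : ℝ} (hc₁ : 0 < c₁)
    (hfB : ∀ᵐ x : E3, x ∈ B → c₁ ≤ f x) : ∀ᵐ x : E3, 0 ≤ f x := by
  have hfr : ∀ᵐ x : E3, x ∉ frontier B := measure_eq_zero_iff_ae_notMem.1 hB
  filter_upwards [hf, hfB, hfr] with x h1 h2 h3
  by_cases hx : x ∈ B
  · exact hc₁.le.trans (h2 hx)
  · rw [h1 fun hcl => h3 ⟨hcl, by rwa [hBo.interior_eq]⟩]

/-- If an average of the solution over `D` is bounded below, then so is the energy. -/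
lemma exists_energyOn_ge_of_integral {D : Set E3} {s : E3 → ℝ} {v : ℝ → H1} {C c α β τ₀ : ℝ}
    (hC : 0 < C) (hc : 0 < c) (hβ : 2 * α ≤ β)
    (h1 : ∀ τ, 1 ≤ τ → (∫ x, toL2 (v τ) x * s x) ^ 2 ≤ C * energyOn D (v τ))
    (h2 : ∀ τ, τ₀ ≤ τ → c * Real.exp (-(α * τ)) ≤ ∫ x, toL2 (v τ) x * s x) :
    ∃ c', 0 < c' ∧ ∃ τ₁, ∀ τ, τ₁ ≤ τ → c' * Real.exp (-(β * τ)) ≤ energyOn D (v τ) := by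
  refine ⟨c ^ 2 / C, by positivity, max τ₀ 1, fun τ hτ => ?_⟩
  have hτ1 : 1 ≤ τ := (le_max_right _ _).trans hτ
  have h3 := h1 τ hτ1
  have h4 := pow_le_pow_left₀ (by positivity) (h2 τ ((le_max_left _ _).trans hτ)) 2
  rw [div_mul_eq_mul_div, div_le_iff₀ hC, mul_comm (energyOn D (v τ))]
  refine le_trans ?_ (h4.trans h3)
  rw [mul_pow, ← Real.exp_nat_mul]
  have : -(β * τ) ≤ (2 : ℕ) * -(α * τ) := by
    push_cast
    nlinarith
  gcongr

lemma setIntegral_le_integral_mul {u : L2} (hu : ∀ᵐ x : E3, 0 ≤ u x) {s : E3 → ℝ}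
    (hs : ∀ᵐ x : E3, 0 ≤ s x)
    (hint : Integrable (fun x => u x * s x) (volume : Measure E3)) {x₀ : E3}
    {r c : ℝ} (hsc : ∀ᵐ x : E3, x ∈ Metric.ball x₀ r → c ≤ s x) :
    c * ∫ x in Metric.ball x₀ r, u x ≤ ∫ x, u x * s x := by
  rw [← integral_const_mul, ← integral_indicator Metric.isOpen_ball.measurableSet]
  refine integral_mono_ae ((integrable_indicator_iff Metric.isOpen_ball.measurableSet).2
    ((integrableOn_ball u x₀ r).const_mul c)) hint ?_
  filter_upwards [hu, hs, hsc] with x hx hs hx'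
  by_cases h : x ∈ Metric.ball x₀ r
  · rw [indicator_of_mem h, mul_comm]
    exact mul_le_mul_of_nonneg_left (hx' h) hx
  · rw [indicator_of_notMem h]
    exact mul_nonneg hx hs

lemma exists_ball_subset_interior {D : Set E3} {x : E3} (hx : x ∈ interior D) :
    ∃ r, 0 < r ∧ Metric.ball x r ⊆ D :=
  let ⟨r, hr, h⟩ := Metric.isOpen_iff.1 isOpen_interior x hx
  ⟨r, hr, h.trans interior_subset⟩

/-- Downward propagation from the source to the inclusion, for the slower upper medium. -/
lemma exists_integral_ge_of_le {γp γm : ℝ} (hp : 0 < γp) (hm : 0 < γm) (hle : γp ≤ γm)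
    {f : L2} (hf0 : ∀ᵐ x : E3, 0 ≤ f x) {v : ℝ → H1}
    (hv : ∀ τ, 1 ≤ τ → IsResolventSolution (layered γp γm) τ f (v τ)) {x y : E3} {r r' c₁ : ℝ}
    (hr : 0 < r) (hr' : 0 < r') (hx : x 2 < 0) (hyr : ∀ w ∈ Metric.ball y r', 0 < w 2)
    (hc₁ : 0 < c₁) (hfc : ∀ᵐ w : E3, w ∈ Metric.ball y r' → c₁ ≤ f w)
    (z : EuclideanSpace ℝ (Fin 2)) {α : ℝ} (hα : pathLength γp γm x y z < α)
    {s : E3 → ℝ} (hs : ContDiff ℝ ∞ s) (hsc : HasCompactSupport s) (hs0 : ∀ w, 0 ≤ s w)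
    (hs1 : ∀ w ∈ Metric.ball x r, s w = 1) :
    ∃ c, 0 < c ∧ ∃ τ₀, ∀ τ, τ₀ ≤ τ → c * Real.exp (-(α * τ)) ≤ ∫ w, toL2 (v τ) w * s w := by
  have hfam := isSuperFamily_of_isResolventSolution hp hm hf0 hv
  have hstart : HasMass v y 0 := hasMass_of_source hp hm hf0 hv hr' hp
    (fun w hw => layeredScalar_of_pos (hyr w hw)) hc₁ hfc
  have hy2 := hyr y (Metric.mem_ball_self hr')
  have hmass := hfam.hasMass_down hp hm hle hx hy2 hstart z
  rw [zero_add] at hmass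
  obtain ⟨c, hc, τ₀, h⟩ := hmass α hα r hr
  refine ⟨c, hc, max τ₀ 1, fun τ hτ => (h τ ((le_max_left _ _).trans hτ)).trans ?_⟩
  have := setIntegral_le_integral_mul (hfam τ ((le_max_right _ _).trans hτ)).1
    (ae_of_all _ hs0) ((Lp.memLp (toL2 (v τ))).integrable_mul (memLp_test hs hsc))
    (c := 1) (ae_of_all _ fun w hw => (hs1 w hw).ge)
  rwa [one_mul] at this

/-- Upward propagation, for the slower lower medium, by reciprocity. -/
lemma exists_integral_ge_of_ge {γp γm : ℝ} (hp : 0 < γp) (hm : 0 < γm) (hle : γm ≤ γp)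
    {f : L2} (hf0 : ∀ᵐ x : E3, 0 ≤ f x) {v : ℝ → H1}
    (hv : ∀ τ, 1 ≤ τ → IsResolventSolution (layered γp γm) τ f (v τ)) {x y : E3} {r r' c₁ : ℝ}
    (hr : 0 < r) (hr' : 0 < r') (hxr : ∀ w ∈ Metric.ball x r, w 2 < 0) (hy : 0 < y 2)
    (hc₁ : 0 < c₁) (hfc : ∀ᵐ w : E3, w ∈ Metric.ball y r' → c₁ ≤ f w)
    (z : EuclideanSpace ℝ (Fin 2)) {α : ℝ} (hα : pathLength γp γm x y z < α)
    {s : E3 → ℝ} (hs : ContDiff ℝ ∞ s) (hsc : HasCompactSupport s) (hs0 : ∀ w, 0 ≤ s w)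
    (hs1 : ∀ w ∈ Metric.ball x r, s w = 1) :
    ∃ c, 0 < c ∧ ∃ τ₀, ∀ τ, τ₀ ≤ τ → c * Real.exp (-(α * τ)) ≤ ∫ w, toL2 (v τ) w * s w := by
  have hcoef := isCoefficient_layered hp hm
  set g : L2 := (memLp_test hs hsc).toLp s with hg
  have hgs : g =ᵐ[volume] s := MemLp.coeFn_toLp _
  have hex : ∀ τ : ℝ, ∃ V : H1, 1 ≤ τ → IsResolventSolution (layered γp γm) τ g V := by
    intro τ
    by_cases hτ : 1 ≤ τ
    · obtain ⟨V, hV⟩ := exists_isResolventSolution hcoef (by linarith : τ ≠ 0) g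
      exact ⟨V, fun _ => hV⟩
    · exact ⟨0, fun h => absurd h hτ⟩
  choose V hV using hex
  have hg0 : ∀ᵐ w : E3, 0 ≤ g w := by filter_upwards [hgs] with w hw; rw [hw]; exact hs0 w
  have hfam := isSuperFamily_of_isResolventSolution hp hm hg0 hV
  have hstart : HasMass V x 0 := hasMass_of_source hp hm hg0 hV hr hm
    (fun w hw => layeredScalar_of_nonpos (hxr w hw).le) one_pos
    (by filter_upwards [hgs] with w hw h; rw [hw, hs1 w h])
  have hmass := hfam.hasMass_up hp hm hle (hxr x (Metric.mem_ball_self hr)) hy hstart z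
  rw [zero_add] at hmass
  obtain ⟨c, hc, τ₀, h⟩ := hmass α hα r' hr'
  refine ⟨c₁ * c, by positivity, max τ₀ 1, fun τ hτ => ?_⟩
  have hτ1 : 1 ≤ τ := (le_max_right _ _).trans hτ
  -- Reciprocity: each of the two resolvent solutions is tested with the other, and the form is
  -- symmetric.
  have hrec : ∫ w, toL2 (v τ) w * s w = ∫ w, toL2 (V τ) w * f w := by
    have h1 := (isResolventSolution_iff.1 (hv τ hτ1)) (V τ)
    have h2 := (isResolventSolution_iff.1 (hV τ hτ1)) (v τ)
    rw [resolventForm_comm hcoef] at h1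
    have h3 : ∫ w, toL2 (v τ) w * s w = ∫ w, toL2 (v τ) w * g w :=
      integral_congr_ae (by filter_upwards [hgs] with w hw; rw [hw])
    rw [h3, integral_mul_eq_inner, integral_mul_eq_inner, real_inner_comm, ← h2, h1,
      real_inner_comm]
  rw [hrec, mul_assoc]
  exact (mul_le_mul_of_nonneg_left (h τ ((le_max_left _ _).trans hτ)) hc₁.le).trans
    (setIntegral_le_integral_mul (hfam τ hτ1).1 hf0
      ((Lp.memLp (toL2 (V τ))).integrable_mul (Lp.memLp f)) hfc)

/-- An average of `v` over a small ball in `D` is bounded below along a nearly optimal path, at rate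
`β/2`. The energy dominates its square, which produces the factor `2` in the exponent. -/
lemma exists_energyOn_ge_of_pos {γp γm : ℝ} (hp : 0 < γp) (hm : 0 < γm) {D B : Set E3}
    (hDm : MeasurableSet D) (hD : D.Nonempty) (hDi : D ⊆ closure (interior D))
    (hDl : D ⊆ {x | x 2 < 0}) (hB : B.Nonempty) (hBo : IsOpen B) (hBn : volume (frontier B) = 0)
    (hBu : closure B ⊆ {x | 0 < x 2}) {f : L2} (hf : ∀ᵐ x : E3, x ∉ closure B → f x = 0)
    {c₁ : ℝ} (hc₁ : 0 < c₁) (hfB : ∀ᵐ x : E3, x ∈ B → c₁ ≤ f x) {v : ℝ → H1}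
    (hv : ∀ τ, 1 ≤ τ → IsResolventSolution (layered γp γm) τ f (v τ)) {β : ℝ}
    (hβ : 2 * opticalSetDist γp γm D B < β) :
    ∃ c, 0 < c ∧ ∃ τ₀, ∀ τ, τ₀ ≤ τ → c * Real.exp (-(β * τ)) ≤ energyOn D (v τ) := by
  obtain ⟨x, hx, y, hy, z, hz⟩ := exists_pathLength_lt hD hB hDi
    (show opticalSetDist γp γm D B < β / 2 by linarith)
  have hf0 := ae_nonneg_of_open hBn hBo hf hc₁ hfB
  obtain ⟨r, hr, hrD⟩ := exists_ball_subset_interior hx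
  obtain ⟨r', hr', hrB⟩ := Metric.isOpen_iff.1 hBo y hy
  obtain ⟨s, hs, hsc, hs0, -, hs1, hsr⟩ := exists_bump x hr
  have hfD : ∀ᵐ x : E3, x ∈ D → f x = 0 := by
    filter_upwards [hf] with w hw hwD
    exact hw fun h => lt_asymm (show 0 < w 2 from hBu h) (hDl hwD)
  have hfc : ∀ᵐ w : E3, w ∈ Metric.ball y r' → c₁ ≤ f w := by
    filter_upwards [hfB] with w hw h using hw (hrB h)
  obtain ⟨C, hC, hCE⟩ := exists_sq_integral_le_energyOn hDm hfD hs hsc (hsr.trans hrD)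
    (fun w hw => layeredScalar_of_nonpos (γp := γp) (γm := γm) (hDl hw).le)
  have hxr : ∀ w ∈ Metric.ball x (r / 4), w 2 < 0 := fun w hw =>
    hDl (hrD (Metric.ball_subset_ball (by linarith) hw))
  have hyr : ∀ w ∈ Metric.ball y r', 0 < w 2 := fun w hw => hBu (subset_closure (hrB hw))
  obtain ⟨c, hc, τ₀, h⟩ : ∃ c, 0 < c ∧ ∃ τ₀, ∀ τ, τ₀ ≤ τ →
      c * Real.exp (-(β / 2 * τ)) ≤ ∫ w, toL2 (v τ) w * s w := by
    -- The mass argument crosses the interface from the slower to the faster medium, so the order of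
    -- the coefficients decides whether it runs downwards or upwards.
    rcases le_total γp γm with hle | hle
    · exact exists_integral_ge_of_le hp hm hle hf0 hv (by positivity : 0 < r / 4) hr'
        (hxr x (Metric.mem_ball_self (by positivity))) hyr hc₁ hfc z hz hs hsc hs0 hs1
    · exact exists_integral_ge_of_ge hp hm hle hf0 hv (by positivity : 0 < r / 4) hr'
        hxr (hyr y (Metric.mem_ball_self hr')) hc₁ hfc z hz hs hsc hs0 hs1
  exact exists_energyOn_ge_of_integral hC hc (by linarith) (fun τ hτ => hCE τ hτ _ (hv τ hτ)) h

lemma IsResolventSolution.neg {γ : E3 → Matrix (Fin 3) (Fin 3) ℝ} {τ : ℝ} {f : L2} {v : H1}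
    (hv : IsResolventSolution γ τ f v) :
    IsResolventSolution γ τ (-f) (-v) := by
  rw [isResolventSolution_iff] at hv ⊢
  intro φ
  have := resolventForm_smul_left (γ := γ) τ (-1) v φ
  rw [neg_one_smul, neg_one_mul] at this
  rw [this, hv φ, inner_neg_left]

lemma energyOn_neg (D : Set E3) (v : H1) : energyOn D (-v) = energyOn D v := by
  refine integral_congr_ae (ae_restrict_of_ae ?_)
  rw [map_neg]
  filter_upwards [Lp.coeFn_neg (grad v)] with x hx
  rw [hx, Pi.neg_apply, norm_neg]

/-- The energy in `D` decays at most like `e^{-2 l(D,B) τ}`. -/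
theorem exists_energyOn_ge {γp γm : ℝ} (hp : 0 < γp) (hm : 0 < γm) {D B : Set E3}
    (hDm : MeasurableSet D) (hD : D.Nonempty) (hDi : D ⊆ closure (interior D))
    (hDl : D ⊆ {x | x 2 < 0}) (hB : B.Nonempty) (hBo : IsOpen B) (hBc : ConeCondition B)
    (hBu : closure B ⊆ {x | 0 < x 2}) {f : L2} (hf : EmissionCondition B f) {v : ℝ → H1}
    (hv : ∀ τ, 1 ≤ τ → IsResolventSolution (layered γp γm) τ f (v τ)) {β : ℝ}
    (hβ : 2 * opticalSetDist γp γm D B < β) :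
    ∃ c, 0 < c ∧ ∃ τ₀, ∀ τ, τ₀ ≤ τ → c * Real.exp (-(β * τ)) ≤ energyOn D (v τ) := by
  obtain ⟨hf0, c₁, hc₁, h | h⟩ := hf
  · exact exists_energyOn_ge_of_pos hp hm hDm hD hDi hDl hB hBo (hBc.volume_frontier hBo) hBu hf0
      hc₁ h hv hβ
  · have hn := Lp.coeFn_neg f
    have := exists_energyOn_ge_of_pos hp hm hDm hD hDi hDl hB hBo (hBc.volume_frontier hBo) hBu
      (f := -f)
      (by filter_upwards [hf0, hn] with x h1 h2 h3; rw [h2, Pi.neg_apply, h1 h3, neg_zero])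
      hc₁ (by filter_upwards [h, hn] with x h1 h2 h3; rw [h2]; exact h1 h3)
      (v := fun τ => -v τ) (fun τ hτ => (hv τ hτ).neg) hβ
    simpa only [energyOn_neg] using this

/-! ### Weighted energy estimate -/

/-- The mixed term is at most `2κ(√a ρ|G|)(τρ|t|)`, and the arithmetic-geometric mean inequality
bounds it by the fraction `κ` of the weighted energy density. -/
lemma cross_term_ge {a κ τ ρ t : ℝ} (ha : 0 < a) (hκ : 0 ≤ κ) (hρ : 0 ≤ ρ)
    {G H : E3} (hH : √a * ‖H‖ ≤ κ * τ * ρ) :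
    -(κ * (a * ρ ^ 2 * ‖G‖ ^ 2 + τ ^ 2 * (ρ ^ 2 * t ^ 2)))
      ≤ a * (2 * ρ * t * inner ℝ G H) := by
  have h1 : |a * (2 * ρ * t * inner ℝ G H)| ≤ 2 * (ρ * |t|) * (√a * ‖G‖) * (√a * ‖H‖) := by
    rw [abs_mul, abs_mul, abs_mul, abs_mul, abs_of_pos ha, abs_two, abs_of_nonneg hρ]
    have h2 := abs_real_inner_le_norm G H
    calc a * (2 * ρ * |t| * |inner ℝ G H|) ≤ a * (2 * ρ * |t| * (‖G‖ * ‖H‖)) := by gcongr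
      _ = √a * √a * (2 * ρ * |t| * (‖G‖ * ‖H‖)) := by rw [Real.mul_self_sqrt ha.le]
      _ = _ := by ring
  have h2 : 2 * (ρ * |t|) * (√a * ‖G‖) * (√a * ‖H‖)
      ≤ 2 * (ρ * |t|) * (√a * ‖G‖) * (κ * τ * ρ) := by gcongr
  have h3 : 0 ≤ κ * (√a * ρ * ‖G‖ - τ * (ρ * |t|)) ^ 2 := by positivity
  have h4 : (√a) ^ 2 = a := Real.sq_sqrt ha.le
  have h5 : |t| ^ 2 = t ^ 2 := sq_abs t
  have h6 : κ * (√a * ρ * ‖G‖ - τ * (ρ * |t|)) ^ 2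
      = κ * ((√a) ^ 2 * ρ ^ 2 * ‖G‖ ^ 2 + τ ^ 2 * (ρ ^ 2 * |t| ^ 2))
        - 2 * (ρ * |t|) * (√a * ‖G‖) * (κ * τ * ρ) := by ring
  rw [h6, h4, h5] at h3
  have := neg_le_of_abs_le h1
  linarith

lemma gradient_sq {ρ : E3 → ℝ} (hρ : ContDiff ℝ ∞ ρ) (x : E3) :
    gradient (fun y => ρ y ^ 2) x = (2 * ρ x) • gradient ρ x := by
  ext i
  have hd := contDiff_differentiableAt hρ x
  have h := (hd.hasFDerivAt.pow 2).fderiv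
  rw [PiLp.smul_apply, gradient_apply, gradient_apply, partialDeriv, partialDeriv, h]
  simp

/-- Agmon's method: test the equation with `ρ²v`. The derivative of the weight consumes only a
fraction `κ < 1` of the energy, while on the right the weight is seen only where `f` is nonzero. -/
lemma weighted_energy_le {γp γm : ℝ} (hp : 0 < γp) (hm : 0 < γm) {τ κ : ℝ}
    (hκ : 0 ≤ κ) (hκ1 : κ < 1) {f : L2} {v : H1}
    (hv : IsResolventSolution (layered γp γm) τ f v) {ρ : E3 → ℝ} (hρ : ContDiff ℝ ∞ ρ)
    (hρ0 : ∀ x, 0 ≤ ρ x) {M : ℝ} (hM : ∀ x, ρ x ≤ M) (hM' : ∀ x, ‖gradient ρ x‖ ≤ M)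
    (hgrad : ∀ x, √(layeredScalar γp γm x) * ‖gradient ρ x‖ ≤ κ * τ * ρ x)
    {D : Set E3} (hD : MeasurableSet D) {d b : ℝ} (hd0 : 0 ≤ d) (hd : ∀ x ∈ D, d ≤ ρ x ^ 2)
    (hb : ∀ᵐ x : E3, f x ≠ 0 → ρ x ^ 2 ≤ b) :
    (1 - κ) * min γp γm * d * energyOn D v ≤ b * (‖f‖ * ‖toL2 v‖) := by
  set a := layeredScalar γp γm with ha
  have hM0 : 0 ≤ M := (hρ0 0).trans (hM 0)
  obtain ⟨p, hp1, hp2⟩ := exists_H1_mul v (ρ := fun x => ρ x ^ 2) (M := M ^ 2 + 2 * M * M)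
    (hρ.pow 2)
    (fun x => by
      rw [abs_of_nonneg (by positivity)]
      have := pow_le_pow_left₀ (hρ0 x) (hM x) 2
      nlinarith [mul_nonneg hM0 hM0])
    (fun x => by
      rw [gradient_sq hρ, norm_smul, Real.norm_of_nonneg (by have := hρ0 x; positivity)]
      have : 2 * ρ x * ‖gradient ρ x‖ ≤ 2 * M * M := by
        have := hM x; have := hM' x; have := hρ0 x; gcongr
      nlinarith [sq_nonneg M])
  have hid := hv p
  rw [form_layered] at hid
  have hbd : ∀ x, ρ x ^ 2 ≤ M ^ 2 := fun x => pow_le_pow_left₀ (hρ0 x) (hM x) 2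
  have hmeas2 : AEStronglyMeasurable (fun x => ρ x ^ 2) (volume : Measure E3) :=
    (hρ.continuous.pow 2).aestronglyMeasurable
  have hbd' : ∀ x, ‖ρ x ^ 2‖ ≤ M ^ 2 := fun x => by
    rw [Real.norm_of_nonneg (by positivity)]; exact hbd x
  have ham : AEStronglyMeasurable a (volume : Measure E3) :=
    (measurable_layeredScalar γp γm).aestronglyMeasurable
  have hab : ∀ x, ‖a x‖ ≤ max γp γm := fun x => by
    rw [Real.norm_of_nonneg (layeredScalar_pos hp hm x).le]; exact layeredScalar_le_max _ _ x
  have i1 : Integrable (fun x => a x * inner ℝ (grad v x) (grad p x)) (volume : Measure E3) :=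
    (L2.integrable_inner (𝕜 := ℝ) (grad v) (grad p)).bdd_mul ham (ae_of_all _ hab)
  have i2 : Integrable (fun x => toL2 v x * toL2 p x) (volume : Measure E3) :=
    (Lp.memLp (toL2 v)).integrable_mul (Lp.memLp (toL2 p))
  have i3 : Integrable (fun x => f x * toL2 p x) (volume : Measure E3) :=
    (Lp.memLp f).integrable_mul (Lp.memLp (toL2 p))
  have hlow : (1 - κ) * min γp γm * d * energyOn D v
      ≤ ∫ x, (a x * inner ℝ (grad v x) (grad p x) + τ ^ 2 * (toL2 v x * toL2 p x)) := by
    rw [energyOn, ← integral_indicator hD, ← integral_const_mul]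
    refine integral_mono_ae (((integrable_norm_sq (grad v)).indicator hD).const_mul _)
      (i1.add (i2.const_mul _)) ?_
    filter_upwards [hp1, hp2] with x h1 h2
    rw [h1, h2, gradient_sq hρ]
    have hax := layeredScalar_pos hp hm x
    have hc := cross_term_ge (a := a x) (t := toL2 v x) (G := grad v x) hax hκ (hρ0 x) (hgrad x)
    simp only [inner_add_right, inner_smul_right, real_inner_self_eq_norm_sq]
    have e : a x * (ρ x ^ 2 * ‖grad v x‖ ^ 2
          + toL2 v x * (2 * ρ x * inner ℝ (grad v x) (gradient ρ x)))
          + τ ^ 2 * (toL2 v x * (ρ x ^ 2 * toL2 v x))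
        = (a x * ρ x ^ 2 * ‖grad v x‖ ^ 2 + τ ^ 2 * (ρ x ^ 2 * toL2 v x ^ 2))
          + a x * (2 * ρ x * toL2 v x * inner ℝ (grad v x) (gradient ρ x)) := by ring
    rw [e]
    have hκ' : 0 < 1 - κ := by linarith
    have hind : (1 - κ) * min γp γm * d * D.indicator (fun x => ‖grad v x‖ ^ 2) x
        ≤ (1 - κ) * (a x * ρ x ^ 2 * ‖grad v x‖ ^ 2) := by
      by_cases hx : x ∈ D
      · rw [indicator_of_mem hx]
        have h3 := hd x hx
        have h4 : min γp γm ≤ a x := min_le_layeredScalar γp γm x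
        have h5 : min γp γm * d ≤ a x * ρ x ^ 2 := by gcongr
        have h6 : 0 ≤ (1 - κ) * ‖grad v x‖ ^ 2 := by positivity
        nlinarith [mul_le_mul_of_nonneg_left h5 h6]
      · rw [indicator_of_notMem hx, mul_zero]
        positivity
    have hlast : 0 ≤ (1 - κ) * (τ ^ 2 * (ρ x ^ 2 * toL2 v x ^ 2)) := by positivity
    nlinarith [hind, hlast, hc]
  rw [integral_add i1 (i2.const_mul _), integral_const_mul, hid] at hlow
  refine hlow.trans ?_
  have i4 : Integrable (fun x => ‖f x‖ * ‖toL2 v x‖) (volume : Measure E3) :=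
    (Lp.memLp f).norm.integrable_mul (Lp.memLp (toL2 v)).norm
  -- The bound `b` dominates a square wherever `f ≠ 0`; it can be negative only when `f` vanishes,
  -- and then the claim is trivial.
  have hb0 : f = 0 ∨ 0 ≤ b := by
    by_cases hz : f = 0
    · exact Or.inl hz
    refine Or.inr ?_
    by_contra! hneg
    refine hz ((Lp.eq_zero_iff_ae_eq_zero).2 ?_)
    filter_upwards [hb] with x hx
    by_contra h0
    have := hx h0
    nlinarith [sq_nonneg (ρ x)]
  rcases hb0 with hz | hb0
  · have : ∫ x, f x * toL2 p x = 0 := by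
      rw [integral_mul_eq_inner, hz, inner_zero_left]
    rw [this, hz, norm_zero, zero_mul, mul_zero]
  · have h7 : ∫ x, f x * toL2 p x ≤ b * ∫ x, ‖f x‖ * ‖toL2 v x‖ := by
      rw [← integral_const_mul]
      refine integral_mono_ae i3 (i4.const_mul b) ?_
      filter_upwards [hp1, hb] with x h1 h2
      rw [h1]
      by_cases h0 : f x = 0
      · simp [h0]
      · calc f x * (ρ x ^ 2 * toL2 v x) = ρ x ^ 2 * (f x * toL2 v x) := by ring
          _ ≤ ρ x ^ 2 * (‖f x‖ * ‖toL2 v x‖) := by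
            rw [← norm_mul]
            exact mul_le_mul_of_nonneg_left (Real.le_norm_self _) (sq_nonneg _)
          _ ≤ b * (‖f x‖ * ‖toL2 v x‖) := mul_le_mul_of_nonneg_right (h2 h0) (by positivity)
    exact h7.trans (mul_le_mul_of_nonneg_left (integral_norm_mul_norm_le f (toL2 v)) hb0)

/-! ### Weights -/

/-- A bounded positive weight with logarithmic gradient at most `c` in the optical metric. -/
structure IsWeight (γp γm c : ℝ) (ρ : E3 → ℝ) : Prop where
  contDiff : ContDiff ℝ ∞ ρ
  lower : ∃ m, 0 < m ∧ ∀ x, m ≤ ρ x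
  upper : ∃ M, ∀ x, ρ x ≤ M
  grad_le : ∀ x, √(layeredScalar γp γm x) * ‖fderiv ℝ ρ x‖ ≤ c * ρ x

lemma IsWeight.pos {γp γm c : ℝ} {ρ : E3 → ℝ} (h : IsWeight γp γm c ρ) (x : E3) : 0 < ρ x :=
  let ⟨_, hm, h'⟩ := h.lower
  hm.trans_le (h' x)

/-- The gradient inequality is homogeneous and subadditive in the weight, so the logarithmic bound
survives sums. Sums of exponentials thus act as smooth maxima. -/
lemma IsWeight.add {γp γm c : ℝ} {ρ σ : E3 → ℝ} (hρ : IsWeight γp γm c ρ)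
    (hσ : IsWeight γp γm c σ) : IsWeight γp γm c (ρ + σ) where
  contDiff := hρ.contDiff.add hσ.contDiff
  lower := by
    obtain ⟨m, hm, h⟩ := hρ.lower
    exact ⟨m, hm, fun x => (h x).trans (le_add_of_nonneg_right (hσ.pos x).le)⟩
  upper := by
    obtain ⟨M, h⟩ := hρ.upper
    obtain ⟨M', h'⟩ := hσ.upper
    exact ⟨M + M', fun x => add_le_add (h x) (h' x)⟩
  grad_le x := by
    rw [fderiv_add (contDiff_differentiableAt hρ.contDiff x)
      (contDiff_differentiableAt hσ.contDiff x), Pi.add_apply]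
    calc _ ≤ √(layeredScalar γp γm x) * (‖fderiv ℝ ρ x‖ + ‖fderiv ℝ σ x‖) := by
          gcongr; exact norm_add_le _ _
      _ ≤ _ := by rw [mul_add, mul_add]; exact add_le_add (hρ.grad_le x) (hσ.grad_le x)

/-- Inversion changes only the sign of the logarithmic gradient. It turns smooth maxima into smooth
minima. -/
lemma IsWeight.inv {γp γm c : ℝ} {ρ : E3 → ℝ} (hρ : IsWeight γp γm c ρ) :
    IsWeight γp γm c (fun x => (ρ x)⁻¹) where
  contDiff := hρ.contDiff.inv fun x => (hρ.pos x).ne'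
  lower := by
    obtain ⟨M, h⟩ := hρ.upper
    exact ⟨M⁻¹, inv_pos.2 ((hρ.pos 0).trans_le (h 0)), fun x => inv_anti₀ (hρ.pos x) (h x)⟩
  upper := by
    obtain ⟨m, hm, h⟩ := hρ.lower
    exact ⟨m⁻¹, fun x => inv_anti₀ hm (h x)⟩
  grad_le x := by
    have h0 := hρ.pos x
    have hd := (contDiff_differentiableAt hρ.contDiff x).hasFDerivAt
    have h1 := ((hasDerivAt_inv h0.ne').comp_hasFDerivAt x hd).fderiv
    have h2 : (Inv.inv ∘ ρ) = fun x => (ρ x)⁻¹ := rfl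
    rw [h2] at h1
    rw [h1, norm_smul, norm_neg, norm_inv, Real.norm_of_nonneg (by positivity)]
    calc _ = (ρ x ^ 2)⁻¹ * (√(layeredScalar γp γm x) * ‖fderiv ℝ ρ x‖) := by ring
      _ ≤ (ρ x ^ 2)⁻¹ * (c * ρ x) :=
          mul_le_mul_of_nonneg_left (hρ.grad_le x) (by positivity)
      _ = c * (ρ x)⁻¹ := by field_simp

/-- A bounded smooth function that is `1`-Lipschitz in the optical metric. -/
structure IsPhase (γp γm : ℝ) (d : E3 → ℝ) : Prop where
  contDiff : ContDiff ℝ ∞ d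
  bound : ∃ M, ∀ x, |d x| ≤ M
  grad_le : ∀ x, √(layeredScalar γp γm x) * ‖fderiv ℝ d x‖ ≤ 1

lemma IsPhase.isWeight {γp γm c : ℝ} (hc : 0 ≤ c) {d : E3 → ℝ} (hd : IsPhase γp γm d) :
    IsWeight γp γm c (fun x => Real.exp (-(c * d x))) where
  contDiff := (contDiff_const.mul hd.contDiff).neg.exp
  lower := by
    obtain ⟨M, h⟩ := hd.bound
    refine ⟨Real.exp (-(c * M)), Real.exp_pos _, fun x => Real.exp_le_exp.2 ?_⟩
    linarith [mul_le_mul_of_nonneg_left ((le_abs_self _).trans (h x)) hc]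
  upper := by
    obtain ⟨M, h⟩ := hd.bound
    refine ⟨Real.exp (c * M), fun x => Real.exp_le_exp.2 ?_⟩
    linarith [mul_le_mul_of_nonneg_left (neg_le.1 ((neg_le_abs _).trans (h x)) ) hc]
  grad_le x := by
    have hx := (contDiff_differentiableAt hd.contDiff x).hasFDerivAt
    have h1 := ((hx.const_mul c).fun_neg.exp).fderiv
    rw [h1, norm_smul, norm_neg, norm_smul, Real.norm_of_nonneg (Real.exp_pos _).le,
      Real.norm_of_nonneg hc]
    have := mul_le_mul_of_nonneg_left (hd.grad_le x)
      (mul_nonneg hc (Real.exp_pos (-(c * d x))).le)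
    linarith

lemma IsPhase.sub_le {γp γm : ℝ} (hp : 0 < γp) (hm : 0 < γm) {d : E3 → ℝ}
    (hd : IsPhase γp γm d) (x y : E3) : |d x - d y| ≤ 1 / √(min γp γm) * dist x y := by
  have hmin : 0 < √(min γp γm) := Real.sqrt_pos.2 (lt_min hp hm)
  have := Convex.norm_image_sub_le_of_norm_fderiv_le (𝕜 := ℝ) (s := univ) (f := d)
    (C := 1 / √(min γp γm)) (fun z _ => contDiff_differentiableAt hd.contDiff z)
    (fun z _ => by
      rw [le_div_iff₀ hmin, mul_comm]
      refine le_trans ?_ (hd.grad_le z)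
      gcongr
      exact min_le_layeredScalar γp γm z) convex_univ (mem_univ y) (mem_univ x)
  rwa [Real.norm_eq_abs, ← dist_eq_norm] at this

/-- The linear ray phases are unbounded, whereas admissible weights are bounded. The rescaled
arctangent truncates them and, having derivative at most `1`, keeps the gradient bound. -/
lemma IsPhase.arctan {γp γm : ℝ} {d : E3 → ℝ} (hd : ContDiff ℝ ∞ d)
    (hg : ∀ x, √(layeredScalar γp γm x) * ‖fderiv ℝ d x‖ ≤ 1) {s : ℝ} (hs : 0 < s) :
    IsPhase γp γm (fun x => Real.arctan (d x * s) / s) where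
  contDiff := (Real.contDiff_arctan.comp (hd.mul contDiff_const)).div_const s
  bound := by
    refine ⟨Real.pi / 2 / s, fun x => ?_⟩
    rw [abs_div, abs_of_pos hs]
    gcongr
    exact abs_le.2 ⟨(Real.neg_pi_div_two_lt_arctan _).le, (Real.arctan_lt_pi_div_two _).le⟩
  grad_le x := by
    have hx := (contDiff_differentiableAt hd x).hasFDerivAt
    have h1 := (((hx.mul_const s).arctan).mul_const s⁻¹).fderiv
    simp only [← div_eq_mul_inv] at h1
    rw [h1]
    refine le_trans ?_ (hg x)
    gcongr
    rw [norm_smul, norm_smul, norm_smul, ← mul_assoc, ← mul_assoc]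
    refine mul_le_of_le_one_left (norm_nonneg _) ?_
    rw [Real.norm_of_nonneg (by positivity), Real.norm_of_nonneg (by positivity),
      Real.norm_of_nonneg hs.le]
    have : 1 ≤ 1 + (d x * s) ^ 2 := by nlinarith [sq_nonneg (d x * s)]
    calc s⁻¹ * (1 / (1 + (d x * s) ^ 2)) * s = 1 / (1 + (d x * s) ^ 2) := by field_simp
      _ ≤ 1 := by rw [div_le_one (by positivity)]; exact this

/-! ### Phases of broken rays -/

lemma hasDerivAt_scaled_ramp {δ : ℝ} (hδ : 0 < δ) (t : ℝ) :
    HasDerivAt (fun t => δ * ramp (t / δ)) (Real.smoothTransition (t / δ)) t := by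
  have h := ((hasDerivAt_ramp (t / δ)).comp t ((hasDerivAt_id t).div_const δ)).const_mul δ
  refine h.congr_deriv ?_
  field_simp

lemma sub_le_scaled_ramp {δ : ℝ} (hδ : 0 < δ) (t : ℝ) : t - δ ≤ δ * ramp (t / δ) := by
  have h := mul_le_mul_of_nonneg_left (sub_one_le_ramp (t / δ)) hδ.le
  rwa [mul_sub, mul_div_cancel₀ _ hδ.ne', mul_one] at h

lemma contDiff_scaled_ramp (δ : ℝ) : ContDiff ℝ ∞ (fun t => δ * ramp (t / δ)) :=
  contDiff_const.mul (contDiff_ramp.comp (contDiff_id.div_const δ))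

/-- A smooth replacement of the function with slopes `q₊` on `t > 0` and `q₋` on `t < 0`. -/
lemma exists_smooth_broken_line {qp qm ε : ℝ} (hqp : 0 ≤ qp) (hqm : 0 ≤ qm) (hε : 0 < ε) :
    ∃ S S' : ℝ → ℝ, ContDiff ℝ ∞ S ∧ (∀ t, HasDerivAt S (S' t) t) ∧ (∀ t, 0 ≤ S' t) ∧
      (∀ t, 0 < t → S' t ≤ qp) ∧ (∀ t, t ≤ 0 → S' t ≤ qm) ∧ (∀ t, 0 < t → qp * t - ε ≤ S t) ∧
      ∀ t, t < 0 → S t ≤ qm * t + ε := by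
  have hσ0 := Real.smoothTransition.nonneg
  have hσ1 := Real.smoothTransition.le_one
  rcases le_total qp qm with hle | hle
  · obtain ⟨k, hk⟩ : ∃ k, k = qm - qp := ⟨_, rfl⟩
    have hk0 : 0 ≤ k := by linarith
    obtain ⟨δ, hδd⟩ : ∃ δ, δ = ε / (k + 1) := ⟨_, rfl⟩
    have hδ : 0 < δ := by rw [hδd]; positivity
    have hkδ : k * δ ≤ ε := by
      have : δ * (k + 1) = ε := by rw [hδd]; field_simp
      linarith
    refine ⟨fun t => qp * t - k * (δ * ramp (-t / δ)),
      fun t => qp + k * Real.smoothTransition (-t / δ), ?_, fun t => ?_, fun t => ?_,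
      fun t ht => ?_, fun t _ => ?_, fun t ht => ?_, fun t ht => ?_⟩
    · exact (contDiff_const.mul contDiff_id).sub
        (contDiff_const.mul ((contDiff_scaled_ramp δ).comp contDiff_neg))
    · have h1 := (hasDerivAt_scaled_ramp hδ (-t)).comp t (hasDerivAt_neg t)
      have h2 := ((hasDerivAt_id t).const_mul qp).sub (h1.const_mul k)
      refine h2.congr_deriv ?_
      ring
    · have := hσ0 (-t / δ); positivity
    · simp only [Real.smoothTransition.zero_of_nonpos
        (div_nonpos_of_nonpos_of_nonneg (by linarith : -t ≤ 0) hδ.le)]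
      linarith
    · have := mul_le_mul_of_nonneg_left (hσ1 (-t / δ)) hk0
      linarith
    · simp only [ramp_of_nonpos (div_nonpos_of_nonpos_of_nonneg (by linarith : -t ≤ 0) hδ.le)]
      linarith
    · have := mul_le_mul_of_nonneg_left (sub_le_scaled_ramp hδ (-t)) hk0
      have e : k * t = qm * t - qp * t := by rw [hk]; ring
      simp only
      linarith
  · obtain ⟨k, hk⟩ : ∃ k, k = qp - qm := ⟨_, rfl⟩
    have hk0 : 0 ≤ k := by linarith
    obtain ⟨δ, hδd⟩ : ∃ δ, δ = ε / (k + 1) := ⟨_, rfl⟩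
    have hδ : 0 < δ := by rw [hδd]; positivity
    have hkδ : k * δ ≤ ε := by
      have : δ * (k + 1) = ε := by rw [hδd]; field_simp
      linarith
    refine ⟨fun t => qm * t + k * (δ * ramp (t / δ)),
      fun t => qm + k * Real.smoothTransition (t / δ), ?_, fun t => ?_, fun t => ?_,
      fun t _ => ?_, fun t ht => ?_, fun t ht => ?_, fun t ht => ?_⟩
    · exact (contDiff_const.mul contDiff_id).add (contDiff_const.mul (contDiff_scaled_ramp δ))
    · have h2 := ((hasDerivAt_id t).const_mul qm).add ((hasDerivAt_scaled_ramp hδ t).const_mul k)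
      refine h2.congr_deriv ?_
      ring
    · have := hσ0 (t / δ); positivity
    · have := mul_le_mul_of_nonneg_left (hσ1 (t / δ)) hk0
      linarith
    · simp only [Real.smoothTransition.zero_of_nonpos (div_nonpos_of_nonpos_of_nonneg ht hδ.le)]
      linarith
    · have := mul_le_mul_of_nonneg_left (sub_le_scaled_ramp hδ t) hk0
      have e : k * t = qp * t - qm * t := by rw [hk]; ring
      simp only
      linarith
    · simp only [ramp_of_nonpos (div_nonpos_of_nonpos_of_nonneg ht.le hδ.le)]
      linarith

/-- Snell's law: some broken path has equal horizontal slownesses on both sides. -/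
lemma exists_snell {A B H cp cm : ℝ} (hA : 0 < A) (hB : 0 < B) (hH : 0 ≤ H) (hcp : 0 < cp)
    (hcm : 0 < cm) : ∃ s ∈ Icc (0 : ℝ) 1,
      s * cm / √(s ^ 2 * H + A ^ 2) = (1 - s) * cp / √((1 - s) ^ 2 * H + B ^ 2) := by
  have hpos : ∀ s : ℝ, ∀ K : ℝ, 0 < K → √(s ^ 2 * H + K ^ 2) ≠ 0 := fun s K hK =>
    (Real.sqrt_pos.2 (by positivity)).ne'
  have hcont : Continuous fun s : ℝ => s * cm / √(s ^ 2 * H + A ^ 2)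
      - (1 - s) * cp / √((1 - s) ^ 2 * H + B ^ 2) := by
    refine Continuous.sub (Continuous.div (by fun_prop) (by fun_prop) fun s => hpos s A hA)
      (Continuous.div (by fun_prop) (by fun_prop) fun s => hpos (1 - s) B hB)
  -- The difference of horizontal slownesses is nonpositive when the refraction point is above `x`
  -- and nonnegative when it is below `y`.
  obtain ⟨s, hs, h⟩ := intermediate_value_Icc zero_le_one hcont.continuousOn
    (show (0 : ℝ) ∈ Icc _ _ by
      constructor
      · simp only [zero_mul, zero_div, zero_sub, sub_zero, one_mul]
        rw [neg_nonpos]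
        positivity
      · simp only [sub_self, zero_mul, zero_div, sub_zero, one_mul]
        positivity)
  exact ⟨s, hs, sub_eq_zero.1 h⟩

lemma hasFDerivAt_rayPhase {S : ℝ → ℝ} {S' : ℝ} (k₀ k₁ c : ℝ) (ξ : E3)
    (hS : HasDerivAt S S' (ξ 2)) :
    HasFDerivAt (fun ξ : E3 => c - (k₀ * ξ 0 + k₁ * ξ 1 + S (ξ 2)))
      (-(innerSL ℝ (!₂[k₀, k₁, S'] : E3))) ξ := by
  have hc : ∀ i : Fin 3, HasFDerivAt (fun ξ : E3 => ξ i) (EuclideanSpace.proj i : E3 →L[ℝ] ℝ) ξ :=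
    fun i => (EuclideanSpace.proj i : E3 →L[ℝ] ℝ).hasFDerivAt
  have h := ((((hc 0).const_mul k₀).add ((hc 1).const_mul k₁)).add
    (hS.comp_hasFDerivAt ξ (hc 2))).const_sub c
  refine h.congr_fderiv ?_
  ext w
  simp [PiLp.inner_apply, Fin.sum_univ_three]
  ring

lemma norm_sq_vec3 (a b c : ℝ) : ‖(!₂[a, b, c] : E3)‖ ^ 2 = a ^ 2 + b ^ 2 + c ^ 2 := by
  rw [EuclideanSpace.real_norm_sq_eq, Fin.sum_univ_three]
  simp

lemma norm_vec3_sub (a b c : ℝ) (x : E3) :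
    ‖(!₂[a, b, c] : E3) - x‖ = √((a - x 0) ^ 2 + (b - x 1) ^ 2 + (c - x 2) ^ 2) := by
  rw [EuclideanSpace.norm_eq, Fin.sum_univ_three]
  simp

/-- Length of one leg of the broken path in terms of its slowness components. -/
lemma leg_eq {s c K H l : ℝ} (hl : 0 < l) (hl2 : l ^ 2 = s ^ 2 * H + K ^ 2) :
    c * l = s * c / l * (s * H) + c * K / l * K := by
  field_simp
  rw [hl2]

/-- This is the eikonal equation for a linear phase: its slowness vector has the length prescribed
by the medium. -/
lemma slowness_sq {s c K H l : ℝ} (hl : 0 < l) (hl2 : l ^ 2 = s ^ 2 * H + K ^ 2) :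
    (s * c / l) ^ 2 * H + (c * K / l) ^ 2 = c ^ 2 := by
  have : (s * c / l) ^ 2 * H + (c * K / l) ^ 2 = c ^ 2 * (s ^ 2 * H + K ^ 2) / l ^ 2 := by
    field_simp
  rw [this, ← hl2]
  field_simp

/-- On each side take the linear phase whose gradient is the slowness vector of the refracted ray.
Snell's law equates the horizontal components, so the two match on the plane and only a bend in the
vertical variable has to be smoothed. Along the ray the phase changes by the travel time, because
the gradient is parallel to each leg. -/
lemma exists_rayPhase {γp γm : ℝ} (hp : 0 < γp) (hm : 0 < γm) {x y : E3} (hx : x 2 < 0)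
    (hy : 0 < y 2) {ε : ℝ} (hε : 0 < ε) :
    ∃ d : E3 → ℝ, ContDiff ℝ ∞ d ∧
      (∀ ξ, √(layeredScalar γp γm ξ) * ‖fderiv ℝ d ξ‖ ≤ 1) ∧ d y = 0 ∧
      ∃ z, pathLength γp γm x y z ≤ d x + ε := by
  obtain ⟨H, hH⟩ : ∃ H, H = (y 0 - x 0) ^ 2 + (y 1 - x 1) ^ 2 := ⟨_, rfl⟩
  have hH0 : 0 ≤ H := by rw [hH]; positivity
  have hcp : 0 < 1 / √γp := by positivity
  have hcm : 0 < 1 / √γm := by positivity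
  obtain ⟨s, -, hs⟩ := exists_snell (neg_pos.2 hx) hy hH0 hcp hcm
  obtain ⟨l₁, hl₁⟩ : ∃ l, l = √(s ^ 2 * H + (-x 2) ^ 2) := ⟨_, rfl⟩
  obtain ⟨l₂, hl₂⟩ : ∃ l, l = √((1 - s) ^ 2 * H + y 2 ^ 2) := ⟨_, rfl⟩
  rw [← hl₁, ← hl₂] at hs
  have hl₁0 : 0 < l₁ := by
    rw [hl₁]; exact Real.sqrt_pos.2 (by have := neg_pos.2 hx; positivity)
  have hl₂0 : 0 < l₂ := by rw [hl₂]; exact Real.sqrt_pos.2 (by positivity)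
  have hl₁2 : l₁ ^ 2 = s ^ 2 * H + (-x 2) ^ 2 := by rw [hl₁]; exact Real.sq_sqrt (by positivity)
  have hl₂2 : l₂ ^ 2 = (1 - s) ^ 2 * H + y 2 ^ 2 := by rw [hl₂]; exact Real.sq_sqrt (by positivity)
  -- Multiplied by the horizontal displacement `y - x`, this is the common horizontal slowness; `qm`
  -- and `qp` are the vertical ones.
  obtain ⟨k, hk⟩ : ∃ k, k = s * (1 / √γm) / l₁ := ⟨_, rfl⟩
  obtain ⟨qm, hqm⟩ : ∃ q, q = 1 / √γm * (-x 2) / l₁ := ⟨_, rfl⟩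
  obtain ⟨qp, hqp⟩ : ∃ q, q = 1 / √γp * y 2 / l₂ := ⟨_, rfl⟩
  have hqm0 : 0 ≤ qm := by rw [hqm]; have := neg_pos.2 hx; positivity
  have hqp0 : 0 ≤ qp := by rw [hqp]; positivity
  have e₁ := leg_eq (c := 1 / √γm) hl₁0 hl₁2
  have e₂ := leg_eq (c := 1 / √γp) hl₂0 hl₂2
  have n₁ := slowness_sq (c := 1 / √γm) hl₁0 hl₁2
  have n₂ := slowness_sq (c := 1 / √γp) hl₂0 hl₂2
  rw [← hs] at e₂ n₂
  rw [← hk, ← hqm] at e₁ n₁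
  rw [← hk, ← hqp] at e₂ n₂
  rw [div_pow, one_pow, Real.sq_sqrt hm.le] at n₁
  rw [div_pow, one_pow, Real.sq_sqrt hp.le] at n₂
  obtain ⟨S, S', hS, hSd, hS0, hSp, hSm, hSp', hSm'⟩ :=
    exists_smooth_broken_line hqp0 hqm0 (half_pos hε)
  have hd := fun ξ : E3 => hasFDerivAt_rayPhase (k * (y 0 - x 0)) (k * (y 1 - x 1))
    (k * (y 0 - x 0) * y 0 + k * (y 1 - x 1) * y 1 + S (y 2)) ξ (hSd (ξ 2))
  refine ⟨fun ξ : E3 => k * (y 0 - x 0) * y 0 + k * (y 1 - x 1) * y 1 + S (y 2)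
      - (k * (y 0 - x 0) * ξ 0 + k * (y 1 - x 1) * ξ 1 + S (ξ 2)), ?_, fun ξ => ?_, ?_,
    !₂[x 0 + s * (y 0 - x 0), x 1 + s * (y 1 - x 1)], ?_⟩
  · have hc : ∀ i : Fin 3, ContDiff ℝ ∞ (fun ξ : E3 => ξ i) := fun i =>
      (EuclideanSpace.proj i : E3 →L[ℝ] ℝ).contDiff
    exact contDiff_const.sub (((contDiff_const.mul (hc 0)).add (contDiff_const.mul (hc 1))).add
      (hS.comp (hc 2)))
  · rw [(hd ξ).fderiv, norm_neg, innerSL_apply_norm]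
    have ha := layeredScalar_pos hp hm ξ
    refine (sq_le_one_iff₀ (by positivity)).1 ?_
    rw [mul_pow, Real.sq_sqrt ha.le, norm_sq_vec3]
    have e : (k * (y 0 - x 0)) ^ 2 + (k * (y 1 - x 1)) ^ 2 = k ^ 2 * H := by rw [hH]; ring
    rw [e]
    by_cases h : 0 < ξ 2
    · rw [layeredScalar_of_pos h]
      have h1 := pow_le_pow_left₀ (hS0 (ξ 2)) (hSp _ h) 2
      calc γp * (k ^ 2 * H + S' (ξ 2) ^ 2) ≤ γp * (1 / γp) := by gcongr; linarith
        _ = 1 := by field_simp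
    · rw [layeredScalar_of_nonpos (not_lt.1 h)]
      have h1 := pow_le_pow_left₀ (hS0 (ξ 2)) (hSm _ (not_lt.1 h)) 2
      calc γm * (k ^ 2 * H + S' (ξ 2) ^ 2) ≤ γm * (1 / γm) := by gcongr; linarith
        _ = 1 := by field_simp
  · simp only [sub_self]
  · have hP : pathLength γp γm x y !₂[x 0 + s * (y 0 - x 0), x 1 + s * (y 1 - x 1)]
        = 1 / √γm * l₁ + 1 / √γp * l₂ := by
      rw [pathLength, norm_vec3_sub, norm_vec3_sub, hl₁, hl₂]
      simp only [Matrix.cons_val_zero, Matrix.cons_val_one]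
      congr 3 <;> rw [hH] <;> ring_nf
    rw [hP, e₁, e₂]
    have h1 := hSp' (y 2) hy
    have h2 := hSm' (x 2) hx
    have e : k * (y 0 - x 0) * y 0 + k * (y 1 - x 1) * y 1
        - (k * (y 0 - x 0) * x 0 + k * (y 1 - x 1) * x 1) = k * (s * H) + k * ((1 - s) * H) := by
      rw [hH]; ring
    simp only
    linarith

/-- As `s → 0⁺` the truncation `arctan(s d)/s` tends to `d`, so some small `s` loses at most `ε/2`
at `x` and preserves the zero at `y`. -/
lemma exists_phase {γp γm : ℝ} (hp : 0 < γp) (hm : 0 < γm) {x y : E3} (hx : x 2 < 0)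
    (hy : 0 < y 2) {ε : ℝ} (hε : 0 < ε) :
    ∃ d : E3 → ℝ, IsPhase γp γm d ∧ d y = 0 ∧ ∃ z, pathLength γp γm x y z ≤ d x + ε := by
  obtain ⟨d, hd, hg, hdy, z, hz⟩ := exists_rayPhase hp hm hx hy (half_pos hε)
  have h1 : HasDerivAt (fun s : ℝ => Real.arctan (d x * s)) (d x) 0 := by
    have := ((hasDerivAt_id (0 : ℝ)).const_mul (d x)).arctan
    simpa using this
  have h2 := h1.tendsto_slope_zero_right
  have h3 : ∀ᶠ s in 𝓝[>] (0 : ℝ), d x - ε / 2 < Real.arctan (d x * s) / s := by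
    filter_upwards [h2.eventually_const_lt (show d x - ε / 2 < d x by linarith)] with s hs
    simpa [div_eq_inv_mul] using hs
  obtain ⟨s, hs, hs0⟩ := (h3.and self_mem_nhdsWithin).exists
  refine ⟨_, IsPhase.arctan hd hg hs0, by simp [hdy], z, ?_⟩
  linarith

/-! ### The upper bound for the energy -/

lemma exists_finset_net {D : Set E3} (hD : Bornology.IsBounded D) (hne : D.Nonempty) {δ : ℝ}
    (hδ : 0 < δ) : ∃ t : Finset E3, t.Nonempty ∧ ↑t ⊆ D ∧ ∀ x ∈ D, ∃ i ∈ t, dist x i < δ := by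
  obtain ⟨t, htD, htf, hcov⟩ := totallyBounded_iff_subset.1
    (hD.isCompact_closure.totallyBounded.subset subset_closure) _ (Metric.dist_mem_uniformity hδ)
  have h : ∀ x ∈ D, ∃ i ∈ t, dist x i < δ := fun x hx => by
    obtain ⟨i, hi, hxi⟩ := mem_iUnion₂.1 (hcov hx)
    exact ⟨i, hi, hxi⟩
  obtain ⟨x, hx⟩ := hne
  obtain ⟨i, hi, -⟩ := h x hx
  exact ⟨htf.toFinset, ⟨i, htf.mem_toFinset.2 hi⟩, by simpa using htD, fun x hx => by
    simpa using h x hx⟩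

/-- The weight attached to a finite family of phases `d i j`. -/
def netWeight (s t : Finset E3) (d : E3 → E3 → E3 → ℝ) (c : ℝ) : E3 → ℝ :=
  ∑ i ∈ s, fun x => ((∑ j ∈ t, fun x => Real.exp (-(c * d i j x))) x)⁻¹

lemma isWeight_netWeight {γp γm c : ℝ} (hc : 0 ≤ c) {s t : Finset E3} (hs : s.Nonempty)
    (ht : t.Nonempty) {d : E3 → E3 → E3 → ℝ}
    (hd : ∀ i ∈ s, ∀ j ∈ t, IsPhase γp γm (d i j)) : IsWeight γp γm c (netWeight s t d c) := by
  refine Finset.sum_induction_nonempty _ _ (fun _ _ => IsWeight.add) hs fun i hi => ?_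
  refine IsWeight.inv ?_
  exact Finset.sum_induction_nonempty _ _ (fun _ _ => IsWeight.add) ht fun j hj =>
    (hd i hi j hj).isWeight hc

lemma netWeight_apply (s t : Finset E3) (d : E3 → E3 → E3 → ℝ) (c : ℝ) (x : E3) :
    netWeight s t d c x = ∑ i ∈ s, (∑ j ∈ t, Real.exp (-(c * d i j x)))⁻¹ := by
  simp only [netWeight, Finset.sum_apply]

/-- Up to cardinalities, `netWeight` is `max_i min_j e^{c d i j}`. Near a net point `j` of `B` the
minimum is small whatever `i` is; near a net point `i` of `D` the maximum may select that `i`, whose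
phases are large for all `j`. -/
lemma netWeight_le {s t : Finset E3} {d : E3 → E3 → E3 → ℝ} {c ε : ℝ} (hc : 0 ≤ c) {x j : E3}
    (hj : j ∈ t) (h : ∀ i ∈ s, d i j x ≤ ε) : netWeight s t d c x ≤ s.card * Real.exp (c * ε) := by
  rw [netWeight_apply, ← nsmul_eq_mul]
  refine Finset.sum_le_card_nsmul _ _ _ fun i hi => ?_
  have h1 : Real.exp (-(c * ε)) ≤ ∑ j ∈ t, Real.exp (-(c * d i j x)) := by
    refine le_trans ?_ (Finset.single_le_sum
      (f := fun j => Real.exp (-(c * d i j x))) (fun j _ => (Real.exp_pos _).le) hj)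
    exact Real.exp_le_exp.2 (by linarith [mul_le_mul_of_nonneg_left (h i hi) hc])
  calc _ ≤ (Real.exp (-(c * ε)))⁻¹ := inv_anti₀ (Real.exp_pos _) h1
    _ = Real.exp (c * ε) := by rw [← Real.exp_neg, neg_neg]

lemma le_netWeight {s t : Finset E3} (ht : t.Nonempty) {d : E3 → E3 → E3 → ℝ} {c l : ℝ}
    (hc : 0 ≤ c) {x i : E3} (hi : i ∈ s) (h : ∀ j ∈ t, l ≤ d i j x) :
    Real.exp (c * l) / t.card ≤ netWeight s t d c x := by
  have hpos : ∀ i, 0 < ∑ j ∈ t, Real.exp (-(c * d i j x)) := fun i =>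
    Finset.sum_pos (fun j _ => Real.exp_pos _) ht
  rw [netWeight_apply]
  refine le_trans ?_ (Finset.single_le_sum
    (f := fun i => (∑ j ∈ t, Real.exp (-(c * d i j x)))⁻¹) (fun i _ => (inv_pos.2 (hpos i)).le) hi)
  have h1 : ∑ j ∈ t, Real.exp (-(c * d i j x)) ≤ t.card * Real.exp (-(c * l)) := by
    rw [← nsmul_eq_mul]
    refine Finset.sum_le_card_nsmul _ _ _ fun j hj => Real.exp_le_exp.2 ?_
    linarith [mul_le_mul_of_nonneg_left (h j hj) hc]
  calc Real.exp (c * l) / t.card = (t.card * Real.exp (-(c * l)))⁻¹ := by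
        rw [mul_inv, Real.exp_neg, inv_inv, div_eq_inv_mul]
    _ ≤ _ := inv_anti₀ (hpos i) h1

lemma IsWeight.energyOn_le {γp γm : ℝ} (hp : 0 < γp) (hm : 0 < γm) {τ κ : ℝ} (hτ : 0 ≤ τ)
    (hκ : 0 ≤ κ) (hκ1 : κ < 1) {f : L2} {v : H1}
    (hv : IsResolventSolution (layered γp γm) τ f v) {ρ : E3 → ℝ}
    (hρ : IsWeight γp γm (κ * τ) ρ) {D B : Set E3} (hD : MeasurableSet D)
    (hf : ∀ᵐ x : E3, x ∉ B → f x = 0) {d b : ℝ} (hd0 : 0 ≤ d) (hd : ∀ x ∈ D, d ≤ ρ x)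
    (hb : ∀ x ∈ B, ρ x ≤ b) :
    (1 - κ) * min γp γm * d ^ 2 * energyOn D v ≤ b ^ 2 * (‖f‖ * ‖toL2 v‖) := by
  obtain ⟨M, hM⟩ := hρ.upper
  have hmin : 0 < √(min γp γm) := Real.sqrt_pos.2 (lt_min hp hm)
  have hg : ∀ x, ‖gradient ρ x‖ ≤ κ * τ * M / √(min γp γm) := fun x => by
    rw [norm_gradient, le_div_iff₀ hmin, mul_comm]
    calc √(min γp γm) * ‖fderiv ℝ ρ x‖ ≤ √(layeredScalar γp γm x) * ‖fderiv ℝ ρ x‖ := by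
          gcongr; exact min_le_layeredScalar γp γm x
      _ ≤ κ * τ * ρ x := hρ.grad_le x
      _ ≤ κ * τ * M := mul_le_mul_of_nonneg_left (hM x) (by positivity)
  refine weighted_energy_le hp hm hκ hκ1 hv hρ.contDiff (fun x => (hρ.pos x).le)
    (M := max M (κ * τ * M / √(min γp γm))) (fun x => (hM x).trans (le_max_left _ _))
    (fun x => (hg x).trans (le_max_right _ _)) (fun x => by rw [norm_gradient]; exact hρ.grad_le x)
    hD (by positivity) (fun x hx => pow_le_pow_left₀ hd0 (hd x hx) 2) ?_
  filter_upwards [hf] with x hx h0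
  exact pow_le_pow_left₀ (hρ.pos x).le (hb x (by_contra fun h => h0 (hx h))) 2

lemma exists_phases {γp γm : ℝ} (hp : 0 < γp) (hm : 0 < γm) {D B : Set E3}
    (hDl : D ⊆ {x | x 2 < 0}) (hBu : B ⊆ {x | 0 < x 2}) {ε : ℝ} (hε : 0 < ε) :
    ∃ d : E3 → E3 → E3 → ℝ, ∀ i ∈ D, ∀ j ∈ B, IsPhase γp γm (d i j) ∧ d i j j = 0 ∧
      opticalSetDist γp γm D B ≤ d i j i + ε := by
  have h : ∀ i j : E3, ∃ d : E3 → ℝ, i ∈ D → j ∈ B → IsPhase γp γm d ∧ d j = 0 ∧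
      opticalSetDist γp γm D B ≤ d i + ε := by
    intro i j
    by_cases hij : i ∈ D ∧ j ∈ B
    · obtain ⟨d, h1, h2, z, h3⟩ := exists_phase hp hm (hDl hij.1) (hBu hij.2) hε
      exact ⟨d, fun hi hj => ⟨h1, h2, (opticalSetDist_le γp γm hi hj z).trans h3⟩⟩
    · exact ⟨0, fun hi hj => absurd ⟨hi, hj⟩ hij⟩
  choose d hd using h
  exact ⟨d, fun i hi j hj => hd i j hi hj⟩

/-- The nets are fixed before `τ`, so their cardinalities enter only the constant and only the
exponents depend on `τ`. The inequality `κ < 1` lets the Agmon estimate absorb the weight. -/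
lemma exists_energyOn_le_of_lt_one {γp γm : ℝ} (hp : 0 < γp) (hm : 0 < γm) {D B : Set E3}
    (hDm : MeasurableSet D) (hD : D.Nonempty) (hDb : Bornology.IsBounded D)
    (hDl : D ⊆ {x | x 2 < 0}) (hB : B.Nonempty) (hBb : Bornology.IsBounded B)
    (hBu : B ⊆ {x | 0 < x 2}) {f : L2} (hf : ∀ᵐ x : E3, x ∉ B → f x = 0) {κ ε : ℝ} (hκ : 0 ≤ κ)
    (hκ1 : κ < 1) (hε : 0 < ε) :
    ∃ C, 0 < C ∧ ∀ τ, 1 ≤ τ → ∀ v, IsResolventSolution (layered γp γm) τ f v →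
      energyOn D v ≤ C * Real.exp (-(2 * κ * (opticalSetDist γp γm D B - 3 * ε) * τ)) := by
  set L := opticalSetDist γp γm D B
  have hmin : 0 < √(min γp γm) := Real.sqrt_pos.2 (lt_min hp hm)
  have hmin' : 0 < min γp γm := lt_min hp hm
  -- Phases are Lipschitz with constant `1/√(min γ₊ γ₋)`, so at this mesh size each changes by at
  -- most `ε` between a point and its net point.
  have hδ : 0 < ε * √(min γp γm) := by positivity
  obtain ⟨s, hs, hsD, hsc⟩ := exists_finset_net hDb hD hδ
  obtain ⟨t, ht, htB, htc⟩ := exists_finset_net hBb hB hδ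
  obtain ⟨d, hd⟩ := exists_phases hp hm hDl hBu hε
  have hclose : ∀ i ∈ s, ∀ j ∈ t, ∀ x y, dist x y < ε * √(min γp γm) →
      |d i j x - d i j y| ≤ ε := fun i hi j hj x y hxy => by
    refine ((hd i (hsD hi) j (htB hj)).1.sub_le hp hm x y).trans ?_
    rw [one_div_mul_eq_div, div_le_iff₀ hmin]
    exact hxy.le
  obtain ⟨C, hC, hCv⟩ := exists_resolvent_bound (isCoefficient_layered hp hm) f
  have hsn : (0 : ℝ) < s.card := by exact_mod_cast hs.card_pos
  have htn : (0 : ℝ) < t.card := by exact_mod_cast ht.card_pos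
  have hκ' : 0 < 1 - κ := by linarith
  set K := (t.card : ℝ) ^ 2 * s.card ^ 2 * ((‖f‖ + 1) * C) / ((1 - κ) * min γp γm) with hK
  have hK0 : 0 < K := by positivity
  refine ⟨K, hK0, fun τ hτ v hv => ?_⟩
  have hc : 0 ≤ κ * τ := by positivity
  have hw : IsWeight γp γm (κ * τ) (netWeight s t d (κ * τ)) :=
    isWeight_netWeight hc hs ht fun i hi j hj => (hd i (hsD hi) j (htB hj)).1
  -- On `D` one `ε` is lost by the phase and one by the mesh; on `B` the phase vanishes at the net
  -- points and one `ε` is lost by the mesh. Together these are the `3ε` of the statement.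
  have hE := hw.energyOn_le hp hm (by linarith) hκ hκ1 hv hDm hf
    (d := Real.exp (κ * τ * (L - 2 * ε)) / t.card) (b := s.card * Real.exp (κ * τ * ε))
    (by positivity)
    (fun x hx => by
      obtain ⟨i, hi, hxi⟩ := hsc x hx
      refine le_netWeight ht hc hi fun j hj => ?_
      have h1 := (abs_le.1 (hclose i hi j hj x i hxi)).1
      have h2 := (hd i (hsD hi) j (htB hj)).2.2
      linarith)
    (fun x hx => by
      obtain ⟨j, hj, hxj⟩ := htc x hx
      refine netWeight_le hc hj fun i hi => ?_
      have h1 := (abs_le.1 (hclose i hi j hj x j hxj)).2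
      have h2 := (hd i (hsD hi) j (htB hj)).2.1
      linarith)
  have hvC : ‖toL2 v‖ ≤ C := by
    have h1 := (hCv τ hτ v hv).1
    have h2 : 1 ≤ τ ^ 2 := one_le_pow₀ hτ
    exact (le_mul_of_one_le_left (norm_nonneg _) h2).trans h1
  have hfv : ‖f‖ * ‖toL2 v‖ ≤ (‖f‖ + 1) * C := by
    gcongr
    linarith
  set X := Real.exp (κ * τ * (L - 2 * ε)) with hX
  set Y := Real.exp (κ * τ * ε) with hY
  have hX0 : 0 < X := Real.exp_pos _
  have hY0 : 0 < Y := Real.exp_pos _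
  have hZ : Real.exp (-(2 * κ * (L - 3 * ε) * τ)) = Y ^ 2 / X ^ 2 := by
    rw [hX, hY, ← Real.exp_nat_mul, ← Real.exp_nat_mul, ← Real.exp_sub]
    congr 1
    push_cast
    ring
  have hE' := hE.trans (mul_le_mul_of_nonneg_left hfv (by positivity))
  rw [hZ, hK, div_mul_div_comm, le_div_iff₀ (by positivity)]
  have h3 : (1 - κ) * min γp γm * (X / t.card) ^ 2 * energyOn D v * t.card ^ 2
      = energyOn D v * ((1 - κ) * min γp γm * X ^ 2) := by
    field_simp
  rw [← h3]
  calc _ ≤ (s.card * Y) ^ 2 * ((‖f‖ + 1) * C) * t.card ^ 2 := by gcongr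
    _ = _ := by ring

/-- The energy in `D` decays at least like `e^{-2 l(D,B) τ}`. -/
theorem exists_energyOn_le {γp γm : ℝ} (hp : 0 < γp) (hm : 0 < γm) {D B : Set E3}
    (hDm : MeasurableSet D) (hD : D.Nonempty) (hDb : Bornology.IsBounded D)
    (hDl : D ⊆ {x | x 2 < 0}) (hB : B.Nonempty) (hBb : Bornology.IsBounded B)
    (hBu : B ⊆ {x | 0 < x 2}) {f : L2} (hf : ∀ᵐ x : E3, x ∉ B → f x = 0) {v : ℝ → H1}
    (hv : ∀ τ, 1 ≤ τ → IsResolventSolution (layered γp γm) τ f (v τ)) {β : ℝ}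
    (hβ : β < 2 * opticalSetDist γp γm D B) :
    ∃ C, 0 < C ∧ ∀ τ, 1 ≤ τ → energyOn D (v τ) ≤ C * Real.exp (-(β * τ)) := by
  set L := opticalSetDist γp γm D B with hL
  -- One parameter `t` drives both `κ = 1 - t` and `ε = t`; the exponent tends to `2 l(D,B)` as `t →
  -- 0⁺`.
  have hlim : Tendsto (fun t : ℝ => 2 * (1 - t) * (L - 3 * t)) (𝓝[>] 0)
      (𝓝 (2 * (1 - 0) * (L - 3 * 0))) :=
    (Continuous.tendsto (by fun_prop) 0).mono_left nhdsWithin_le_nhds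
  obtain ⟨t, ht, ht0, ht1⟩ := ((hlim.eventually_const_lt (u := β) (by linarith)).and
    (Ioo_mem_nhdsGT (zero_lt_one' ℝ))).exists
  obtain ⟨C, hC, h⟩ := exists_energyOn_le_of_lt_one hp hm hDm hD hDb hDl hB hBb hBu hf
    (κ := 1 - t) (ε := t) (by linarith) (by linarith) ht0
  refine ⟨C, hC, fun τ hτ => (h τ hτ _ (hv τ hτ)).trans ?_⟩
  refine mul_le_mul_of_nonneg_left (Real.exp_le_exp.2 (neg_le_neg ?_)) hC.le
  exact mul_le_mul_of_nonneg_right ht.le (by linarith)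

/-! ### Asymptotics of the indicator function -/

lemma quad_layered_self_of_lower {γp γm : ℝ} {x : E3} (hx : x 2 < 0) (ξ : E3) :
    quad (layered γp γm x) ξ ξ = γm * ‖ξ‖ ^ 2 := by
  rw [quad_layered, layeredScalar_of_nonpos hx.le, real_inner_self_eq_norm_sq]

lemma indicatorFn_eq (T : ℝ) (f : L2) (u v : ℝ → H1) (τ : ℝ) :
    indicatorFn T f u v τ = inner ℝ f (laplaceT T u τ) - inner ℝ f (toL2 (v τ)) := by
  rw [← inner_sub_right, ← integral_mul_eq_inner, indicatorFn]
  refine integral_congr_ae ?_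
  filter_upwards [Lp.coeFn_sub (laplaceT T u τ) (toL2 (v τ))] with x hx
  rw [hx, Pi.sub_apply]

/-- Up to an error `O(e^{-τT}/τ)` the indicator function is comparable to the energy of `v` in `D`,
with the sign given by the monotonicity condition. -/
theorem exists_indicatorFn_approx {γp γm : ℝ} (hp : 0 < γp) (hm : 0 < γm) {D : Set E3}
    (hD : MeasurableSet D) (hDl : D ⊆ {x | x 2 < 0}) {γ : E3 → Matrix (Fin 3) (Fin 3) ℝ}
    (hγ : IsCoefficient γ) (hbg : ∀ᵐ x : E3, x ∉ D → γ x = layered γp γm x) {f : L2} {T : ℝ}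
    (hT : 0 < T) {u : ℝ → H1} (hu : IsWaveSolution γ T f u) {v : ℝ → H1}
    (hv : ∀ τ, 1 ≤ τ → IsResolventSolution (layered γp γm) τ f (v τ)) :
    ∃ J : ℝ → ℝ,
      (∃ C, 0 < C ∧ ∀ τ, 1 ≤ τ →
        |indicatorFn T f u v τ - J τ| ≤ C * Real.exp (-(τ * T)) / τ) ∧
      (∃ C, 0 < C ∧ ∀ τ, 1 ≤ τ → |J τ| ≤ C * energyOn D (v τ)) ∧
      (MonoPlus γ D γm → ∃ c, 0 < c ∧ ∀ τ, 1 ≤ τ → c * energyOn D (v τ) ≤ -J τ) ∧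
      (MonoMinus γ D γm → ∃ c, 0 < c ∧ ∀ τ, 1 ≤ τ → c * energyOn D (v τ) ≤ J τ) := by
  have hγ₀ := isCoefficient_layered hp hm
  have hex : ∀ τ : ℝ, ∃ V : H1, 1 ≤ τ → IsResolventSolution γ τ f V := fun τ => by
    by_cases hτ : 1 ≤ τ
    · obtain ⟨V, hV⟩ := exists_isResolventSolution hγ (by linarith : τ ≠ 0) f
      exact ⟨V, fun _ => hV⟩
    · exact ⟨0, fun h => absurd h hτ⟩
  choose V hV using hex
  -- `J` replaces the truncated Laplace transform by the resolvent solution `V` of the perturbed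
  -- medium.
  refine ⟨fun τ => inner ℝ f (toL2 (V τ)) - inner ℝ f (toL2 (v τ)), ?_, ?_, ?_, ?_⟩
  · obtain ⟨C, hC, h⟩ := exists_laplaceT_error hγ hT hu
    refine ⟨C, hC, fun τ hτ => ?_⟩
    rw [indicatorFn_eq, sub_sub_sub_cancel_right]
    exact h τ hτ _ (hV τ hτ)
  · obtain ⟨C, hC, h⟩ := exists_abs_inner_sub_le hγ₀ hγ hD hbg f
    exact ⟨C, hC, fun τ hτ => h τ _ _ (hv τ hτ) (hV τ hτ)⟩
  · rintro ⟨c, hc, h⟩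
    refine ⟨min c γm / 2, half_pos (lt_min hc hm), fun τ hτ => ?_⟩
    rw [neg_sub]
    refine le_inner_sub_of_ge hc hm hγ₀ hγ hD hbg (ae_of_all _ fun x ξ => ?_)
      (ae_of_all _ fun x hx ξ => (quad_layered_self_of_lower (hDl hx) ξ).ge) ?_ (hv τ hτ) (hV τ hτ)
    · rw [quad_layered, real_inner_self_eq_norm_sq]
      have := layeredScalar_pos hp hm x
      positivity
    · filter_upwards [h] with x hx hxD ξ
      have h1 := hx hxD ξ
      rw [dotProduct_mulVec_eq_quad, dotProduct_self_eq_norm_sq] at h1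
      rw [quad_layered_self_of_lower (hDl hxD)]
      linarith
  · rintro ⟨c, hc, h⟩
    refine ⟨c, hc, fun τ hτ => ?_⟩
    refine le_inner_sub_of_le hγ₀ hγ hD hbg ?_ (hv τ hτ) (hV τ hτ)
    filter_upwards [h] with x hx hxD ξ
    have h1 := hx hxD ξ
    rw [dotProduct_mulVec_eq_quad, dotProduct_self_eq_norm_sq] at h1
    rw [quad_layered_self_of_lower (hDl hxD)]
    linarith

lemma tendsto_exp_mul_zero {T l : ℝ} {I J : ℝ → ℝ} {C : ℝ} (hTl : T < l)
    (hIJ : ∀ τ, 1 ≤ τ → |I τ - J τ| ≤ C * Real.exp (-(τ * T)) / τ)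
    (hJ : ∀ β, β < l → ∃ C', 0 < C' ∧ ∀ τ, 1 ≤ τ → |J τ| ≤ C' * Real.exp (-(β * τ))) :
    Tendsto (fun τ => Real.exp (τ * T) * I τ) atTop (𝓝 0) := by
  -- Any rate strictly between `T` and `l` makes `e^{τT} J` decay. The transform error decays only
  -- through its factor `1/τ`, since `e^{τT}` cancels its exponential.
  obtain ⟨C', -, hJ'⟩ := hJ ((T + l) / 2) (by linarith)
  have hlim : Tendsto (fun τ : ℝ => C / τ + C' * Real.exp (-((l - T) / 2 * τ))) atTop (𝓝 0) := by
    have h1 : Tendsto (fun τ : ℝ => C / τ) atTop (𝓝 0) := tendsto_const_nhds.div_atTop tendsto_id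
    have h2 : Tendsto (fun τ : ℝ => Real.exp (-((l - T) / 2 * τ))) atTop (𝓝 0) :=
      Real.tendsto_exp_neg_atTop_nhds_zero.comp
        (tendsto_id.const_mul_atTop (show 0 < (l - T) / 2 by linarith))
    simpa using h1.add (h2.const_mul C')
  refine squeeze_zero_norm' ?_ hlim
  filter_upwards [eventually_ge_atTop 1] with τ hτ
  have h1 := hIJ τ hτ
  have h2 := hJ' τ hτ
  have h3 : |I τ| ≤ C * Real.exp (-(τ * T)) / τ + C' * Real.exp (-((T + l) / 2 * τ)) := by
    have := abs_add_le (I τ - J τ) (J τ)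
    rw [sub_add_cancel] at this
    linarith
  rw [norm_mul, Real.norm_of_nonneg (Real.exp_pos _).le, Real.norm_eq_abs]
  refine (mul_le_mul_of_nonneg_left h3 (Real.exp_pos _).le).trans_eq ?_
  have e1 : Real.exp (τ * T) * Real.exp (-(τ * T)) = 1 := by
    rw [← Real.exp_add, add_neg_cancel, Real.exp_zero]
  have e2 : Real.exp (τ * T) * Real.exp (-((T + l) / 2 * τ)) = Real.exp (-((l - T) / 2 * τ)) := by
    rw [← Real.exp_add]; congr 1; ring
  rw [← e2]
  linear_combination (C / τ) * e1

lemma tendsto_exp_mul_atTop {T l : ℝ} {I J : ℝ → ℝ} {C : ℝ} (hC : 0 < C) (hTl : l < T)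
    (hIJ : ∀ τ, 1 ≤ τ → |I τ - J τ| ≤ C * Real.exp (-(τ * T)) / τ)
    (hJ : ∀ β, l < β → ∃ c, 0 < c ∧ ∃ τ₀, ∀ τ, τ₀ ≤ τ → c * Real.exp (-(β * τ)) ≤ J τ) :
    Tendsto (fun τ => Real.exp (τ * T) * I τ) atTop atTop := by
  obtain ⟨c, hc, τ₀, hJ'⟩ := hJ ((T + l) / 2) (by linarith)
  have hlim : Tendsto (fun τ : ℝ => c * Real.exp ((T - l) / 2 * τ) + -C) atTop atTop :=
    tendsto_atTop_add_const_right _ _ ((Real.tendsto_exp_atTop.comp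
      (tendsto_id.const_mul_atTop (show 0 < (T - l) / 2 by linarith))).const_mul_atTop hc)
  refine tendsto_atTop_mono' _ ?_ hlim
  filter_upwards [eventually_ge_atTop 1, eventually_ge_atTop τ₀] with τ hτ hτ'
  have h1 := (abs_le.1 (hIJ τ hτ)).1
  have h2 := hJ' τ hτ'
  have h3 : C * Real.exp (-(τ * T)) / τ ≤ C * Real.exp (-(τ * T)) :=
    div_le_self (by positivity) hτ
  have h4 : c * Real.exp (-((T + l) / 2 * τ)) - C * Real.exp (-(τ * T)) ≤ I τ := by linarith
  refine le_trans (le_of_eq ?_) (mul_le_mul_of_nonneg_left h4 (Real.exp_pos (τ * T)).le)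
  have e1 : Real.exp (τ * T) * Real.exp (-(τ * T)) = 1 := by
    rw [← Real.exp_add, add_neg_cancel, Real.exp_zero]
  have e2 : Real.exp (τ * T) * Real.exp (-((T + l) / 2 * τ)) = Real.exp ((T - l) / 2 * τ) := by
    rw [← Real.exp_add]; congr 1; ring
  rw [← e2]
  linear_combination C * e1

/-- Multiplicative constants contribute `log c / τ → 0`, so arbitrarily close exponential bounds
determine the rate. -/
lemma tendsto_log_of_exp_bounds {l : ℝ} {I : ℝ → ℝ}
    (hlow : ∀ β, l < β → ∃ c, 0 < c ∧ ∀ᶠ τ in atTop, c * Real.exp (-(β * τ)) ≤ |I τ|)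
    (hup : ∀ β, β < l → ∃ C, 0 < C ∧ ∀ᶠ τ in atTop, |I τ| ≤ C * Real.exp (-(β * τ))) :
    Tendsto (fun τ : ℝ => 1 / τ * Real.log |I τ|) atTop (𝓝 (-l)) := by
  have hlog : ∀ c : ℝ, 0 < c → ∀ β τ : ℝ, 0 < τ →
      1 / τ * Real.log (c * Real.exp (-(β * τ))) = Real.log c / τ - β := fun c hc β τ hτ => by
    rw [Real.log_mul hc.ne' (Real.exp_pos _).ne', Real.log_exp]
    field_simp
    ring
  have hlim : ∀ c β : ℝ, Tendsto (fun τ : ℝ => Real.log c / τ - β) atTop (𝓝 (0 - β)) :=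
    fun c β => (tendsto_const_nhds.div_atTop tendsto_id).sub tendsto_const_nhds
  -- Any rate above `l` would do: this bound only ensures `|I τ| > 0`, which monotonicity of the
  -- logarithm requires in the upper estimate.
  obtain ⟨c₀, hc₀, hlow₀⟩ := hlow (l + 1) (by linarith)
  refine tendsto_order.2 ⟨fun a ha => ?_, fun a ha => ?_⟩
  · obtain ⟨c, hc, h⟩ := hlow ((l - a) / 2) (by linarith)
    filter_upwards [h, eventually_gt_atTop 0,
      (hlim c ((l - a) / 2)).eventually_const_lt (show a < 0 - (l - a) / 2 by linarith)]
      with τ h1 h2 h3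
    refine h3.trans_le ?_
    rw [← hlog c hc _ τ h2]
    gcongr
  · obtain ⟨C, hC, h⟩ := hup ((l - a) / 2) (by linarith)
    filter_upwards [h, hlow₀, eventually_gt_atTop 0,
      (hlim C ((l - a) / 2)).eventually_lt_const (show 0 - (l - a) / 2 < a by linarith)]
      with τ h1 h2 h3 h4
    refine lt_of_le_of_lt ?_ h4
    rw [← hlog C hC _ τ h3]
    have : 0 < |I τ| := lt_of_lt_of_le (by positivity) h2
    gcongr

lemma tendsto_log_indicator {T l : ℝ} {I J : ℝ → ℝ} {C : ℝ} (hC : 0 < C) (hTl : l < T)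
    (hIJ : ∀ τ, 1 ≤ τ → |I τ - J τ| ≤ C * Real.exp (-(τ * T)) / τ)
    (hlow : ∀ β, l < β → ∃ c, 0 < c ∧ ∃ τ₀, ∀ τ, τ₀ ≤ τ → c * Real.exp (-(β * τ)) ≤ |J τ|)
    (hup : ∀ β, β < l → ∃ C', 0 < C' ∧ ∀ τ, 1 ≤ τ → |J τ| ≤ C' * Real.exp (-(β * τ))) :
    Tendsto (fun τ : ℝ => 1 / τ * Real.log |I τ|) atTop (𝓝 (-l)) := by
  have herr : ∀ τ, 1 ≤ τ → |I τ - J τ| ≤ C * Real.exp (-(τ * T)) := fun τ hτ =>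
    (hIJ τ hτ).trans (div_le_self (by positivity) hτ)
  refine tendsto_log_of_exp_bounds (fun β hβ => ?_) fun β hβ => ?_
  · obtain ⟨β', h1, h2⟩ := exists_between (lt_min hβ hTl)
    obtain ⟨c, hc, τ₀, h⟩ := hlow β' h1
    refine ⟨c / 2, half_pos hc, ?_⟩
    have hlim : Tendsto (fun τ : ℝ => C * Real.exp (-((T - β') * τ))) atTop (𝓝 (C * 0)) :=
      (Real.tendsto_exp_neg_atTop_nhds_zero.comp (tendsto_id.const_mul_atTop
        (show 0 < T - β' by linarith [min_le_right β T]))).const_mul C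
    rw [mul_zero] at hlim
    filter_upwards [eventually_ge_atTop 1, eventually_ge_atTop τ₀,
      hlim.eventually_lt_const (half_pos hc)] with τ h3 h4 h5
    have h6 := h τ h4
    have h7 := herr τ h3
    have h8 : |J τ| ≤ |I τ| + |I τ - J τ| := by
      have := abs_sub (I τ) (I τ - J τ)
      rwa [sub_sub_cancel] at this
    have h9 : C * Real.exp (-(τ * T)) ≤ c / 2 * Real.exp (-(β' * τ)) := by
      have e : Real.exp (-(τ * T)) = Real.exp (-((T - β') * τ)) * Real.exp (-(β' * τ)) := by
        rw [← Real.exp_add]; congr 1; ring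
      rw [e, ← mul_assoc]
      exact mul_le_mul_of_nonneg_right h5.le (Real.exp_pos _).le
    have h10 : Real.exp (-(β * τ)) ≤ Real.exp (-(β' * τ)) := by
      refine Real.exp_le_exp.2 (neg_le_neg (mul_le_mul_of_nonneg_right ?_ (by linarith)))
      exact (h2.trans_le (min_le_left _ _)).le
    have h11 : c / 2 * Real.exp (-(β * τ)) ≤ c / 2 * Real.exp (-(β' * τ)) := by gcongr
    linarith
  · obtain ⟨C', hC', h⟩ := hup β hβ
    refine ⟨C + C', by positivity, ?_⟩
    filter_upwards [eventually_ge_atTop 1] with τ h3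
    have h6 := h τ h3
    have h7 := herr τ h3
    have h8 : |I τ| ≤ |I τ - J τ| + |J τ| := by
      have := abs_add_le (I τ - J τ) (J τ)
      rwa [sub_add_cancel] at this
    have h9 : C * Real.exp (-(τ * T)) ≤ C * Real.exp (-(β * τ)) := by
      refine mul_le_mul_of_nonneg_left (Real.exp_le_exp.2 (neg_le_neg ?_)) hC.le
      rw [mul_comm τ T]
      exact mul_le_mul_of_nonneg_right (by linarith) (by linarith)
    linarith

lemma ae_eq_zero_of_notMem_open {B : Set E3} (hB : volume (frontier B) = 0) (hBo : IsOpen B)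
    {f : L2} (hf : ∀ᵐ x : E3, x ∉ closure B → f x = 0) : ∀ᵐ x : E3, x ∉ B → f x = 0 := by
  filter_upwards [hf, measure_eq_zero_iff_ae_notMem.1 hB] with x h1 h2 hx
  exact h1 fun hcl => h2 ⟨hcl, by rwa [hBo.interior_eq]⟩

lemma exists_exp_le_mul {E K : ℝ → ℝ} {c l : ℝ} (hc : 0 < c)
    (hE : ∀ β, l < β → ∃ c, 0 < c ∧ ∃ τ₀, ∀ τ, τ₀ ≤ τ → c * Real.exp (-(β * τ)) ≤ E τ)
    (hK : ∀ τ, 1 ≤ τ → c * E τ ≤ K τ) :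
    ∀ β, l < β → ∃ c, 0 < c ∧ ∃ τ₀, ∀ τ, τ₀ ≤ τ → c * Real.exp (-(β * τ)) ≤ K τ := by
  intro β hβ
  obtain ⟨c', hc', τ₀, h⟩ := hE β hβ
  refine ⟨c * c', by positivity, max τ₀ 1, fun τ hτ => ?_⟩
  rw [mul_assoc]
  exact (mul_le_mul_of_nonneg_left (h τ ((le_max_left _ _).trans hτ)) hc.le).trans
    (hK τ ((le_max_right _ _).trans hτ))

end TwoLayer

end

/-! ### The main theorem -/

theorem mainTheorem2
    (γp γm : ℝ) (hγp : 0 < γp) (hγm : 0 < γm) (hγ_ne : γp ≠ γm)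
    (D B : Set TwoLayer.E3)
    (hD_meas : MeasurableSet D) (hD_ne : D.Nonempty) (hD_bdd : Bornology.IsBounded D)
    (hD_lower : closure D ⊆ {x | x 2 < 0})
    (hD_conn : IsConnected ({x : TwoLayer.E3 | x 2 < 0} \ D))
    (hB_open : IsOpen B) (hB_ne : B.Nonempty) (hB_bdd : Bornology.IsBounded B)
    (hB_upper : closure B ⊆ {x | 0 < x 2})
    (hDB : (TwoLayer.HasC1Boundary D ∧ TwoLayer.ConeCondition B) ∨
      (TwoLayer.ConeCondition D ∧ TwoLayer.ConeCondition B ∧ Convex ℝ B))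
    (γ : TwoLayer.E3 → Matrix (Fin 3) (Fin 3) ℝ) (hγ : TwoLayer.IsCoefficient γ)
    (hγ_bg : ∀ᵐ x : TwoLayer.E3, x ∉ D → γ x = TwoLayer.layered γp γm x)
    (f : TwoLayer.L2) (hf : TwoLayer.EmissionCondition B f)
    (T : ℝ) (hT : 0 < T)
    (u : ℝ → TwoLayer.H1) (hu : TwoLayer.IsWaveSolution γ T f u)
    (v : ℝ → TwoLayer.H1)
    (hv : ∀ τ : ℝ, 1 ≤ τ →
      TwoLayer.IsResolventSolution (TwoLayer.layered γp γm) τ f (v τ)) :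
    (T < 2 * TwoLayer.opticalSetDist γp γm D B →
      Tendsto (fun τ : ℝ => Real.exp (τ * T) * TwoLayer.indicatorFn T f u v τ) atTop (𝓝 0)) ∧
    (2 * TwoLayer.opticalSetDist γp γm D B < T → TwoLayer.MonoPlus γ D γm →
      Tendsto (fun τ : ℝ => Real.exp (τ * T) * TwoLayer.indicatorFn T f u v τ) atTop atBot) ∧
    (2 * TwoLayer.opticalSetDist γp γm D B < T → TwoLayer.MonoMinus γ D γm →
      Tendsto (fun τ : ℝ => Real.exp (τ * T) * TwoLayer.indicatorFn T f u v τ) atTop atTop) ∧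
    (2 * TwoLayer.opticalSetDist γp γm D B < T →
      TwoLayer.MonoPlus γ D γm ∨ TwoLayer.MonoMinus γ D γm →
      Tendsto (fun τ : ℝ => 1 / τ * Real.log |TwoLayer.indicatorFn T f u v τ|) atTop
        (𝓝 (-2 * TwoLayer.opticalSetDist γp γm D B))) := by
  have hDl : D ⊆ {x : TwoLayer.E3 | x 2 < 0} := subset_closure.trans hD_lower
  have hBu : B ⊆ {x : TwoLayer.E3 | 0 < x 2} := subset_closure.trans hB_upper
  have hBc : TwoLayer.ConeCondition B := hDB.elim (·.2) (·.2.1)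
  have hDi : D ⊆ closure (interior D) :=
    hDB.elim (fun h => h.1.subset_closure_interior) fun h => h.1.subset_closure_interior
  have hlow : ∀ β, 2 * TwoLayer.opticalSetDist γp γm D B < β → _ := fun β hβ =>
    TwoLayer.exists_energyOn_ge hγp hγm hD_meas hD_ne hDi hDl hB_ne hB_open hBc hB_upper hf hv hβ
  have hup : ∀ β, β < 2 * TwoLayer.opticalSetDist γp γm D B → _ := fun β hβ =>
    TwoLayer.exists_energyOn_le hγp hγm hD_meas hD_ne hD_bdd hDl hB_ne hB_bdd hBu
      (TwoLayer.ae_eq_zero_of_notMem_open (hBc.volume_frontier hB_open) hB_open hf.1) hv hβ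
  obtain ⟨J, ⟨C, hC, hIJ⟩, ⟨C', hC', hJE⟩, hplus, hminus⟩ :=
    TwoLayer.exists_indicatorFn_approx hγp hγm hD_meas hDl hγ hγ_bg hT hu hv
  have hJup : ∀ β, β < 2 * TwoLayer.opticalSetDist γp γm D B →
      ∃ K, 0 < K ∧ ∀ τ, 1 ≤ τ → |J τ| ≤ K * Real.exp (-(β * τ)) := fun β hβ => by
    obtain ⟨K, hK, h⟩ := hup β hβ
    refine ⟨C' * K, by positivity, fun τ hτ => (hJE τ hτ).trans ?_⟩
    rw [mul_assoc]
    exact mul_le_mul_of_nonneg_left (h τ hτ) hC'.le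
  refine ⟨fun hlt => TwoLayer.tendsto_exp_mul_zero hlt hIJ hJup, fun hlt hM => ?_,
    fun hlt hM => ?_, fun hlt hM => ?_⟩
  · obtain ⟨c, hc, h⟩ := hplus hM
    -- A raised coefficient makes `J` negative, so the divergence criterion is applied to `-I` and
    -- `-J`.
    have h1 := TwoLayer.tendsto_exp_mul_atTop (I := fun τ => -TwoLayer.indicatorFn T f u v τ)
      (J := fun τ => -J τ) hC hlt
      (fun τ hτ => by rw [neg_sub_neg, abs_sub_comm]; exact hIJ τ hτ)
      (TwoLayer.exists_exp_le_mul hc hlow h)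
    simpa [Function.comp_def] using tendsto_neg_atTop_atBot.comp h1
  · obtain ⟨c, hc, h⟩ := hminus hM
    exact TwoLayer.tendsto_exp_mul_atTop hC hlt hIJ (TwoLayer.exists_exp_le_mul hc hlow h)
  · obtain ⟨c, hc, h⟩ : ∃ c, 0 < c ∧ ∀ τ, 1 ≤ τ → c * TwoLayer.energyOn D (v τ) ≤ |J τ| := by
      rcases hM with hM | hM
      · obtain ⟨c, hc, h⟩ := hplus hM
        exact ⟨c, hc, fun τ hτ => (h τ hτ).trans (neg_le_abs _)⟩
      · obtain ⟨c, hc, h⟩ := hminus hM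
        exact ⟨c, hc, fun τ hτ => (h τ hτ).trans (le_abs_self _)⟩
    rw [neg_mul]
    exact TwoLayer.tendsto_log_indicator hC hlt hIJ (TwoLayer.exists_exp_le_mul hc hlow h) hJup
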